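/- **Setting.** Let $\Omega\subset\mathbb R^2$ be a bounded domain with smooth boundary $\Gamma$ (a finite disjoint union of smooth regular simple closed curves, with $\Omega$ on the left of each), with outward unit normal $\nu=(\nu_1,\nu_2)^\top$, $\nu^\perp=(-\nu_2,\nu_1)^\top$, arc length $s$, and tangential derivative $\frac{d}{ds}$ in direction $\nu^\perp$. Let $A=\begin{bmatrix}0&-1\\1&0\end{bmatrix}$. Let $\lambda,\mu,\nu_p,\nu_u,B,\rho_s,\rho_f,\rho_a,\phi,\kappa,\omega$ be real with $\mu,\lambda+\mu,\rho_f,\phi,\kappa,\omega>0$, $B\ne0$, $\nu_p\neq\nu_u$, $\nu_p\ne\frac12$, $\nu_u\ne\frac12$, $\nu_u\neq-1$, and put $\rho=(1-\phi)\rho_s+\phi\rho_f$, $\alpha=\frac{3(\nu_u-\nu_p)}{B(1-2\nu_p)(1+\nu_u)}$, $R=\frac{2\phi^2\mu B^2(1-2\nu_p)(1+\nu_u)^2}{9(\nu_u-\nu_p)(1-2\nu_u)}$, $$\beta=\frac{\omega\phi^2\rho_f\kappa}{i\phi^2+\omega\kappa(\rho_a+\phi\rho_f)},\quad q=\frac{\omega^2\phi^2\rho_f}{\beta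 R},\quad \gamma=-\frac{i\omega\rho_f(\alpha-\beta)}{\beta},\quad \epsilon=\frac{i\omega\gamma(\alpha-\beta)}{q(\lambda+2\mu)},$$ $$k_p=\omega\sqrt{\tfrac{\rho-\beta\rho_f}{\lambda+2\mu}},\qquad k_s=\omega\sqrt{\tfrac{\rho-\beta\rho_f}{\mu}}$$ (principal square roots). Let $k_1,k_2\in\mathbb C$ with $\operatorname{Im}k_1,\operatorname{Im}k_2\ge0$, $k_1^2\neq k_2^2$, $k_1^2+k_2^2=q(1+\epsilon)+k_p^2$ and $k_1^2k_2^2=qk_p^2$. For $x\ne y$ let $\gamma_k(x,y)=\frac i4H^{(1)}_0(k|x-y|)$ and $$E_{11}=\tfrac1\mu\gamma_{k_s}I+\tfrac1{(\rho-\beta\rho_f)\omega^2}\nabla_x\nabla_x^\top\Big[\gamma_{k_s}-\tfrac{k_p^2-k_2^2}{k_1^2-k_2^2}\gamma_{k_1}+\tfrac{k_p^2-k_1^2}{k_1^2-k_2^2}\gamma_{k_2}\Big],$$ $$E_{12}=\tfrac{i\omega\gamma}{(\lambda+2\mu)(k_1^2-k_2^2)}\nabla_x[\gamma_{k_1}-\gamma_{k_2}],\qquad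 E_{21}=-\tfrac{\gamma}{(\lambda+2\mu)(k_1^2-k_2^2)}\nabla_x[\gamma_{k_1}-\gamma_{k_2}],$$ $$E_{22}=\tfrac{i\rho_f\omega}{\beta(k_1^2-k_2^2)}\big[(k_p^2-k_1^2)\gamma_{k_1}-(k_p^2-k_2^2)\gamma_{k_2}\big],\qquad E=\begin{bmatrix}E_{11}&E_{12}\\E_{21}^\top&E_{22}\end{bmatrix}.$$ Let $T(\partial,\nu)u=2\mu\partial_\nu u+\lambda\nu\,\nabla\cdot u+\mu\nu^\perp(\partial_2u_1-\partial_1u_2)$ and $\widetilde T(\partial,\nu)=\begin{bmatrix}T(\partial,\nu)&-\alpha\nu\\-i\omega\beta\nu^\top&\frac{i\beta}{\omega\rho_f}\partial_\nu\end{bmatrix}$. For Hölder continuous $u:\Gamma\to\mathbb C^2$, $p:\Gamma\to\mathbb C$ (any positive exponent) and $x\in\Gamma$ put $$K'\begin{bmatrix}u\\p\end{bmatrix}(x)=\mathrm{p.v.}\!\int_\Gamma\widetilde T(\partial_x,\nu_x)\Big(E(x,y)^\top\begin{bmatrix}u(y)\\p(y)\end{bmatrix}\Big)ds_y,\qquad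 K'=\begin{bmatrix}K_1'&K_2'\\K_3'&K_4'\end{bmatrix},$$ where p.v. denotes the Cauchy principal value $\lim_{\varepsilon\to0+}\int_{\{y\in\Gamma:|x-y|>\varepsilon\}}$. **Lemma.** For all Hölder continuous $u,p$ and all $x\in\Gamma$ the principal values exist, $K'$ acts as the above block operator, and at $x$ $$K'_j=K'^1_j+\frac{d}{ds}K'^2_j,\qquad j=1,\dots,4,$$ where the functions to which $\frac d{ds}$ is applied are differentiable along $\Gamma$, with $C_0=\frac{\beta\gamma}{\rho_f(\lambda+2\mu)(k_1^2-k_2^2)}$ and $$K'^1_1(u)(x)=\int_\Gamma\nu_x\nabla_x^\top\Big[-(\gamma_{k_s}-\gamma_{k_1})+\tfrac{k_2^2-q}{k_1^2-k_2^2}(\gamma_{k_1}-\gamma_{k_2})\Big]u(y)\,ds_y+\int_\Gamma\big[\partial_{\nu_x}\gamma_{k_s}I-\alpha\nu_xE_{12}^\top\big]u(y)\,ds_y,$$ $$K'^2_1(u)(x)=A\int_\Gamma[2\mu E_{11}-\gamma_{k_s}I]u(y)\,ds_y,$$ $$K'^1_2(p)(x)=\int_\Gamma\Big[\tfrac{\gamma}{k_1^2-k_2^2}(k_1^2\gamma_{k_1}-k_2^2\gamma_{k_2})\nu_x-\alpha\nu_xE_{22}\Big]p(y)\,ds_y,$$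 $$K'^2_2(p)(x)=-\tfrac{2\mu\gamma}{(\lambda+2\mu)(k_1^2-k_2^2)}A\int_\Gamma\nabla_x[\gamma_{k_1}-\gamma_{k_2}]p(y)\,ds_y,$$ $$K'^1_3(u)(x)=\int_\Gamma\big[-i\omega\beta\nu_x^\top E_{11}+C_0(k_1^2\gamma_{k_1}-k_2^2\gamma_{k_2})\nu_x^\top\big]u(y)\,ds_y,$$ $$K'^2_3(u)(x)=C_0\int_\Gamma\nabla_x^\top[\gamma_{k_1}-\gamma_{k_2}]A\,u(y)\,ds_y,$$ $$K'^1_4(p)(x)=-\int_\Gamma\nu_x^\top\Big[i\omega\beta E_{21}+\nabla_x\Big(\tfrac{k_p^2-k_1^2}{k_1^2-k_2^2}\gamma_{k_1}-\tfrac{k_p^2-k_2^2}{k_1^2-k_2^2}\gamma_{k_2}\Big)\Big]p(y)\,ds_y,\qquad K'^2_4(p)(x)=0,$$ all fundamental solutions being evaluated at $(x,y)$. Moreover the kernels (entrywise) of all $K'^i_j$ are weakly singular, i.e. continuous on $\{(x,y)\in\Gamma\times\Gamma:x\neq y\}$ and bounded there by $C|x-y|^{-a}$ for some $C$ and some $0\le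 a<1$, and the integrals above exist for every $x\in\Gamma$. -/

import Mathlib

open Filter Topology Matrix MeasureTheory
open scoped ContDiff

namespace Poro

noncomputable section

/-- The Euclidean plane. -/
abbrev Plane : Type := EuclideanSpace ℝ (Fin 2)

/-- A vector of the plane, regarded as a complex vector. -/
def toC (v : Plane) : Fin 2 → ℂ := fun i => ((v i : ℝ) : ℂ)

/-! ### Hankel function and Helmholtz fundamental solution -/

/-- Bessel function of the first kind of order zero. -/
def besselJ0 (z : ℂ) : ℂ :=
  ∑' m : ℕ, (-1 : ℂ) ^ m * (z / 2) ^ (2 * m) / (Nat.factorial m : ℂ) ^ 2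

/-- Bessel function of the second kind of order zero (principal branch of the logarithm). -/
def besselY0 (z : ℂ) : ℂ :=
  (2 / (Real.pi : ℂ)) * (Complex.log (z / 2) + (Real.eulerMascheroniConstant : ℂ)) * besselJ0 z -
    (2 / (Real.pi : ℂ)) *
      ∑' m : ℕ, (-1 : ℂ) ^ m * ((harmonic m : ℚ) : ℂ) * (z / 2) ^ (2 * m) / (Nat.factorial m : ℂ) ^ 2

/-- Hankel function of the first kind of order zero. -/
def hankel0 (z : ℂ) : ℂ := besselJ0 z + Complex.I * besselY0 z

/-- Fundamental solution `(i/4) H_0^{(1)}(k|x-y|)` of the Helmholtz equation. -/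
def helm (k : ℂ) (x y : Plane) : ℂ :=
  Complex.I / 4 * hankel0 (k * ((‖x - y‖ : ℝ) : ℂ))

/-! ### Differential operators -/

/-- Partial derivative with respect to the `i`-th coordinate. -/
def pd (i : Fin 2) (f : Plane → ℂ) (x : Plane) : ℂ :=
  fderiv ℝ f x (EuclideanSpace.single i (1 : ℝ))

/-- Gradient. -/
def grad (f : Plane → ℂ) (x : Plane) : Fin 2 → ℂ := fun i => pd i f x

/-- The matrix `∇∇ᵀ f` of second derivatives. -/
def hess (f : Plane → ℂ) (x : Plane) : Matrix (Fin 2) (Fin 2) ℂ :=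
  Matrix.of fun i j => pd i (fun x' => pd j f x') x

/-- Divergence. -/
def dvg (v : Plane → Fin 2 → ℂ) (x : Plane) : ℂ := ∑ i, pd i (fun x' => v x' i) x

/-- Directional derivative `n · ∇ f`. -/
def dirDeriv (n : Plane) (f : Plane → ℂ) (x : Plane) : ℂ := toC n ⬝ᵥ grad f x

/-- `n^⊥ = (-n_2, n_1)`. -/
def perp (n : Plane) : Fin 2 → ℂ := ![-toC n 1, toC n 0]

/-- The rotation matrix `A`. -/
def rotA : Matrix (Fin 2) (Fin 2) ℂ := !![0, -1; 1, 0]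

/-! ### Material parameters -/

/-- The material parameters and the frequency; the conditions say that the Lamé parameters are
admissible, that the physical quantities dividing somewhere are positive, and that the
fractions defining `α` and `R` have nonzero denominators and `R ≠ 0`. -/
structure Medium where
  lam : ℝ
  mu : ℝ
  nuP : ℝ
  nuU : ℝ
  skempton : ℝ
  rhoS : ℝ
  rhoF : ℝ
  rhoA : ℝ
  phi : ℝ
  kappa : ℝ
  omega : ℝ
  mu_pos : 0 < mu
  lam_add_mu_pos : 0 < lam + mu
  rhoF_pos : 0 < rhoF
  phi_pos : 0 < phi
  kappa_pos : 0 < kappa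
  omega_pos : 0 < omega
  skempton_ne : skempton ≠ 0
  nuP_ne_nuU : nuP ≠ nuU
  nuP_ne_half : nuP ≠ 1 / 2
  nuU_ne_half : nuU ≠ 1 / 2
  nuU_ne_neg_one : nuU ≠ -1

namespace Medium

variable (P : Medium)

/-- Bulk density. -/
def rho : ℝ := (1 - P.phi) * P.rhoS + P.phi * P.rhoF

/-- Compressibility. -/
def alpha : ℝ :=
  3 * (P.nuU - P.nuP) / (P.skempton * (1 - 2 * P.nuP) * (1 + P.nuU))

/-- The constitutive coefficient `R`. -/
def coefR : ℝ :=
  2 * P.phi ^ 2 * P.mu * P.skempton ^ 2 * (1 - 2 * P.nuP) * (1 + P.nuU) ^ 2 /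
    (9 * (P.nuU - P.nuP) * (1 - 2 * P.nuU))

/-- The coefficient `β` of the Biot system. -/
def beta : ℂ :=
  ((P.omega * P.phi ^ 2 * P.rhoF * P.kappa : ℝ) : ℂ) /
    (Complex.I * ((P.phi ^ 2 : ℝ) : ℂ) +
      ((P.omega * P.kappa * (P.rhoA + P.phi * P.rhoF) : ℝ) : ℂ))

/-- The coefficient `q` of the Biot system. -/
def q : ℂ := ((P.omega ^ 2 * P.phi ^ 2 * P.rhoF : ℝ) : ℂ) / (P.beta * (P.coefR : ℂ))

/-- The coefficient `γ` of the Biot system. -/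
def gam : ℂ :=
  -(Complex.I * (P.omega : ℂ) * (P.rhoF : ℂ) * ((P.alpha : ℂ) - P.beta)) / P.beta

/-- The compressional wave number. -/
def kP : ℂ :=
  (P.omega : ℂ) *
    (((P.rho : ℂ) - P.beta * (P.rhoF : ℂ)) / ((P.lam + 2 * P.mu : ℝ) : ℂ)) ^ (1 / 2 : ℂ)

/-- The shear wave number. -/
def kS : ℂ :=
  (P.omega : ℂ) * (((P.rho : ℂ) - P.beta * (P.rhoF : ℂ)) / (P.mu : ℂ)) ^ (1 / 2 : ℂ)

/-- The coefficient `ε` of the characteristic system. -/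
def eps : ℂ :=
  Complex.I * (P.omega : ℂ) * P.gam * ((P.alpha : ℂ) - P.beta) /
    (P.q * ((P.lam + 2 * P.mu : ℝ) : ℂ))

/-- `k₁, k₂` are wave numbers of the medium: roots, with nonnegative imaginary parts, of the
characteristic system. -/
def IsWaveNumbers (k₁ k₂ : ℂ) : Prop :=
  0 ≤ k₁.im ∧ 0 ≤ k₂.im ∧
    k₁ ^ 2 + k₂ ^ 2 = P.q * (1 + P.eps) + P.kP ^ 2 ∧ k₁ ^ 2 * k₂ ^ 2 = P.q * P.kP ^ 2

/-! ### Boundary operators -/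

/-- The traction operator `T(∂, n)`, applied to the displacement field `u` at the point `x`. -/
def traction (n : Plane) (u : Plane → Fin 2 → ℂ) (x : Plane) : Fin 2 → ℂ :=
  (2 * (P.mu : ℂ)) • (fun i => dirDeriv n (fun x' => u x' i) x) +
    ((P.lam : ℂ) * dvg u x) • toC n +
    ((P.mu : ℂ) * (pd 1 (fun x' => u x' 0) x - pd 0 (fun x' => u x' 1) x)) • perp n

/-- The Neumann operator `T̃(∂, n)`, applied to the field `U = (u, p)` at the point `x`. -/
def neumann (n : Plane) (U : Plane → (Fin 2 → ℂ) × ℂ) (x : Plane) : (Fin 2 → ℂ) × ℂ :=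
  (P.traction n (fun x' => (U x').1) x - ((P.alpha : ℂ) * (U x).2) • toC n,
    -(Complex.I * (P.omega : ℂ) * P.beta) * (toC n ⬝ᵥ (U x).1) +
      Complex.I * P.beta / ((P.omega : ℂ) * (P.rhoF : ℂ)) *
        dirDeriv n (fun x' => (U x').2) x)

/-! ### The fundamental solution -/

variable (k₁ k₂ : ℂ)

/-! The blocks of the matrix `E(x,y)`; all derivatives act on `x`. -/

def E11 (x y : Plane) : Matrix (Fin 2) (Fin 2) ℂ :=
  (1 / (P.mu : ℂ) * helm P.kS x y) • (1 : Matrix (Fin 2) (Fin 2) ℂ) +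
    (1 / (((P.rho : ℂ) - P.beta * (P.rhoF : ℂ)) * (P.omega : ℂ) ^ 2)) •
      hess (fun x' => helm P.kS x' y
        - (P.kP ^ 2 - k₂ ^ 2) / (k₁ ^ 2 - k₂ ^ 2) * helm k₁ x' y
        + (P.kP ^ 2 - k₁ ^ 2) / (k₁ ^ 2 - k₂ ^ 2) * helm k₂ x' y) x

def E12 (x y : Plane) : Fin 2 → ℂ :=
  (Complex.I * (P.omega : ℂ) * P.gam /
      (((P.lam + 2 * P.mu : ℝ) : ℂ) * (k₁ ^ 2 - k₂ ^ 2))) •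
    grad (fun x' => helm k₁ x' y - helm k₂ x' y) x

def E21 (x y : Plane) : Fin 2 → ℂ :=
  (-P.gam / (((P.lam + 2 * P.mu : ℝ) : ℂ) * (k₁ ^ 2 - k₂ ^ 2))) •
    grad (fun x' => helm k₁ x' y - helm k₂ x' y) x

def E22 (x y : Plane) : ℂ :=
  Complex.I * (P.rhoF : ℂ) * (P.omega : ℂ) / (P.beta * (k₁ ^ 2 - k₂ ^ 2)) *
    ((P.kP ^ 2 - k₁ ^ 2) * helm k₁ x y - (P.kP ^ 2 - k₂ ^ 2) * helm k₂ x y)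

/-- `E(x,y)ᵀ c` for the block matrix `E = [E11, E12; E21ᵀ, E22]` and `c = (u, p)`. -/
def ETmul (x y : Plane) (c : (Fin 2 → ℂ) × ℂ) : (Fin 2 → ℂ) × ℂ :=
  ((P.E11 k₁ k₂ x y)ᵀ *ᵥ c.1 + c.2 • P.E21 k₁ k₂ x y,
    P.E12 k₁ k₂ x y ⬝ᵥ c.1 + P.E22 k₁ k₂ x y * c.2)

/-! ### The kernels `ker_j_2` of the operators `K'^2_j` -/

def ker_1_2 (x y : Plane) : Matrix (Fin 2) (Fin 2) ℂ :=
  rotA * ((2 * (P.mu : ℂ)) • P.E11 k₁ k₂ x y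
    - helm P.kS x y • (1 : Matrix (Fin 2) (Fin 2) ℂ))

def ker_2_2 (x y : Plane) : Fin 2 → ℂ :=
  (-(2 * (P.mu : ℂ) * P.gam / (((P.lam + 2 * P.mu : ℝ) : ℂ) * (k₁ ^ 2 - k₂ ^ 2)))) •
    (rotA *ᵥ grad (fun x' => helm k₁ x' y - helm k₂ x' y) x)

/-- The constant `C_0`. -/
def C0 : ℂ :=
  P.beta * P.gam / ((P.rhoF : ℂ) * ((P.lam + 2 * P.mu : ℝ) : ℂ) * (k₁ ^ 2 - k₂ ^ 2))

/-- A row vector. -/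
def ker_3_2 (x y : Plane) : Fin 2 → ℂ :=
  P.C0 k₁ k₂ • (grad (fun x' => helm k₁ x' y - helm k₂ x' y) x ᵥ* rotA)

end Medium

/-! ### Function classes on a set -/

/-- `f` is Hölder continuous on `G`, with some positive exponent. -/
def IsHolderOn {W : Type*} [NormedAddCommGroup W] (G : Set Plane) (f : Plane → W) : Prop :=
  ∃ C r : NNReal, 0 < r ∧ HolderOnWith C r f G

/-- A scalar kernel on the curve `G` is weakly singular: continuous off the diagonal and bounded
there by `C |x - y|^{-a}` with some `a < 1`. -/
def WeaklySingularOn (G : Set Plane) (k : Plane → Plane → ℂ) : Prop :=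
  ContinuousOn (fun w : Plane × Plane => k w.1 w.2) {w | w.1 ∈ G ∧ w.2 ∈ G ∧ w.1 ≠ w.2} ∧
    ∃ C a : ℝ, 0 ≤ a ∧ a < 1 ∧ ∀ x ∈ G, ∀ y ∈ G, x ≠ y → ‖k x y‖ ≤ C * ‖x - y‖ ^ (-a)

/-! ### Smooth boundaries -/

/-- The unit normal `(c_2', -c_1') / |c'|` lying to the right of a regular plane curve. -/
def curveNormal (c : ℝ → Plane) (t : ℝ) : Plane :=
  ‖deriv c t‖⁻¹ • !₂[deriv c t 1, -(deriv c t 0)]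

/-- The boundary of `Ω` is smooth: it is the disjoint union of finitely many smooth regular simple
closed curves, each oriented so that `Ω` lies locally to its left and the complement of the closure
of `Ω` to its right (the outer boundary curve is then counterclockwise). -/
structure SmoothBoundary (Ω : Set Plane) where
  n : ℕ
  z : Fin n → ℝ → Plane
  smooth : ∀ j, ContDiff ℝ ∞ (z j)
  periodic : ∀ j, Function.Periodic (z j) (2 * Real.pi)
  regular : ∀ j t, deriv (z j) t ≠ 0
  simple : ∀ i j s t, z i s = z j t → i = j ∧ ∃ m : ℤ, t = s + m * (2 * Real.pi)
  range_eq : ⋃ j, Set.range (z j) = frontier Ω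
  outward : ∀ j t, ∀ᶠ ε : ℝ in 𝓝[>] 0,
    z j t + ε • curveNormal (z j) t ∉ closure Ω ∧ z j t - ε • curveNormal (z j) t ∈ Ω

namespace SmoothBoundary

variable {Ω : Set Plane} (S : SmoothBoundary Ω)

open Classical in
/-- Outward unit normal at the boundary point `x` (zero off the boundary). -/
def normal (x : Plane) : Plane :=
  if h : ∃ a : Fin S.n × ℝ, S.z a.1 a.2 = x then curveNormal (S.z h.choose.1) h.choose.2 else 0

variable {W : Type*} [NormedAddCommGroup W] [NormedSpace ℝ W]

/-- `f` is differentiable along the boundary at `x`. -/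
def ArcDifferentiableAt (f : Plane → W) (x : Plane) : Prop :=
  ∀ j t, S.z j t = x → DifferentiableAt ℝ (fun s => f (S.z j s)) t

open Classical in
/-- The arc length derivative `df/ds` at the boundary point `x` (zero off the boundary). -/
def arcDeriv (f : Plane → W) (x : Plane) : W :=
  if h : ∃ a : Fin S.n × ℝ, S.z a.1 a.2 = x then
    ‖deriv (S.z h.choose.1) h.choose.2‖⁻¹ •
      deriv (fun s => f (S.z h.choose.1 s)) h.choose.2
  else 0

theorem deriv_add_period {c : ℝ → W} {T : ℝ} (m : ℤ) (hc : Function.Periodic c T) (t : ℝ) :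
    deriv c (t + m * T) = deriv c t := by
  have h : (fun s => c (s + m * T)) = c := funext (hc.int_mul m)
  have h2 := deriv_comp_add_const c (m * T) t
  rw [h] at h2
  exact h2.symm

/-- The outward normal does not depend on the parameter that represents the point. -/
theorem normal_apply (j : Fin S.n) (t : ℝ) : S.normal (S.z j t) = curveNormal (S.z j) t := by
  have h : ∃ a : Fin S.n × ℝ, S.z a.1 a.2 = S.z j t := ⟨(j, t), rfl⟩
  obtain ⟨h1, m, hm⟩ := S.simple _ _ _ _ h.choose_spec
  rw [normal, dif_pos h]
  have h2 : deriv (S.z j) t = deriv (S.z j) h.choose.2 :=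
    (congrArg _ hm).trans (deriv_add_period m (S.periodic j) _)
  rw [h1, curveNormal, curveNormal, h2]

/-- The arc length derivative does not depend on the parameter that represents the point. -/
theorem arcDeriv_apply (f : Plane → W) (j : Fin S.n) (t : ℝ) :
    S.arcDeriv f (S.z j t) = ‖deriv (S.z j) t‖⁻¹ • deriv (fun s => f (S.z j s)) t := by
  have h : ∃ a : Fin S.n × ℝ, S.z a.1 a.2 = S.z j t := ⟨(j, t), rfl⟩
  obtain ⟨h1, m, hm⟩ := S.simple _ _ _ _ h.choose_spec
  rw [arcDeriv, dif_pos h]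
  rw [h1]
  have hp : Function.Periodic (fun s => f (S.z j s)) (2 * Real.pi) :=
    fun s => congrArg f (S.periodic j s)
  have h2 : deriv (S.z j) t = deriv (S.z j) h.choose.2 :=
    (congrArg _ hm).trans (deriv_add_period m (S.periodic j) _)
  have h3 : deriv (fun s => f (S.z j s)) t = deriv (fun s => f (S.z j s)) h.choose.2 :=
    (congrArg _ hm).trans (deriv_add_period m hp _)
  rw [h2, h3]

/-- `f` is integrable over the boundary with respect to arc length. -/
def Integrable (f : Plane → W) : Prop :=
  ∀ j, IntervalIntegrable (fun t => ‖deriv (S.z j) t‖ • f (S.z j t)) volume 0 (2 * Real.pi)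

/-- The integral of `f` over the boundary with respect to arc length. -/
def integral (f : Plane → W) : W :=
  ∑ j, ∫ t in (0 : ℝ)..(2 * Real.pi), ‖deriv (S.z j) t‖ • f (S.z j t)

open Classical in
/-- The integral of `f` over the boundary points at distance greater than `ε` from `x`. -/
def truncIntegral (f : Plane → W) (x : Plane) (ε : ℝ) : W :=
  S.integral fun y => if ε < ‖x - y‖ then f y else 0

/-- The Cauchy principal value at `x` of the boundary integral of `f` exists; the truncated
integrals of which it is the limit are integrals of integrable functions. -/
def HasPV (f : Plane → W) (x : Plane) : Prop :=
  (∀ ε : ℝ, 0 < ε → S.Integrable fun y => open Classical in if ε < ‖x - y‖ then f y else 0) ∧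
    ∃ v : W, Tendsto (S.truncIntegral f x) (𝓝[>] 0) (𝓝 v)

/-- The Cauchy principal value at `x` of the boundary integral of `f`. -/
def pv (f : Plane → W) (x : Plane) : W := limUnder (𝓝[>] 0) (S.truncIntegral f x)

/-! ### The strongly singular operator `K'` and its blocks -/

variable (P : Medium) (k₁ k₂ : ℂ)

/-- The integrand `T̃(∂_x, ν_x) (E(x,y)ᵀ d(y))` of `K'(d)(x)`, for the density `d = (u, p)`,
as a function of `y`. -/
def KPintegrand (d : Plane → (Fin 2 → ℂ) × ℂ) (x y : Plane) : (Fin 2 → ℂ) × ℂ :=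
  P.neumann (S.normal x) (fun x' => P.ETmul k₁ k₂ x' y (d y)) x

/-- The operator `K'`. -/
def KP (d : Plane → (Fin 2 → ℂ) × ℂ) (x : Plane) : (Fin 2 → ℂ) × ℂ :=
  S.pv (S.KPintegrand P k₁ k₂ d x) x

/-- The block `K'_1`. -/
def KP1 (u : Plane → Fin 2 → ℂ) (x : Plane) : Fin 2 → ℂ :=
  (S.KP P k₁ k₂ (fun y => (u y, 0)) x).1

/-- The block `K'_2`. -/
def KP2 (p : Plane → ℂ) (x : Plane) : Fin 2 → ℂ :=
  (S.KP P k₁ k₂ (fun y => (0, p y)) x).1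

/-- The block `K'_3`. -/
def KP3 (u : Plane → Fin 2 → ℂ) (x : Plane) : ℂ :=
  (S.KP P k₁ k₂ (fun y => (u y, 0)) x).2

/-- The block `K'_4`. -/
def KP4 (p : Plane → ℂ) (x : Plane) : ℂ :=
  (S.KP P k₁ k₂ (fun y => (0, p y)) x).2

/-! ### The kernels `ker_j_1` of the operators `K'^1_j` -/

def ker_1_1 (x y : Plane) : Matrix (Fin 2) (Fin 2) ℂ :=
  Matrix.vecMulVec (toC (S.normal x))
      (grad (fun x' => -(helm P.kS x' y - helm k₁ x' y)
        + (k₂ ^ 2 - P.q) / (k₁ ^ 2 - k₂ ^ 2) * (helm k₁ x' y - helm k₂ x' y)) x) +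
    dirDeriv (S.normal x) (fun x' => helm P.kS x' y) x • (1 : Matrix (Fin 2) (Fin 2) ℂ) -
    (P.alpha : ℂ) • Matrix.vecMulVec (toC (S.normal x)) (P.E12 k₁ k₂ x y)

def ker_2_1 (x y : Plane) : Fin 2 → ℂ :=
  (P.gam / (k₁ ^ 2 - k₂ ^ 2) * (k₁ ^ 2 * helm k₁ x y - k₂ ^ 2 * helm k₂ x y)) •
      toC (S.normal x) -
    ((P.alpha : ℂ) * P.E22 k₁ k₂ x y) • toC (S.normal x)

/-- A row vector. -/
def ker_3_1 (x y : Plane) : Fin 2 → ℂ :=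
  (-(Complex.I * (P.omega : ℂ) * P.beta)) • (toC (S.normal x) ᵥ* P.E11 k₁ k₂ x y) +
    (P.C0 k₁ k₂ * (k₁ ^ 2 * helm k₁ x y - k₂ ^ 2 * helm k₂ x y)) • toC (S.normal x)

def ker_4_1 (x y : Plane) : ℂ :=
  -(toC (S.normal x) ⬝ᵥ
    ((Complex.I * (P.omega : ℂ) * P.beta) • P.E21 k₁ k₂ x y +
      grad (fun x' => (P.kP ^ 2 - k₁ ^ 2) / (k₁ ^ 2 - k₂ ^ 2) * helm k₁ x' y
        - (P.kP ^ 2 - k₂ ^ 2) / (k₁ ^ 2 - k₂ ^ 2) * helm k₂ x' y) x))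

/-! ### The weakly singular operators `K'^i_j` -/

def KP1_1 (u : Plane → Fin 2 → ℂ) (x : Plane) : Fin 2 → ℂ :=
  S.integral fun y => S.ker_1_1 P k₁ k₂ x y *ᵥ u y

def KP1_2 (u : Plane → Fin 2 → ℂ) (x : Plane) : Fin 2 → ℂ :=
  S.integral fun y => P.ker_1_2 k₁ k₂ x y *ᵥ u y

def KP2_1 (p : Plane → ℂ) (x : Plane) : Fin 2 → ℂ :=
  S.integral fun y => p y • S.ker_2_1 P k₁ k₂ x y

def KP2_2 (p : Plane → ℂ) (x : Plane) : Fin 2 → ℂ :=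
  S.integral fun y => p y • P.ker_2_2 k₁ k₂ x y

def KP3_1 (u : Plane → Fin 2 → ℂ) (x : Plane) : ℂ :=
  S.integral fun y => S.ker_3_1 P k₁ k₂ x y ⬝ᵥ u y

def KP3_2 (u : Plane → Fin 2 → ℂ) (x : Plane) : ℂ :=
  S.integral fun y => P.ker_3_2 k₁ k₂ x y ⬝ᵥ u y

def KP4_1 (p : Plane → ℂ) (x : Plane) : ℂ :=
  S.integral fun y => S.ker_4_1 P k₁ k₂ x y * p y

/-- The operator `K'^2_4`, which is zero. -/
def KP4_2 (_S : SmoothBoundary Ω) (_p : Plane → ℂ) (_x : Plane) : ℂ := 0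

end SmoothBoundary

end

end Poro

open Poro

/-! The proof combines a pointwise identity with a rule for differentiating potentials along the
curve.

The identity is ∂_ν u = ν ∇·u + ∂_s(Au) - ν^⊥(∂₂u₁ - ∂₁u₂) with ∂_s = ν^⊥·∇. It gives Tu = (λ+2μ) ν
∇·u + 2μ ∂_s(Au) - μ ν^⊥(∂₂u₁ - ∂₁u₂). On a gradient the rotation vanishes and the divergence is a
Laplacian, which Δγ_k = -k²γ_k removes. On E₁₁ the rotation comes only from γ_{k_s}/μ, and the same
identity, applied to γ_{k_s} times a constant vector, expresses it by ∂_ν γ_{k_s}, ν∇ᵀγ_{k_s} and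
∂_s(γ_{k_s}A). The remaining coefficients match because k₁²k₂² = q k_p² (`lrThird_psi_trace`). So
off the diagonal the integrand of K' is one kernel plus the ∂_s derivative of another
(`neumann_ETmul_fst`, `neumann_ETmul_snd`).

Both kernels are weakly singular. In ρ = |x-y|² each γ_k has the form a(ρ) log ρ + b(ρ) with a, b
entire, and a(0) = -1/(4π) does not depend on k. In γ_{k₁} - γ_{k₂} and in the function under the
Hessian of E₁₁ these constants cancel: the worst term is ρ log ρ, so first derivatives are bounded
near the diagonal and second derivatives are logarithmic. Where nothing cancels, as in ∂_ν γ_k, the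
estimate ν_x·(x-y) = O(|x-y|²) compensates.

Along a curve z such a kernel is A log|t-τ| plus a remainder that has a limit at the diagonal point
and a t-derivative of size |t-τ|^{-1/2}. The remainder may be differentiated under the integral sign
(`MildlySingular.hasDerivAt_integral`), and so may the logarithm once the value of the Hölder
continuous density at t₀ is subtracted (`hasDerivAt_integral_log_mul`). A constant density on an
interval centred at t₀ contributes derivative 0, and the principal value of 1/(t₀-τ) is 0 as well,
even when the cutoff is by chord length (`tendsto_pv_inv`). Hence the derivative of the potential is
the principal value of the differentiated kernel (`hasDerivAt_integral_logKernel`,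
`SmoothBoundary.arcDeriv_integral`). Together with the pointwise identity this is the claim
(`SmoothBoundary.regularizes`). -/

namespace Poro

noncomputable section

section

/-! ### Entire power series -/

/-- Coefficient sequences of entire functions. -/
def entireCoeff : Submodule ℂ (ℕ → ℂ) where
  carrier := {c | ∀ R : ℝ, 0 ≤ R → Summable fun m => ‖c m‖ * R ^ m}
  zero_mem' := fun R _ => by simp [summable_zero]
  add_mem' := fun {a b} ha hb R hR => by
    refine Summable.of_nonneg_of_le (fun m => by positivity) (fun m => ?_) ((ha R hR).add (hb R hR))
    rw [← add_mul]
    exact mul_le_mul_of_nonneg_right (norm_add_le _ _) (by positivity)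
  smul_mem' := fun k a ha R hR => by
    simpa [norm_mul, mul_assoc] using (ha R hR).mul_left ‖k‖

/-- The factor m + 1 is at most 2^(m+1), so the series at radius R is dominated by the original one
at radius 2 max(R, 1). -/
theorem derivCoeff_mem {c : ℕ → ℂ} (hc : c ∈ entireCoeff) :
    (fun m : ℕ => ((m : ℂ) + 1) * c (m + 1)) ∈ entireCoeff := by
  intro R hR
  have h := (summable_nat_add_iff 1).2 (hc (2 * max R 1) (by positivity))
  refine Summable.of_nonneg_of_le (fun m => by positivity) (fun m => ?_) h
  have h1 : ‖(m : ℂ) + 1‖ = (m : ℝ) + 1 := by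
    have : ((m : ℂ) + 1) = ((m + 1 : ℕ) : ℂ) := by push_cast; ring
    rw [this, Complex.norm_natCast]; push_cast; ring
  have h2 : (m : ℝ) + 1 ≤ 2 ^ (m + 1) := by
    have := (Nat.lt_two_pow_self (n := m + 1)).le
    exact_mod_cast this
  have h3 : R ^ m ≤ max R 1 ^ (m + 1) :=
    (pow_le_pow_left₀ hR (le_max_left _ _) m).trans
      (pow_le_pow_right₀ (le_max_right _ _) (Nat.le_succ m))
  rw [norm_mul, h1, mul_pow]
  calc ((m : ℝ) + 1) * ‖c (m + 1)‖ * R ^ m = ‖c (m + 1)‖ * (((m : ℝ) + 1) * R ^ m) := by ring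
    _ ≤ ‖c (m + 1)‖ * (2 ^ (m + 1) * max R 1 ^ (m + 1)) := by gcongr

theorem shiftCoeff_mem {c : ℕ → ℂ} (hc : c ∈ entireCoeff) :
    (fun m : ℕ => c (m + 1)) ∈ entireCoeff := by
  intro R hR
  refine Summable.of_nonneg_of_le (fun m => by positivity) (fun m => ?_) (derivCoeff_mem hc R hR)
  have h1 : ‖(m : ℂ) + 1‖ = (m : ℝ) + 1 := by
    have : ((m : ℂ) + 1) = ((m + 1 : ℕ) : ℂ) := by push_cast; ring
    rw [this, Complex.norm_natCast]; push_cast; ring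
  rw [norm_mul, h1]
  have : ‖c (m + 1)‖ ≤ ((m : ℝ) + 1) * ‖c (m + 1)‖ :=
    le_mul_of_one_le_left (norm_nonneg _) (by simp)
  gcongr

/-- Termwise differentiation of a power series. -/
def derivCoeff : entireCoeff →ₗ[ℂ] entireCoeff where
  toFun c := ⟨_, derivCoeff_mem c.2⟩
  map_add' a b := by ext m; simp [mul_add]
  map_smul' a b := by ext m; simp; ring

/-- Removal of the constant term of a power series, and division by the variable. -/
def shiftCoeff : entireCoeff →ₗ[ℂ] entireCoeff where
  toFun c := ⟨_, shiftCoeff_mem c.2⟩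
  map_add' a b := by ext m; simp
  map_smul' a b := by ext m; simp

theorem summable_ps (c : entireCoeff) (ρ : ℝ) : Summable fun m => c.1 m * (ρ : ℂ) ^ m := by
  refine Summable.of_norm ?_
  simpa [norm_mul, norm_pow] using c.2 |ρ| (abs_nonneg ρ)

/-- The sum of an entire power series at a real point. -/
def ps (ρ : ℝ) : entireCoeff →ₗ[ℂ] ℂ where
  toFun c := ∑' m, c.1 m * (ρ : ℂ) ^ m
  map_add' a b := by
    rw [← (summable_ps a ρ).tsum_add (summable_ps b ρ)]
    exact tsum_congr fun m => by simp [add_mul]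
  map_smul' k a := by
    simp only [RingHom.id_apply, smul_eq_mul]
    rw [← tsum_mul_left]
    exact tsum_congr fun m => by simp [mul_assoc]

theorem ps_apply (ρ : ℝ) (c : entireCoeff) : ps ρ c = ∑' m, c.1 m * (ρ : ℂ) ^ m := rfl

theorem ps_eq_add_mul_shift (ρ : ℝ) (c : entireCoeff) :
    ps ρ c = c.1 0 + ρ * ps ρ (shiftCoeff c) := by
  rw [ps_apply, (summable_ps c ρ).tsum_eq_zero_add, ps_apply, ← tsum_mul_left]
  simp only [pow_zero, mul_one]
  congr 1
  exact tsum_congr fun m => by simp [shiftCoeff]; ring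

theorem hasDerivAt_ps (c : entireCoeff) (ρ : ℝ) :
    HasDerivAt (fun t => ps t c) (ps ρ (derivCoeff c)) ρ := by
  -- The extra 1 puts ρ inside a ball on which the differentiated series has a summable majorant.
  set R : ℝ := |ρ| + 1 with hR
  have hρ : ρ ∈ Metric.ball (0 : ℝ) R := by simp [hR]
  have hsum : Summable fun m : ℕ => ‖c.1 m‖ * (m * R ^ (m - 1)) := by
    rw [← summable_nat_add_iff 1]
    refine ((derivCoeff c).2 R (by positivity)).congr fun m => ?_
    have : ((m : ℂ) + 1) = ((m + 1 : ℕ) : ℂ) := by push_cast; ring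
    simp only [derivCoeff, LinearMap.coe_mk, AddHom.coe_mk, norm_mul, this, Complex.norm_natCast,
      Nat.add_sub_cancel]
    ring
  have h := hasDerivAt_tsum_of_isPreconnected (𝕜 := ℝ) (F := ℂ)
    (g := fun m (t : ℝ) => c.1 m * (t : ℂ) ^ m)
    (g' := fun m (t : ℝ) => c.1 m * (m * (t : ℂ) ^ (m - 1))) hsum Metric.isOpen_ball
    (convex_ball (0 : ℝ) R).isPreconnected (fun m t _ => ?_) (fun m t ht => ?_) hρ
    (summable_ps c ρ) hρ
  · refine h.congr_deriv ?_
    have hs : Summable fun m : ℕ => c.1 m * (m * (ρ : ℂ) ^ (m - 1)) := by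
      refine Summable.of_norm_bounded hsum fun m => ?_
      simp only [norm_mul, Complex.norm_natCast, norm_pow, Complex.norm_real, Real.norm_eq_abs]
      gcongr
      simp [hR]
    rw [hs.tsum_eq_zero_add, ps_apply]
    simp only [Nat.cast_zero, zero_mul, mul_zero, zero_add]
    exact tsum_congr fun m => by simp [derivCoeff]; ring
  · have h1 : HasDerivAt (fun t : ℝ => (t : ℂ) ^ m) (m * (t : ℂ) ^ (m - 1)) t := by
      simpa using (hasDerivAt_pow m (t : ℂ)).comp_ofReal
    exact h1.const_mul _
  · simp only [norm_mul, Complex.norm_natCast, norm_pow, Complex.norm_real]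
    gcongr
    exact (mem_ball_zero_iff.1 ht).le

theorem contDiff_ps (c : entireCoeff) : ContDiff ℝ 1 fun t => ps t c := by
  rw [contDiff_one_iff_deriv]
  have h : deriv (fun t => ps t c) = fun t => ps t (derivCoeff c) :=
    funext fun t => (hasDerivAt_ps c t).deriv
  refine ⟨fun t => (hasDerivAt_ps c t).differentiableAt, ?_⟩
  rw [h]
  exact continuous_iff_continuousAt.2 fun t => (hasDerivAt_ps _ t).continuousAt

/-! ### Logarithmic profiles -/

/-- Pairs of entire power series `(a, b)`, standing for the function `a(ρ) log ρ + b(ρ)`. -/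
abbrev Profile : Type := entireCoeff × entireCoeff

/-- The value of the logarithmic profile. -/
def lr (ρ : ℝ) : Profile →ₗ[ℂ] ℂ :=
  (Real.log ρ : ℂ) • (ps ρ ∘ₗ LinearMap.fst ℂ _ _) + ps ρ ∘ₗ LinearMap.snd ℂ _ _

theorem lr_apply (ρ : ℝ) (p : Profile) : lr ρ p = Real.log ρ * ps ρ p.1 + ps ρ p.2 := rfl

/-- The derivative of a logarithmic profile, without the pole. -/
def derivProfile : Profile →ₗ[ℂ] Profile :=
  LinearMap.prod (derivCoeff ∘ₗ LinearMap.fst ℂ _ _)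
    (derivCoeff ∘ₗ LinearMap.snd ℂ _ _ + shiftCoeff ∘ₗ LinearMap.fst ℂ _ _)

theorem derivProfile_apply (p : Profile) :
    derivProfile p = (derivCoeff p.1, derivCoeff p.2 + shiftCoeff p.1) := rfl

/-- The coefficient of `log ρ` at `ρ = 0`. -/
def logCoeff : Profile →ₗ[ℂ] ℂ where
  toFun p := p.1.1 0
  map_add' _ _ := rfl
  map_smul' _ _ := rfl

/-- First derivative of the logarithmic profile. -/
def lr1 (ρ : ℝ) : Profile →ₗ[ℂ] ℂ := (ρ : ℂ)⁻¹ • logCoeff + lr ρ ∘ₗ derivProfile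

/-- Second derivative of the logarithmic profile. -/
def lr2 (ρ : ℝ) : Profile →ₗ[ℂ] ℂ := (-((ρ : ℂ) ^ 2)⁻¹) • logCoeff + lr1 ρ ∘ₗ derivProfile

/-- Third derivative of the logarithmic profile. -/
def lr3 (ρ : ℝ) : Profile →ₗ[ℂ] ℂ := (2 * ((ρ : ℂ) ^ 3)⁻¹) • logCoeff + lr2 ρ ∘ₗ derivProfile

theorem lr1_apply (ρ : ℝ) (p : Profile) :
    lr1 ρ p = (ρ : ℂ)⁻¹ * logCoeff p + lr ρ (derivProfile p) := rfl

theorem lr2_apply (ρ : ℝ) (p : Profile) :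
    lr2 ρ p = (-((ρ : ℂ) ^ 2)⁻¹) * logCoeff p + lr1 ρ (derivProfile p) := rfl

/-- (a log ρ + b)' = a' log ρ + b' + a/ρ, and a/ρ splits into the pole a(0)/ρ and an entire series.
Keeping the pole apart makes its cancellation a linear condition, the vanishing of `logCoeff`. -/
theorem hasDerivAt_lr {ρ : ℝ} (hρ : 0 < ρ) (p : Profile) :
    HasDerivAt (fun t => lr t p) (lr1 ρ p) ρ := by
  have h1 : HasDerivAt (fun t : ℝ => (Real.log t : ℂ)) ((ρ⁻¹ : ℝ) : ℂ) ρ :=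
    (Real.hasDerivAt_log hρ.ne').ofReal_comp
  have h := (h1.mul (hasDerivAt_ps p.1 ρ)).add (hasDerivAt_ps p.2 ρ)
  refine h.congr_deriv ?_
  have h0 : (ρ : ℂ) ≠ 0 := by exact_mod_cast hρ.ne'
  rw [lr1_apply, lr_apply, derivProfile_apply, map_add, ps_eq_add_mul_shift ρ p.1]
  simp only [logCoeff, LinearMap.coe_mk, AddHom.coe_mk, Complex.ofReal_inv]
  field_simp
  ring

theorem hasDerivAt_lr1 {ρ : ℝ} (hρ : 0 < ρ) (p : Profile) :
    HasDerivAt (fun t => lr1 t p) (lr2 ρ p) ρ := by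
  have h1 : HasDerivAt (fun t : ℝ => (t : ℂ)⁻¹) (-((ρ : ℂ) ^ 2)⁻¹) ρ := by
    have h0 : (ρ : ℂ) ≠ 0 := by exact_mod_cast hρ.ne'
    simpa using (hasDerivAt_inv h0).comp_ofReal
  exact (h1.mul_const _).add (hasDerivAt_lr hρ _)

theorem hasDerivAt_lr2 {ρ : ℝ} (hρ : 0 < ρ) (p : Profile) :
    HasDerivAt (fun t => lr2 t p) (lr3 ρ p) ρ := by
  have h0 : (ρ : ℂ) ≠ 0 := by exact_mod_cast hρ.ne'
  have h1 : HasDerivAt (fun t : ℝ => -((t : ℂ) ^ 2)⁻¹) (2 * ((ρ : ℂ) ^ 3)⁻¹) ρ := by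
    have := (((hasDerivAt_pow 2 (ρ : ℂ)).inv (pow_ne_zero 2 h0)).neg).comp_ofReal
    refine this.congr_deriv ?_
    field_simp
    norm_num
    ring
  exact (h1.mul_const _).add (hasDerivAt_lr1 hρ _)

/-- The left side is (ρ c)'. With this, differential equations in ρ reduce to recursions for
coefficients. -/
theorem mul_ps_derivCoeff_add (ρ : ℝ) (c d : entireCoeff)
    (h : ∀ m : ℕ, d.1 m = (m + 1) * c.1 m) : ρ * ps ρ (derivCoeff c) + ps ρ c = ps ρ d := by
  have h1 : HasDerivAt (fun t : ℝ => (t : ℂ) * ps t c) (1 * ps ρ c + ρ * ps ρ (derivCoeff c)) ρ :=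
    (Complex.ofRealCLM.hasDerivAt).mul (hasDerivAt_ps c ρ)
  -- The coefficients of ρ c(ρ): the index moves up by one and the constant term is 0.
  let e : entireCoeff := ⟨fun m => if m = 0 then 0 else c.1 (m - 1), fun R hR => by
    rw [← summable_nat_add_iff 1]
    refine ((c.2 R hR).mul_right R).congr fun m => ?_
    simp [pow_succ, mul_assoc]⟩
  have he : ∀ t : ℝ, ps t e = t * ps t c := fun t => by
    rw [ps_eq_add_mul_shift]
    have : shiftCoeff e = c := by ext m; simp [shiftCoeff, e]
    rw [this]; simp [e]
  have hd : derivCoeff e = d := by ext m; simp [derivCoeff, e, h]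
  have h2 := hasDerivAt_ps e ρ
  rw [hd, show (fun t => ps t e) = fun t : ℝ => (t : ℂ) * ps t c from funext he] at h2
  rw [h2.unique h1]; ring

/-! ### The profile of the Helmholtz fundamental solution -/

/-- One of the two factorials absorbs b, and the other leaves an exponential series. -/
theorem besselCoeff_mem (w : ℂ) {b : ℕ → ℂ} (hb : ∀ m, ‖b m‖ ≤ m.factorial) :
    (fun m : ℕ => (-1) ^ m * b m * w ^ m / (Nat.factorial m : ℂ) ^ 2) ∈ entireCoeff := by
  intro R hR
  refine Summable.of_nonneg_of_le (fun m => by positivity) (fun m => ?_)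
    (Real.summable_pow_div_factorial (‖w‖ * R))
  have hf : (0 : ℝ) < m.factorial := by exact_mod_cast m.factorial_pos
  simp only [norm_div, norm_mul, norm_pow, norm_neg, norm_one, one_pow, one_mul,
    Complex.norm_natCast, mul_pow]
  rw [div_mul_eq_mul_div, div_le_div_iff₀ (by positivity) hf]
  have := hb m
  have h0 : 0 ≤ ‖w‖ ^ m * R ^ m := by positivity
  calc ‖b m‖ * ‖w‖ ^ m * R ^ m * m.factorial = ‖b m‖ * (‖w‖ ^ m * R ^ m * m.factorial) := by ring
    _ ≤ m.factorial * (‖w‖ ^ m * R ^ m * m.factorial) := by gcongr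
    _ = ‖w‖ ^ m * R ^ m * (m.factorial : ℝ) ^ 2 := by ring

/-- Coefficients of `J₀(k√ρ)`. -/
def coeffJ (k : ℂ) : entireCoeff :=
  ⟨_, besselCoeff_mem (k ^ 2 / 4) (b := fun _ => 1) fun m => by
    simpa using Nat.one_le_iff_ne_zero.2 m.factorial_ne_zero⟩

/-- Coefficients of the regular series in `Y₀(k√ρ)`. -/
def coeffH (k : ℂ) : entireCoeff :=
  ⟨_, besselCoeff_mem (k ^ 2 / 4) (b := fun m => ((harmonic m : ℚ) : ℂ)) fun m => by
    -- The bound needed is harmonic m ≤ m ≤ m!.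
    have h1 : harmonic m ≤ m := by
      rw [harmonic]
      calc ∑ i ∈ Finset.range m, ((i + 1 : ℕ) : ℚ)⁻¹ ≤ ∑ i ∈ Finset.range m, 1 :=
            Finset.sum_le_sum fun i _ => inv_le_one_of_one_le₀ (by simp)
        _ = m := by simp
    have h0 : 0 ≤ harmonic m := Finset.sum_nonneg fun i _ => by positivity
    have h2 : ((harmonic m : ℚ) : ℝ) ≤ m := by exact_mod_cast h1
    have h3 : (m : ℝ) ≤ m.factorial := by exact_mod_cast Nat.self_le_factorial m
    rw [show ((harmonic m : ℚ) : ℂ) = (((harmonic m : ℚ) : ℝ) : ℂ) by push_cast; rfl,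
      Complex.norm_real, Real.norm_eq_abs, abs_of_nonneg (by exact_mod_cast h0)]
    exact h2.trans h3⟩

/-- The profile of `(i/4) H₀⁽¹⁾(k√ρ)`. -/
def helmProfile (k : ℂ) : Profile :=
  ((-(1 / (4 * Real.pi)) : ℂ) • coeffJ k,
    (Complex.I / 4 - 1 / (2 * Real.pi) * (Complex.log (k / 2) + Real.eulerMascheroniConstant)) •
      coeffJ k + (1 / (2 * Real.pi) : ℂ) • coeffH k)

/-- Only even powers of kr occur in the series, so they are series in r². Since r is positive,
log(kr/2) = log r + log(k/2) without a branch correction, and log r is half of log r². -/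
theorem helm_eq {k : ℂ} (hk : k ≠ 0) {x y : Plane} (hxy : x ≠ y) :
    helm k x y = lr (‖x - y‖ ^ 2) (helmProfile k) := by
  have hr : 0 < ‖x - y‖ := norm_pos_iff.2 (sub_ne_zero.2 hxy)
  set r := ‖x - y‖
  have hpow : ∀ m : ℕ, (k * (r : ℂ) / 2) ^ (2 * m) = (k ^ 2 / 4) ^ m * ((r ^ 2 : ℝ) : ℂ) ^ m := by
    intro m; rw [pow_mul, ← mul_pow]; congr 1; push_cast; ring
  have hJ : besselJ0 (k * r) = ps (r ^ 2) (coeffJ k) := by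
    rw [besselJ0, ps_apply]
    refine tsum_congr fun m => ?_
    rw [hpow]; simp only [coeffJ]; ring
  have hH : (∑' m : ℕ, (-1 : ℂ) ^ m * ((harmonic m : ℚ) : ℂ) * (k * (r : ℂ) / 2) ^ (2 * m) /
      (Nat.factorial m : ℂ) ^ 2) = ps (r ^ 2) (coeffH k) := by
    rw [ps_apply]
    refine tsum_congr fun m => ?_
    rw [hpow]; simp only [coeffH]; ring
  have hlog : Complex.log (k * r / 2) = (Real.log r : ℂ) + Complex.log (k / 2) := by
    rw [← Complex.log_ofReal_mul hr (div_ne_zero hk two_ne_zero)]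
    congr 1; ring
  have hlog2 : ((Real.log (r ^ 2) : ℝ) : ℂ) = 2 * (Real.log r : ℂ) := by
    rw [Real.log_pow]; push_cast; ring
  have hpi : (Real.pi : ℂ) ≠ 0 := by exact_mod_cast Real.pi_ne_zero
  rw [helm, hankel0, besselY0, hJ, hH, hlog, lr_apply, hlog2, helmProfile, map_add, map_smul,
    map_smul, map_smul]
  simp only [smul_eq_mul]
  field_simp
  ring_nf
  simp only [Complex.I_sq]
  ring

theorem harmonic_succ_cast (m : ℕ) :
    ((harmonic (m + 1) : ℚ) : ℂ) = ((harmonic m : ℚ) : ℂ) + ((m : ℂ) + 1)⁻¹ := by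
  rw [harmonic_succ]; push_cast; ring

/-- The radial Helmholtz equation, with the Laplacian in the variable `ρ = r²`. -/
theorem helmProfile_ode (k : ℂ) {ρ : ℝ} (hρ : 0 < ρ) :
    ρ * lr2 ρ (helmProfile k) + lr1 ρ (helmProfile k) + k ^ 2 / 4 * lr ρ (helmProfile k) = 0 := by
  have h0 : (ρ : ℂ) ≠ 0 := by exact_mod_cast hρ.ne'
  have hpi : (Real.pi : ℂ) ≠ 0 := by exact_mod_cast Real.pi_ne_zero
  set p := helmProfile k with hp
  -- The recursion of the Bessel coefficients. In `hH` the harmonic numbers add a source term,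
  -- because consecutive ones differ by 1/(m+1).
  have hJ : ∀ m : ℕ, ((m : ℂ) + 1) ^ 2 * (coeffJ k).1 (m + 1) + k ^ 2 / 4 * (coeffJ k).1 m = 0 := by
    intro m
    have h1 : ((m : ℂ) + 1) ≠ 0 := by exact_mod_cast m.succ_ne_zero
    have h2 : (m.factorial : ℂ) ≠ 0 := by exact_mod_cast m.factorial_ne_zero
    simp only [coeffJ, Nat.factorial_succ]
    push_cast
    field_simp
    ring
  have hH : ∀ m : ℕ, ((m : ℂ) + 1) ^ 2 * (coeffH k).1 (m + 1) + k ^ 2 / 4 * (coeffH k).1 m =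
      ((m : ℂ) + 1) * (coeffJ k).1 (m + 1) := by
    intro m
    have h1 : ((m : ℂ) + 1) ≠ 0 := by exact_mod_cast m.succ_ne_zero
    have h2 : (m.factorial : ℂ) ≠ 0 := by exact_mod_cast m.factorial_ne_zero
    simp only [coeffH, coeffJ, Nat.factorial_succ, harmonic_succ_cast]
    push_cast
    field_simp
    ring
  -- The factor a of the logarithm and the regular part b satisfy separate equations. The source 2a'
  -- in the second one arises from differentiating a log ρ twice; the poles a/ρ cancel.
  have hc : ∀ m : ℕ, ((m : ℂ) + 1) ^ 2 * p.1.1 (m + 1) + k ^ 2 / 4 * p.1.1 m = 0 := by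
    intro m
    have := hJ m
    simp only [hp, helmProfile, Submodule.coe_smul, Pi.smul_apply, smul_eq_mul]
    linear_combination (-(1 / (4 * Real.pi)) : ℂ) * this
  have he : ∀ m : ℕ, 2 * ((m : ℂ) + 1) * p.1.1 (m + 1) + ((m : ℂ) + 1) ^ 2 * p.2.1 (m + 1) +
      k ^ 2 / 4 * p.2.1 m = 0 := by
    intro m
    simp only [hp, helmProfile, Submodule.coe_smul, Submodule.coe_add, Pi.add_apply, Pi.smul_apply,
      smul_eq_mul]
    linear_combination (Complex.I / 4 - 1 / (2 * Real.pi) *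
      (Complex.log (k / 2) + Real.eulerMascheroniConstant)) * hJ m + 1 / (2 * Real.pi) * hH m
  have hA : ρ * ps ρ (derivCoeff (derivCoeff p.1)) + ps ρ (derivCoeff p.1) =
      ps ρ (-(k ^ 2 / 4) • p.1) := by
    refine mul_ps_derivCoeff_add ρ _ _ fun m => ?_
    simp only [derivCoeff, LinearMap.coe_mk, AddHom.coe_mk, Submodule.coe_smul, Pi.smul_apply,
      smul_eq_mul]
    linear_combination -hc m
  have hB : ρ * ps ρ (derivCoeff (derivCoeff p.2 + shiftCoeff p.1)) +
      ps ρ (derivCoeff p.2 + shiftCoeff p.1) = ps ρ (-(k ^ 2 / 4) • p.2 - derivCoeff p.1) := by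
    refine mul_ps_derivCoeff_add ρ _ _ fun m => ?_
    simp only [derivCoeff, shiftCoeff, LinearMap.coe_mk, AddHom.coe_mk, Submodule.coe_smul,
      Pi.smul_apply, smul_eq_mul, Submodule.coe_add, AddSubgroupClass.coe_sub, Pi.sub_apply,
      Pi.add_apply]
    linear_combination -he m
  have hS := ps_eq_add_mul_shift ρ (derivCoeff p.1)
  rw [lr2_apply, lr1_apply, lr1_apply, lr_apply, lr_apply, lr_apply]
  simp only [derivProfile_apply, map_add, map_sub, map_smul, smul_eq_mul] at hA hB ⊢
  have hl : logCoeff (derivCoeff p.1, derivCoeff p.2 + shiftCoeff p.1) = (derivCoeff p.1).1 0 := rfl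
  rw [hl]
  field_simp
  linear_combination 4 * (ρ : ℂ) * (Real.log ρ) * hA + 4 * (ρ : ℂ) * hB - 4 * (ρ : ℂ) * hS

/-- The equation holds for all positive ρ, hence so does its derivative. -/
theorem helmProfile_ode_deriv (k : ℂ) {ρ : ℝ} (hρ : 0 < ρ) :
    ρ * lr3 ρ (helmProfile k) + 2 * lr2 ρ (helmProfile k) +
      k ^ 2 / 4 * lr1 ρ (helmProfile k) = 0 := by
  set p := helmProfile k
  have h1 : HasDerivAt (fun t : ℝ => (t : ℂ) * lr2 t p + lr1 t p + k ^ 2 / 4 * lr t p)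
      (1 * lr2 ρ p + ρ * lr3 ρ p + lr2 ρ p + k ^ 2 / 4 * lr1 ρ p) ρ :=
    ((Complex.ofRealCLM.hasDerivAt.mul (hasDerivAt_lr2 hρ p)).add (hasDerivAt_lr1 hρ p)).add
      ((hasDerivAt_lr hρ p).const_mul _)
  have h2 : HasDerivAt (fun t : ℝ => (t : ℂ) * lr2 t p + lr1 t p + k ^ 2 / 4 * lr t p) 0 ρ := by
    refine (hasDerivAt_const ρ (0 : ℂ)).congr_of_eventuallyEq ?_
    filter_upwards [lt_mem_nhds hρ] with t ht using helmProfile_ode k ht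
  linear_combination h1.unique h2

end

section

/-! ### Gradients -/

/-- The real linear form on the plane with complex coefficients `g`. -/
def gradForm (g : Fin 2 → ℂ) : Plane →L[ℝ] ℂ :=
  ∑ l, g l • (Complex.ofRealCLM ∘L (EuclideanSpace.proj l : Plane →L[ℝ] ℝ))

theorem gradForm_apply (g : Fin 2 → ℂ) (v : Plane) : gradForm g v = g ⬝ᵥ toC v := by
  simp [gradForm, toC, dotProduct]

/-- `F` is differentiable at `x`, with gradient `g`. -/
def HasGrad (F : Plane → ℂ) (g : Fin 2 → ℂ) (x : Plane) : Prop := HasFDerivAt F (gradForm g) x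

variable {F G : Plane → ℂ} {f g : Fin 2 → ℂ} {x y : Plane}

theorem HasGrad.pd_eq (h : HasGrad F g x) (l : Fin 2) : pd l F x = g l := by
  rw [pd, HasFDerivAt.fderiv h, gradForm_apply]
  fin_cases l <;> simp [dotProduct, toC]

theorem HasGrad.grad_eq (h : HasGrad F g x) : grad F x = g := funext h.pd_eq

theorem HasGrad.congr (h : HasGrad F g x) (hFG : G =ᶠ[𝓝 x] F) : HasGrad G g x :=
  HasFDerivAt.congr_of_eventuallyEq h hFG

theorem HasGrad.congr_grad (h : HasGrad F g x) (hfg : g = f) : HasGrad F f x := hfg ▸ h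

theorem HasGrad.add (hF : HasGrad F f x) (hG : HasGrad G g x) :
    HasGrad (fun x => F x + G x) (fun l => f l + g l) x := by
  refine (HasFDerivAt.add hF hG).congr_fderiv ?_
  ext v; simp [gradForm_apply, dotProduct, Fin.sum_univ_two]; ring

theorem HasGrad.sub (hF : HasGrad F f x) (hG : HasGrad G g x) :
    HasGrad (fun x => F x - G x) (fun l => f l - g l) x := by
  refine (HasFDerivAt.sub hF hG).congr_fderiv ?_
  ext v; simp [gradForm_apply, dotProduct, Fin.sum_univ_two]; ring

theorem HasGrad.mul (hF : HasGrad F f x) (hG : HasGrad G g x) :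
    HasGrad (fun x => F x * G x) (fun l => F x * g l + f l * G x) x := by
  refine (HasFDerivAt.mul hF hG).congr_fderiv ?_
  ext v; simp [gradForm_apply, dotProduct, Fin.sum_univ_two]; ring

theorem HasGrad.const_mul (c : ℂ) (hF : HasGrad F f x) :
    HasGrad (fun x => c * F x) (fun l => c * f l) x := by
  refine (HasFDerivAt.const_mul hF c).congr_fderiv ?_
  ext v; simp [gradForm_apply, dotProduct, Fin.sum_univ_two]; ring

theorem HasGrad.comp_curve {z : ℝ → Plane} {t : ℝ} {v : Plane} (h : HasGrad F g (z t))
    (hz : HasDerivAt z v t) : HasDerivAt (fun s => F (z s)) (g ⬝ᵥ toC v) t := by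
  rw [← gradForm_apply]; exact HasFDerivAt.comp_hasDerivAt t h hz

/-- The complex coordinates of `x - y`. -/
def dif (x y : Plane) (i : Fin 2) : ℂ := toC x i - toC y i

theorem hasGrad_dif (x y : Plane) (i : Fin 2) :
    HasGrad (fun x => dif x y i) (fun l => if i = l then 1 else 0) x := by
  have h : HasFDerivAt (fun x : Plane => dif x y i)
      (Complex.ofRealCLM ∘L (EuclideanSpace.proj i : Plane →L[ℝ] ℝ)) x :=
    ((Complex.ofRealCLM ∘L (EuclideanSpace.proj i : Plane →L[ℝ] ℝ)).hasFDerivAt).sub_const _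
  refine h.congr_fderiv ?_
  ext v; fin_cases i <;> simp [gradForm_apply, dotProduct, toC]

theorem normSq_sub (x y : Plane) : ‖x - y‖ ^ 2 = (x 0 - y 0) ^ 2 + (x 1 - y 1) ^ 2 := by
  rw [EuclideanSpace.norm_sq_eq]; simp [Fin.sum_univ_two]

theorem normSq_sub_dif (x y : Plane) :
    ((‖x - y‖ ^ 2 : ℝ) : ℂ) = dif x y 0 * dif x y 0 + dif x y 1 * dif x y 1 := by
  rw [normSq_sub]; simp only [dif, toC]; push_cast; ring

theorem normSq_sub_pos (h : x ≠ y) : 0 < ‖x - y‖ ^ 2 := by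
  have : 0 < ‖x - y‖ := norm_pos_iff.2 (sub_ne_zero.2 h)
  positivity

theorem hasGrad_radial {h : ℝ → ℂ} {h' : ℂ} (hh : HasDerivAt h h' (‖x - y‖ ^ 2)) :
    HasGrad (fun x => h (‖x - y‖ ^ 2)) (fun l => 2 * dif x y l * h') x := by
  have h1 : HasFDerivAt (fun x : Plane => ‖x - y‖ ^ 2) (2 • innerSL ℝ (x - y)) x := by
    simpa using ((hasFDerivAt_id x).sub_const y).norm_sq
  refine (hh.hasFDerivAt.comp x h1).congr_fderiv ?_
  ext v
  simp [gradForm_apply, dotProduct, Fin.sum_univ_two, toC, dif, PiLp.inner_apply]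
  ring

theorem eventually_ne (h : x ≠ y) : ∀ᶠ x' in 𝓝 x, x' ≠ y := isOpen_ne.mem_nhds h

/-! ### Derivatives of radial logarithmic profiles -/

theorem hasGrad_lr (p : Profile) (h : x ≠ y) :
    HasGrad (fun x => lr (‖x - y‖ ^ 2) p) (fun l => 2 * dif x y l * lr1 (‖x - y‖ ^ 2) p) x :=
  hasGrad_radial (h := fun ρ => lr ρ p) (hasDerivAt_lr (normSq_sub_pos h) p)

/-- Partial derivatives of a logarithmic profile. -/
def lrGrad (p : Profile) (x y : Plane) (i : Fin 2) : ℂ := 2 * dif x y i * lr1 (‖x - y‖ ^ 2) p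

/-- Second partial derivatives of a logarithmic profile. -/
def lrHess (p : Profile) (x y : Plane) (i j : Fin 2) : ℂ :=
  (if i = j then 2 else 0) * lr1 (‖x - y‖ ^ 2) p +
    4 * (dif x y i * dif x y j) * lr2 (‖x - y‖ ^ 2) p

/-- Third partial derivatives of a logarithmic profile. -/
def lrThird (p : Profile) (x y : Plane) (i j l : Fin 2) : ℂ :=
  4 * ((if i = j then dif x y l else 0) + (if i = l then dif x y j else 0) +
    (if j = l then dif x y i else 0)) * lr2 (‖x - y‖ ^ 2) p +
      8 * (dif x y i * dif x y j * dif x y l) * lr3 (‖x - y‖ ^ 2) p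

theorem hasGrad_lr1 (p : Profile) (h : x ≠ y) :
    HasGrad (fun x => lr1 (‖x - y‖ ^ 2) p) (fun l => 2 * dif x y l * lr2 (‖x - y‖ ^ 2) p) x :=
  hasGrad_radial (h := fun ρ => lr1 ρ p) (hasDerivAt_lr1 (normSq_sub_pos h) p)

theorem hasGrad_lr2 (p : Profile) (h : x ≠ y) :
    HasGrad (fun x => lr2 (‖x - y‖ ^ 2) p) (fun l => 2 * dif x y l * lr3 (‖x - y‖ ^ 2) p) x :=
  hasGrad_radial (h := fun ρ => lr2 ρ p) (hasDerivAt_lr2 (normSq_sub_pos h) p)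

theorem hasGrad_lrGrad (p : Profile) (h : x ≠ y) (i : Fin 2) :
    HasGrad (fun x => lrGrad p x y i) (fun l => lrHess p x y l i) x := by
  refine (((hasGrad_dif x y i).const_mul 2).mul (hasGrad_lr1 p h)).congr_grad ?_
  funext l
  simp only [lrHess, eq_comm (a := l)]
  split_ifs <;> ring

theorem hasGrad_lrHess (p : Profile) (h : x ≠ y) (i j : Fin 2) :
    HasGrad (fun x => lrHess p x y i j) (lrThird p x y i j) x := by
  refine (((hasGrad_lr1 p h).const_mul (if i = j then 2 else 0)).add
    ((((hasGrad_dif x y i).mul (hasGrad_dif x y j)).const_mul 4).mul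
      (hasGrad_lr2 p h))).congr_grad ?_
  funext l
  rw [lrThird]
  split_ifs <;> ring

theorem lrHess_comm (p : Profile) (x y : Plane) (i j : Fin 2) :
    lrHess p x y i j = lrHess p x y j i := by
  simp only [lrHess, eq_comm (a := j)]
  ring

theorem grad_lr {p : Profile} (h : x ≠ y) (hF : ∀ x', x' ≠ y → F x' = lr (‖x' - y‖ ^ 2) p) :
    grad F x = lrGrad p x y :=
  ((hasGrad_lr p h).congr ((eventually_ne h).mono hF)).grad_eq

/-- The gradient formula holds at every point near x, so it may be inserted before the second
differentiation. -/
theorem hess_lr {p : Profile} (h : x ≠ y) (hF : ∀ x', x' ≠ y → F x' = lr (‖x' - y‖ ^ 2) p) :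
    hess F x = Matrix.of (lrHess p x y) := by
  ext i j
  rw [hess, Matrix.of_apply, Matrix.of_apply]
  exact ((hasGrad_lrGrad p h j).congr
    ((eventually_ne h).mono fun x' hx' => congrFun (grad_lr hx' hF) j)).pd_eq i

/-- For functions of ρ = |x-y|² in the plane the Laplacian is 4(ρ ∂² + ∂), so the radial equation
says Δγ_k = -k²γ_k. -/
theorem lrHess_trace (k : ℂ) (h : x ≠ y) :
    lrHess (helmProfile k) x y 0 0 + lrHess (helmProfile k) x y 1 1 =
      -k ^ 2 * lr (‖x - y‖ ^ 2) (helmProfile k) := by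
  have h1 := helmProfile_ode k (normSq_sub_pos h)
  rw [normSq_sub_dif] at h1
  simp only [lrHess, if_true]
  linear_combination 4 * h1

/-- The gradient of the Helmholtz equation, obtained from the differentiated radial equation. -/
theorem lrThird_trace (k : ℂ) (h : x ≠ y) (j : Fin 2) :
    lrThird (helmProfile k) x y 0 j 0 + lrThird (helmProfile k) x y 1 j 1 =
      -k ^ 2 * lrGrad (helmProfile k) x y j := by
  have h1 := helmProfile_ode_deriv k (normSq_sub_pos h)
  rw [normSq_sub_dif] at h1
  simp only [lrThird, lrGrad]
  fin_cases j <;> simp <;> linear_combination 8 * dif x y _ * h1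

theorem lrThird_symm (p : Profile) (x y : Plane) (i j l : Fin 2) :
    lrThird p x y i j l = lrThird p x y l j i := by
  simp only [lrThird, eq_comm (a := l), eq_comm (b := i) (a := j)]
  split_ifs <;> ring

theorem lrThird_right_comm (p : Profile) (x y : Plane) (i j l : Fin 2) :
    lrThird p x y i j l = lrThird p x y i l j := by
  simp only [lrThird, eq_comm (a := l) (b := j)]
  split_ifs <;> ring

end

/-! ### Linearity in the profile; the fundamental solution -/

section

theorem lrGrad_sub (p q : Profile) (x y : Plane) (i : Fin 2) :
    lrGrad (p - q) x y i = lrGrad p x y i - lrGrad q x y i := by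
  simp only [lrGrad, map_sub]; ring

theorem lrGrad_add (p q : Profile) (x y : Plane) (i : Fin 2) :
    lrGrad (p + q) x y i = lrGrad p x y i + lrGrad q x y i := by
  simp only [lrGrad, map_add]; ring

theorem lrGrad_smul (c : ℂ) (p : Profile) (x y : Plane) (i : Fin 2) :
    lrGrad (c • p) x y i = c * lrGrad p x y i := by
  simp only [lrGrad, map_smul, smul_eq_mul]; ring

theorem lrHess_sub (p q : Profile) (x y : Plane) (i j : Fin 2) :
    lrHess (p - q) x y i j = lrHess p x y i j - lrHess q x y i j := by
  simp only [lrHess, map_sub]; ring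

theorem lrThird_sub (p q : Profile) (x y : Plane) (i j l : Fin 2) :
    lrThird (p - q) x y i j l = lrThird p x y i j l - lrThird q x y i j l := by
  simp only [lrThird, map_sub]; ring

theorem lrThird_add (p q : Profile) (x y : Plane) (i j l : Fin 2) :
    lrThird (p + q) x y i j l = lrThird p x y i j l + lrThird q x y i j l := by
  simp only [lrThird, map_add]; ring

theorem lrThird_smul (c : ℂ) (p : Profile) (x y : Plane) (i j l : Fin 2) :
    lrThird (c • p) x y i j l = c * lrThird p x y i j l := by
  simp only [lrThird, map_smul, smul_eq_mul]; ring

namespace Medium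

variable (P : Medium)

/-! ### Nonvanishing of the parameters -/

/-- The imaginary part is φ² > 0, whatever the sign of the real part. -/
theorem beta_den_ne : Complex.I * ((P.phi ^ 2 : ℝ) : ℂ) +
    ((P.omega * P.kappa * (P.rhoA + P.phi * P.rhoF) : ℝ) : ℂ) ≠ 0 := by
  intro h
  have := congrArg Complex.im h
  simp only [Complex.add_im, Complex.mul_im, Complex.I_re, Complex.I_im, Complex.ofReal_re,
    Complex.ofReal_im, Complex.zero_im] at this
  have := P.phi_pos
  nlinarith

theorem beta_ne : P.beta ≠ 0 := by
  refine div_ne_zero ?_ P.beta_den_ne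
  have := P.omega_pos; have := P.phi_pos; have := P.rhoF_pos; have := P.kappa_pos
  exact_mod_cast (by positivity : P.omega * P.phi ^ 2 * P.rhoF * P.kappa ≠ 0)

/-- The effective density `ρ - β ρ_f`. -/
def effDensity : ℂ := (P.rho : ℂ) - P.beta * (P.rhoF : ℂ)

/-- After the denominator of β is cleared, the imaginary part of βρ_f = ρ forces ρ = 0; the real
part then says ωφ²ρ_f²κ = 0, against positivity. -/
theorem effDensity_ne : P.effDensity ≠ 0 := by
  intro h
  have hb : P.beta * (P.rhoF : ℂ) = (P.rho : ℂ) := (sub_eq_zero.1 h).symm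
  have hd := P.beta_den_ne
  have ho := P.omega_pos; have hp := P.phi_pos; have hr := P.rhoF_pos; have hk := P.kappa_pos
  rw [beta, div_mul_eq_mul_div, div_eq_iff hd] at hb
  have him := congrArg Complex.im hb
  have hre := congrArg Complex.re hb
  simp only [← Complex.ofReal_mul, Complex.mul_im, Complex.mul_re, Complex.add_im, Complex.add_re,
    Complex.I_re, Complex.I_im, Complex.ofReal_re, Complex.ofReal_im] at him hre
  have h0 : P.rho = 0 := by
    have : P.rho * P.phi ^ 2 = 0 := by linarith
    rcases mul_eq_zero.1 this with h | h
    · exact h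
    · exact absurd h (by positivity)
  rw [h0] at hre
  have : P.omega * P.phi ^ 2 * P.rhoF * P.kappa * P.rhoF > 0 := by positivity
  linarith

theorem lamTwoMu_pos : 0 < P.lam + 2 * P.mu := by linarith [P.lam_add_mu_pos, P.mu_pos]

theorem omega_ne : (P.omega : ℂ) ≠ 0 := by exact_mod_cast P.omega_pos.ne'
theorem mu_ne : (P.mu : ℂ) ≠ 0 := by exact_mod_cast P.mu_pos.ne'
theorem rhoF_ne : (P.rhoF : ℂ) ≠ 0 := by exact_mod_cast P.rhoF_pos.ne'
theorem lamTwoMu_ne : ((P.lam + 2 * P.mu : ℝ) : ℂ) ≠ 0 := by exact_mod_cast P.lamTwoMu_pos.ne'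

/-- Squaring removes the branch of the root. -/
theorem kP_sq : P.kP ^ 2 = (P.omega : ℂ) ^ 2 * (P.effDensity / ((P.lam + 2 * P.mu : ℝ) : ℂ)) := by
  rw [kP, mul_pow, ← Complex.cpow_nat_mul]; simp [effDensity]

theorem kS_sq : P.kS ^ 2 = (P.omega : ℂ) ^ 2 * (P.effDensity / (P.mu : ℂ)) := by
  rw [kS, mul_pow, ← Complex.cpow_nat_mul]; simp [effDensity]

theorem kP_ne : P.kP ≠ 0 := by
  have h := P.kP_sq
  intro h0
  rw [h0] at h
  exact mul_ne_zero (pow_ne_zero 2 P.omega_ne) (div_ne_zero P.effDensity_ne P.lamTwoMu_ne)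
    (by simpa using h.symm)

theorem kS_ne : P.kS ≠ 0 := by
  have h := P.kS_sq
  intro h0
  rw [h0] at h
  exact mul_ne_zero (pow_ne_zero 2 P.omega_ne) (div_ne_zero P.effDensity_ne P.mu_ne)
    (by simpa using h.symm)

theorem coefR_ne : P.coefR ≠ 0 := by
  have h1 := P.phi_pos; have h2 := P.mu_pos; have h3 := P.skempton_ne
  have h4 : 1 - 2 * P.nuP ≠ 0 := fun h => P.nuP_ne_half (by linarith)
  have h5 : 1 + P.nuU ≠ 0 := fun h => P.nuU_ne_neg_one (by linarith)
  have h6 : P.nuU - P.nuP ≠ 0 := fun h => P.nuP_ne_nuU (by linarith)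
  have h7 : 1 - 2 * P.nuU ≠ 0 := fun h => P.nuU_ne_half (by linarith)
  rw [coefR]
  positivity

theorem q_ne : P.q ≠ 0 := by
  have ho := P.omega_pos; have hp := P.phi_pos; have hr := P.rhoF_pos
  refine div_ne_zero ?_ (mul_ne_zero P.beta_ne (by exact_mod_cast P.coefR_ne))
  exact_mod_cast (by positivity : P.omega ^ 2 * P.phi ^ 2 * P.rhoF ≠ 0)

variable {P} {k₁ k₂ : ℂ}

/-- The product of the squares is q k_p². Nonvanishing is what the logarithm in the fundamental
solution needs, see `helm_eq`. -/
theorem IsWaveNumbers.ne_zero (hk : P.IsWaveNumbers k₁ k₂) : k₁ ≠ 0 ∧ k₂ ≠ 0 := by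
  have h : k₁ ^ 2 * k₂ ^ 2 ≠ 0 := by
    rw [hk.2.2.2]; exact mul_ne_zero P.q_ne (pow_ne_zero 2 P.kP_ne)
  constructor <;> rintro rfl <;> simp at h

/-! ### The fundamental solution in terms of profiles -/

variable (P) (k₁ k₂)

/-- The profile of the function under the Hessian in `E₁₁`. -/
def psiProfile : Profile :=
  helmProfile P.kS - ((P.kP ^ 2 - k₂ ^ 2) / (k₁ ^ 2 - k₂ ^ 2)) • helmProfile k₁ +
    ((P.kP ^ 2 - k₁ ^ 2) / (k₁ ^ 2 - k₂ ^ 2)) • helmProfile k₂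

/-- The coefficient of the Hessian in `E₁₁`. -/
def hessCoeff : ℂ := 1 / (P.effDensity * (P.omega : ℂ) ^ 2)

variable {P k₁ k₂} {x y : Plane}

theorem E11_eq (hk : P.IsWaveNumbers k₁ k₂) (h : x ≠ y) (i j : Fin 2) :
    P.E11 k₁ k₂ x y i j = (if i = j then 1 / (P.mu : ℂ) else 0) *
      lr (‖x - y‖ ^ 2) (helmProfile P.kS) + P.hessCoeff * lrHess (P.psiProfile k₁ k₂) x y i j := by
  rw [E11, hess_lr (p := P.psiProfile k₁ k₂) h, helm_eq P.kS_ne h]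
  · simp only [Matrix.add_apply, Matrix.smul_apply, Matrix.one_apply, smul_eq_mul, Matrix.of_apply,
      hessCoeff, effDensity]
    split_ifs <;> ring
  · intro x' hx'
    simp only [psiProfile, map_add, map_sub, map_smul, smul_eq_mul]
    rw [helm_eq P.kS_ne hx', helm_eq hk.ne_zero.1 hx', helm_eq hk.ne_zero.2 hx']

theorem grad_helm_sub (hk : P.IsWaveNumbers k₁ k₂) (h : x ≠ y) :
    grad (fun x' => helm k₁ x' y - helm k₂ x' y) x =
      lrGrad (helmProfile k₁ - helmProfile k₂) x y :=
  grad_lr h fun x' hx' => by rw [map_sub, helm_eq hk.ne_zero.1 hx', helm_eq hk.ne_zero.2 hx']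

/-- The gradient of the entries of `E₁₁`. -/
def E11Grad (P : Medium) (k₁ k₂ : ℂ) (x y : Plane) (i j l : Fin 2) : ℂ :=
  (if i = j then 1 / (P.mu : ℂ) else 0) * lrGrad (helmProfile P.kS) x y l +
    P.hessCoeff * lrThird (P.psiProfile k₁ k₂) x y i j l

theorem hasGrad_E11 (hk : P.IsWaveNumbers k₁ k₂) (h : x ≠ y) (i j : Fin 2) :
    HasGrad (fun x' => P.E11 k₁ k₂ x' y i j) (E11Grad P k₁ k₂ x y i j) x :=
  (((hasGrad_lr _ h).const_mul _).add ((hasGrad_lrHess _ h i j).const_mul _)).congr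
    ((eventually_ne h).mono fun _ hx' => E11_eq hk hx' i j)

theorem hasGrad_grad_sub (hk : P.IsWaveNumbers k₁ k₂) (h : x ≠ y) (i : Fin 2) :
    HasGrad (fun x' => grad (fun x'' => helm k₁ x'' y - helm k₂ x'' y) x' i)
      (fun l => lrHess (helmProfile k₁ - helmProfile k₂) x y l i) x :=
  (hasGrad_lrGrad _ h i).congr
    ((eventually_ne h).mono fun _ hx' => congrFun (grad_helm_sub hk hx') i)

theorem hasGrad_helm {k : ℂ} (hk : k ≠ 0) (h : x ≠ y) :
    HasGrad (fun x' => helm k x' y) (lrGrad (helmProfile k) x y) x :=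
  (hasGrad_lr _ h).congr ((eventually_ne h).mono fun _ hx' => helm_eq hk hx')

/-- The gradient of the entries of the kernel `ker_1_2`. -/
def ker12Grad (P : Medium) (k₁ k₂ : ℂ) (x y : Plane) (i j l : Fin 2) : ℂ :=
  ∑ m, rotA i m * (2 * P.mu * E11Grad P k₁ k₂ x y m j l -
    (if m = j then 1 else 0) * lrGrad (helmProfile P.kS) x y l)

theorem hasGrad_ker_1_2 (hk : P.IsWaveNumbers k₁ k₂) (h : x ≠ y) (i j : Fin 2) :
    HasGrad (fun x' => P.ker_1_2 k₁ k₂ x' y i j) (ker12Grad P k₁ k₂ x y i j) x := by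
  have hm : ∀ m, HasGrad (fun x' => rotA i m * (2 * (P.mu : ℂ) * P.E11 k₁ k₂ x' y m j -
      (if m = j then 1 else 0) * helm P.kS x' y)) (fun l => rotA i m *
        (2 * P.mu * E11Grad P k₁ k₂ x y m j l -
          (if m = j then 1 else 0) * lrGrad (helmProfile P.kS) x y l)) x := fun m =>
    (((hasGrad_E11 hk h m j).const_mul _).sub ((hasGrad_helm P.kS_ne h).const_mul _)).const_mul _
  refine (((hm 0).add (hm 1)).congr (Eventually.of_forall fun x' => ?_)).congr_grad ?_
  · simp only [ker_1_2, Matrix.mul_apply, Fin.sum_univ_two, Matrix.sub_apply, Matrix.smul_apply,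
      Matrix.one_apply, smul_eq_mul]
    congr 2 <;> split_ifs <;> ring
  · funext l; simp only [ker12Grad, Fin.sum_univ_two]

/-- The gradient of the entries of the kernel `ker_2_2`. -/
def ker22Grad (P : Medium) (k₁ k₂ : ℂ) (x y : Plane) (i l : Fin 2) : ℂ :=
  ∑ m, (-(2 * (P.mu : ℂ) * P.gam / (((P.lam + 2 * P.mu : ℝ) : ℂ) * (k₁ ^ 2 - k₂ ^ 2)))) *
    (rotA i m * lrHess (helmProfile k₁ - helmProfile k₂) x y l m)

theorem hasGrad_ker_2_2 (hk : P.IsWaveNumbers k₁ k₂) (h : x ≠ y) (i : Fin 2) :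
    HasGrad (fun x' => P.ker_2_2 k₁ k₂ x' y i) (ker22Grad P k₁ k₂ x y i) x := by
  refine (((((hasGrad_grad_sub hk h 0).const_mul (rotA i 0)).const_mul
    (-(2 * (P.mu : ℂ) * P.gam / (((P.lam + 2 * P.mu : ℝ) : ℂ) * (k₁ ^ 2 - k₂ ^ 2))))).add
      (((hasGrad_grad_sub hk h 1).const_mul (rotA i 1)).const_mul
        (-(2 * (P.mu : ℂ) * P.gam / (((P.lam + 2 * P.mu : ℝ) : ℂ) * (k₁ ^ 2 - k₂ ^ 2)))))).congr
          (Eventually.of_forall fun x' => ?_)).congr_grad ?_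
  rotate_left
  · funext l; simp only [ker22Grad, Fin.sum_univ_two]
  · simp only [ker_2_2, Pi.smul_apply, smul_eq_mul, Matrix.mulVec, dotProduct, Fin.sum_univ_two]
    ring

/-- The gradient of the entries of the kernel `ker_3_2`. -/
def ker32Grad (P : Medium) (k₁ k₂ : ℂ) (x y : Plane) (i l : Fin 2) : ℂ :=
  ∑ m, P.C0 k₁ k₂ * (rotA m i * lrHess (helmProfile k₁ - helmProfile k₂) x y l m)

theorem hasGrad_ker_3_2 (hk : P.IsWaveNumbers k₁ k₂) (h : x ≠ y) (i : Fin 2) :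
    HasGrad (fun x' => P.ker_3_2 k₁ k₂ x' y i) (ker32Grad P k₁ k₂ x y i) x := by
  refine (((((hasGrad_grad_sub hk h 0).const_mul (rotA 0 i)).const_mul
    (P.C0 k₁ k₂)).add
      (((hasGrad_grad_sub hk h 1).const_mul (rotA 1 i)).const_mul
        (P.C0 k₁ k₂))).congr
          (Eventually.of_forall fun x' => ?_)).congr_grad ?_
  rotate_left
  · funext l; simp only [ker32Grad, Fin.sum_univ_two]
  · simp only [ker_3_2, Pi.smul_apply, smul_eq_mul, Matrix.vecMul, dotProduct, Fin.sum_univ_two]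
    ring


/-! ### The pointwise identity -/

/-- The trace is the gradient of a Laplacian, and each term of the profile is an eigenfunction of
the Laplacian. The term in γ_{k_s} is the negative of (λ+2μ) ∇γ_{k_s}/μ, so the shear wave drops out
of the divergence of E₁₁. -/
theorem lrThird_psi_trace (hne : k₁ ^ 2 ≠ k₂ ^ 2) (hk : P.IsWaveNumbers k₁ k₂) (h : x ≠ y)
    (j : Fin 2) :
    P.hessCoeff * ((P.lam : ℂ) + 2 * P.mu) * (lrThird (P.psiProfile k₁ k₂) x y 0 j 0 +
      lrThird (P.psiProfile k₁ k₂) x y 1 j 1) =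
    -((P.lam : ℂ) + 2 * P.mu) * (1 / P.mu) * lrGrad (helmProfile P.kS) x y j +
      lrGrad (helmProfile k₁) x y j + (k₂ ^ 2 - P.q) / (k₁ ^ 2 - k₂ ^ 2) *
        (lrGrad (helmProfile k₁) x y j - lrGrad (helmProfile k₂) x y j) := by
  have hS := lrThird_trace P.kS h j
  have h1 := lrThird_trace k₁ h j
  have h2 := lrThird_trace k₂ h j
  have hm := P.effDensity_ne
  have ho := P.omega_ne
  have hmu := P.mu_ne
  have hl : (P.lam : ℂ) + 2 * P.mu ≠ 0 := by simpa using P.lamTwoMu_ne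
  have hkP : P.hessCoeff * ((P.lam : ℂ) + 2 * P.mu) * P.kP ^ 2 = 1 := by
    rw [kP_sq, hessCoeff]; push_cast; field_simp
  have hkS : P.hessCoeff * P.kS ^ 2 = 1 / P.mu := by
    rw [kS_sq, hessCoeff]; field_simp
  have hD : (k₁ ^ 2 - k₂ ^ 2) * (k₁ ^ 2 - k₂ ^ 2)⁻¹ = 1 := mul_inv_cancel₀ (sub_ne_zero.2 hne)
  have hq := hk.2.2.2
  -- Here k₁²k₂² = q k_p² enters. At the end, (k₁²-q)/(k₁²-k₂²) is rewritten as 1 +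
  -- (k₂²-q)/(k₁²-k₂²) by means of `hD`.
  have hc1 : P.hessCoeff * ((P.lam : ℂ) + 2 * P.mu) * ((P.kP ^ 2 - k₂ ^ 2) * k₁ ^ 2) =
      k₁ ^ 2 - P.q := by
    linear_combination (k₁ ^ 2 - P.q) * hkP - P.hessCoeff * ((P.lam : ℂ) + 2 * P.mu) * hq
  have hc2 : P.hessCoeff * ((P.lam : ℂ) + 2 * P.mu) * ((P.kP ^ 2 - k₁ ^ 2) * k₂ ^ 2) =
      k₂ ^ 2 - P.q := by
    linear_combination (k₂ ^ 2 - P.q) * hkP - P.hessCoeff * ((P.lam : ℂ) + 2 * P.mu) * hq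
  simp only [psiProfile, lrThird_add, lrThird_sub, lrThird_smul, div_eq_mul_inv] at *
  linear_combination P.hessCoeff * ((P.lam : ℂ) + 2 * P.mu) * (hS -
    (P.kP ^ 2 - k₂ ^ 2) * (k₁ ^ 2 - k₂ ^ 2)⁻¹ * h1 +
    (P.kP ^ 2 - k₁ ^ 2) * (k₁ ^ 2 - k₂ ^ 2)⁻¹ * h2) -
    ((P.lam : ℂ) + 2 * P.mu) * lrGrad (helmProfile P.kS) x y j * hkS +
    (k₁ ^ 2 - k₂ ^ 2)⁻¹ * lrGrad (helmProfile k₁) x y j * hc1 -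
    (k₁ ^ 2 - k₂ ^ 2)⁻¹ * lrGrad (helmProfile k₂) x y j * hc2 +
    lrGrad (helmProfile k₁) x y j * hD

end Medium

end

/-! ### The integrand of K' off the diagonal -/

section

variable {P : Medium} {k₁ k₂ : ℂ} {x y : Plane} {Ω : Set Plane}

namespace SmoothBoundary

variable (S : SmoothBoundary Ω)

theorem ker_1_1_eq (hk : P.IsWaveNumbers k₁ k₂) (h : x ≠ y) (i j : Fin 2) :
    S.ker_1_1 P k₁ k₂ x y i j = toC (S.normal x) i *
        (-(lrGrad (helmProfile P.kS) x y j - lrGrad (helmProfile k₁) x y j) +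
          (k₂ ^ 2 - P.q) / (k₁ ^ 2 - k₂ ^ 2) *
            (lrGrad (helmProfile k₁) x y j - lrGrad (helmProfile k₂) x y j)) +
      (if i = j then toC (S.normal x) ⬝ᵥ lrGrad (helmProfile P.kS) x y else 0) -
      P.alpha * (toC (S.normal x) i * P.E12 k₁ k₂ x y j) := by
  have hg : grad (fun x' => -(helm P.kS x' y - helm k₁ x' y)
        + (k₂ ^ 2 - P.q) / (k₁ ^ 2 - k₂ ^ 2) * (helm k₁ x' y - helm k₂ x' y)) x =
      lrGrad (-(helmProfile P.kS - helmProfile k₁) +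
        ((k₂ ^ 2 - P.q) / (k₁ ^ 2 - k₂ ^ 2)) • (helmProfile k₁ - helmProfile k₂)) x y :=
    grad_lr h fun x' hx' => by
      rw [helm_eq P.kS_ne hx', helm_eq hk.ne_zero.1 hx', helm_eq hk.ne_zero.2 hx']
      simp only [map_add, map_neg, map_sub, map_smul, smul_eq_mul]
  have hneg : ∀ p : Profile, lrGrad (-p) x y j = -lrGrad p x y j := fun p => by
    simp only [lrGrad, map_neg]; ring
  rw [ker_1_1, hg, dirDeriv, (Medium.hasGrad_helm P.kS_ne h).grad_eq]
  simp only [Matrix.add_apply, Matrix.sub_apply, Matrix.vecMulVec_apply, Matrix.smul_apply,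
    Matrix.one_apply, smul_eq_mul, lrGrad_add, lrGrad_sub, lrGrad_smul, hneg]
  split_ifs <;> ring

theorem ker_4_1_eq (hk : P.IsWaveNumbers k₁ k₂) (h : x ≠ y) :
    S.ker_4_1 P k₁ k₂ x y = -(toC (S.normal x) ⬝ᵥ fun l =>
      (Complex.I * (P.omega : ℂ) * P.beta) * P.E21 k₁ k₂ x y l +
        ((P.kP ^ 2 - k₁ ^ 2) / (k₁ ^ 2 - k₂ ^ 2) * lrGrad (helmProfile k₁) x y l -
          (P.kP ^ 2 - k₂ ^ 2) / (k₁ ^ 2 - k₂ ^ 2) * lrGrad (helmProfile k₂) x y l)) := by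
  have hg : grad (fun x' => (P.kP ^ 2 - k₁ ^ 2) / (k₁ ^ 2 - k₂ ^ 2) * helm k₁ x' y
        - (P.kP ^ 2 - k₂ ^ 2) / (k₁ ^ 2 - k₂ ^ 2) * helm k₂ x' y) x =
      lrGrad (((P.kP ^ 2 - k₁ ^ 2) / (k₁ ^ 2 - k₂ ^ 2)) • helmProfile k₁ -
        ((P.kP ^ 2 - k₂ ^ 2) / (k₁ ^ 2 - k₂ ^ 2)) • helmProfile k₂) x y :=
    grad_lr h fun x' hx' => by
      rw [helm_eq hk.ne_zero.1 hx', helm_eq hk.ne_zero.2 hx']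
      simp only [map_sub, map_smul, smul_eq_mul]
  rw [ker_4_1, hg]
  congr 2
  funext l
  simp only [Pi.add_apply, Pi.smul_apply, smul_eq_mul, lrGrad_sub, lrGrad_smul]

end SmoothBoundary

namespace Medium

theorem hasGrad_ETmul_fst (hk : P.IsWaveNumbers k₁ k₂) (h : x ≠ y) (u : Fin 2 → ℂ) (p : ℂ)
    (i : Fin 2) :
    HasGrad (fun x' => (P.ETmul k₁ k₂ x' y (u, p)).1 i)
      (fun l => E11Grad P k₁ k₂ x y 0 i l * u 0 + E11Grad P k₁ k₂ x y 1 i l * u 1 +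
        p * ((-P.gam / (((P.lam + 2 * P.mu : ℝ) : ℂ) * (k₁ ^ 2 - k₂ ^ 2))) *
          lrHess (helmProfile k₁ - helmProfile k₂) x y l i)) x := by
  refine (((((hasGrad_E11 hk h 0 i).const_mul (u 0)).add
    ((hasGrad_E11 hk h 1 i).const_mul (u 1))).add
    (((hasGrad_grad_sub hk h i).const_mul
      (-P.gam / (((P.lam + 2 * P.mu : ℝ) : ℂ) * (k₁ ^ 2 - k₂ ^ 2)))).const_mul p)).congr
        (Eventually.of_forall fun x' => ?_)).congr_grad ?_
  · simp only [ETmul, E21, Pi.add_apply, Pi.smul_apply, smul_eq_mul, Matrix.mulVec, dotProduct,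
      Matrix.transpose_apply, Fin.sum_univ_two]
    ring
  · funext l; ring

theorem hasGrad_ETmul_snd (hk : P.IsWaveNumbers k₁ k₂) (h : x ≠ y) (u : Fin 2 → ℂ) (p : ℂ) :
    HasGrad (fun x' => (P.ETmul k₁ k₂ x' y (u, p)).2)
      (fun l => (Complex.I * (P.omega : ℂ) * P.gam /
          (((P.lam + 2 * P.mu : ℝ) : ℂ) * (k₁ ^ 2 - k₂ ^ 2))) *
        (u 0 * lrHess (helmProfile k₁ - helmProfile k₂) x y l 0 +
          u 1 * lrHess (helmProfile k₁ - helmProfile k₂) x y l 1) +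
        p * (Complex.I * (P.rhoF : ℂ) * (P.omega : ℂ) / (P.beta * (k₁ ^ 2 - k₂ ^ 2)) *
          ((P.kP ^ 2 - k₁ ^ 2) * lrGrad (helmProfile k₁) x y l -
            (P.kP ^ 2 - k₂ ^ 2) * lrGrad (helmProfile k₂) x y l))) x := by
  refine (((((hasGrad_grad_sub hk h 0).const_mul (u 0)).add
    ((hasGrad_grad_sub hk h 1).const_mul (u 1))).const_mul
      (Complex.I * (P.omega : ℂ) * P.gam /
          (((P.lam + 2 * P.mu : ℝ) : ℂ) * (k₁ ^ 2 - k₂ ^ 2)))).add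
    (((((hasGrad_helm hk.ne_zero.1 h).const_mul (P.kP ^ 2 - k₁ ^ 2)).sub
      ((hasGrad_helm hk.ne_zero.2 h).const_mul (P.kP ^ 2 - k₂ ^ 2))).const_mul
        (Complex.I * (P.rhoF : ℂ) * (P.omega : ℂ) / (P.beta * (k₁ ^ 2 - k₂ ^ 2)))).const_mul
          p)).congr (Eventually.of_forall fun x' => ?_)
  simp only [ETmul, E12, E22, Pi.smul_apply, smul_eq_mul, dotProduct, Fin.sum_univ_two]
  ring

end Medium

namespace SmoothBoundary

variable (S : SmoothBoundary Ω)

/-- The integrand of the displacement component of `K'` splits into the weakly singular kernels and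
the tangential derivatives of weakly singular kernels. -/
theorem neumann_ETmul_fst (hne : k₁ ^ 2 ≠ k₂ ^ 2) (hk : P.IsWaveNumbers k₁ k₂) (h : x ≠ y)
    (u : Fin 2 → ℂ) (p : ℂ) (i : Fin 2) :
    (P.neumann (S.normal x) (fun x' => P.ETmul k₁ k₂ x' y (u, p)) x).1 i =
      (S.ker_1_1 P k₁ k₂ x y i 0 + Medium.ker12Grad P k₁ k₂ x y i 0 ⬝ᵥ perp (S.normal x)) * u 0 +
      (S.ker_1_1 P k₁ k₂ x y i 1 + Medium.ker12Grad P k₁ k₂ x y i 1 ⬝ᵥ perp (S.normal x)) * u 1 +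
      p * (S.ker_2_1 P k₁ k₂ x y i + Medium.ker22Grad P k₁ k₂ x y i ⬝ᵥ perp (S.normal x)) := by
  have hG := Medium.hasGrad_ETmul_fst (P := P) hk h u p
  have hmu := mul_inv_cancel₀ P.mu_ne
  have hl := mul_inv_cancel₀ P.lamTwoMu_ne
  have ht := Medium.lrThird_psi_trace hne hk h
  have hb1 := lrHess_trace k₁ h
  have hb2 := lrHess_trace k₂ h
  have hc := lrHess_comm (helmProfile k₁ - helmProfile k₂) x y 1 0
  -- Third derivatives commute, so the Hessian part of E₁₁ has no rotation. It enters the traction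
  -- only through its divergence, given by `ht`, and through a tangential derivative.
  have s1 := lrThird_symm (P.psiProfile k₁ k₂) x y 1 0 0
  have s2 := lrThird_symm (P.psiProfile k₁ k₂) x y 1 1 0
  have s3 : lrThird (P.psiProfile k₁ k₂) x y 0 1 0 = lrThird (P.psiProfile k₁ k₂) x y 0 0 1 :=
    lrThird_right_comm _ _ _ _ _ _
  have s4 : lrThird (P.psiProfile k₁ k₂) x y 1 0 1 = lrThird (P.psiProfile k₁ k₂) x y 0 1 1 :=
    (lrThird_right_comm _ _ _ _ _ _).trans s2
  have ht0 := ht 0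
  have ht1 := ht 1
  rw [s3] at ht1
  rw [s4] at ht0
  have hE2 : (P.ETmul k₁ k₂ x y (u, p)).2 = P.E12 k₁ k₂ x y 0 * u 0 + P.E12 k₁ k₂ x y 1 * u 1 +
      P.E22 k₁ k₂ x y * p := by simp [Medium.ETmul, dotProduct]
  have hh0 : lrHess (helmProfile k₁ - helmProfile k₂) x y 0 0 +
      lrHess (helmProfile k₁ - helmProfile k₂) x y 1 1 =
      -(k₁ ^ 2 * lr (‖x - y‖ ^ 2) (helmProfile k₁) - k₂ ^ 2 * lr (‖x - y‖ ^ 2) (helmProfile k₂)) := by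
    rw [lrHess_sub, lrHess_sub]; linear_combination hb1 - hb2
  simp only [Medium.neumann, Medium.traction, Pi.add_apply, Pi.sub_apply, Pi.smul_apply,
    smul_eq_mul, dirDeriv, dvg, Fin.sum_univ_two, dotProduct, grad, fun i l => (hG i).pd_eq l,
    ker_1_1_eq S hk h, hE2, ker_2_1, Medium.ker12Grad, Medium.ker22Grad,
    Medium.E11Grad, helm_eq hk.ne_zero.1 h, helm_eq hk.ne_zero.2 h, rotA, perp, div_eq_mul_inv,
    mul_inv] at *
  generalize ((P.lam + 2 * P.mu : ℝ) : ℂ)⁻¹ = L at *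
  push_cast at hl
  generalize toC (S.normal x) = n
  generalize lrThird (P.psiProfile k₁ k₂) x y = H at *
  generalize lrHess (helmProfile k₁ - helmProfile k₂) x y = Q at *
  fin_cases i
  · simp [-mul_eq_mul_left_iff, -mul_eq_mul_right_iff] at ht0 ht1 ⊢
    rw [s1, s2, s3, s4, hc]
    -- `ht0` and `ht1` give the normal term (λ+2μ)∇·E₁₁, `hmu` cancels μ against the factor 1/μ in
    -- the rotation of γ_{k_s}/μ, and `hh0` with `hl` treats the gradient E₂₁ by the Helmholtz
    -- equation.
    linear_combination n 0 * (u 0 * ht0 + u 1 * ht1) +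
      n 1 * (lrGrad (helmProfile P.kS) x y 1 * u 0 - lrGrad (helmProfile P.kS) x y 0 * u 1) * hmu -
      p * n 0 * P.gam * (k₁ ^ 2 - k₂ ^ 2)⁻¹ * (P.lam + 2 * P.mu) * L * hh0 +
      p * n 0 * P.gam * (k₁ ^ 2 - k₂ ^ 2)⁻¹ * (k₁ ^ 2 * lr (‖x - y‖ ^ 2) (helmProfile k₁) -
        k₂ ^ 2 * lr (‖x - y‖ ^ 2) (helmProfile k₂)) * hl
  · simp [-mul_eq_mul_left_iff, -mul_eq_mul_right_iff] at ht0 ht1 ⊢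
    rw [s1, s2, s3, s4, hc]
    linear_combination n 1 * (u 0 * ht0 + u 1 * ht1) +
      -n 0 * (lrGrad (helmProfile P.kS) x y 1 * u 0 - lrGrad (helmProfile P.kS) x y 0 * u 1) * hmu -
      p * n 1 * P.gam * (k₁ ^ 2 - k₂ ^ 2)⁻¹ * (P.lam + 2 * P.mu) * L * hh0 +
      p * n 1 * P.gam * (k₁ ^ 2 - k₂ ^ 2)⁻¹ * (k₁ ^ 2 * lr (‖x - y‖ ^ 2) (helmProfile k₁) -
        k₂ ^ 2 * lr (‖x - y‖ ^ 2) (helmProfile k₂)) * hl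

/-- The integrand of the pressure component of `K'` splits into the weakly singular kernels and
the tangential derivatives of weakly singular kernels. -/
theorem neumann_ETmul_snd (hk : P.IsWaveNumbers k₁ k₂) (h : x ≠ y) (u : Fin 2 → ℂ) (p : ℂ) :
    (P.neumann (S.normal x) (fun x' => P.ETmul k₁ k₂ x' y (u, p)) x).2 =
      (S.ker_3_1 P k₁ k₂ x y 0 + Medium.ker32Grad P k₁ k₂ x y 0 ⬝ᵥ perp (S.normal x)) * u 0 +
      (S.ker_3_1 P k₁ k₂ x y 1 + Medium.ker32Grad P k₁ k₂ x y 1 ⬝ᵥ perp (S.normal x)) * u 1 +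
      S.ker_4_1 P k₁ k₂ x y * p := by
  have hG := Medium.hasGrad_ETmul_snd (P := P) hk h u p
  have hb := mul_inv_cancel₀ P.beta_ne
  have hr := mul_inv_cancel₀ P.rhoF_ne
  have ho := mul_inv_cancel₀ P.omega_ne
  have hb1 := lrHess_trace k₁ h
  have hb2 := lrHess_trace k₂ h
  have hc := lrHess_comm (helmProfile k₁ - helmProfile k₂) x y 1 0
  have hE : ∀ i, (P.ETmul k₁ k₂ x y (u, p)).1 i = P.E11 k₁ k₂ x y 0 i * u 0 +
      P.E11 k₁ k₂ x y 1 i * u 1 + p * P.E21 k₁ k₂ x y i := fun i => by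
    simp only [Medium.ETmul, Pi.add_apply, Pi.smul_apply, Matrix.mulVec, dotProduct,
      Matrix.transpose_apply, Fin.sum_univ_two, smul_eq_mul]
  -- K' contains the transpose of E₁₁ while `ker_3_1` contains E₁₁ itself; the two agree by
  -- symmetry.
  have hs : P.E11 k₁ k₂ x y 1 0 = P.E11 k₁ k₂ x y 0 1 := by
    rw [Medium.E11_eq hk h, Medium.E11_eq hk h, lrHess_comm]; simp
  have hh0 : lrHess (helmProfile k₁ - helmProfile k₂) x y 0 0 +
      lrHess (helmProfile k₁ - helmProfile k₂) x y 1 1 =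
      -(k₁ ^ 2 * lr (‖x - y‖ ^ 2) (helmProfile k₁) - k₂ ^ 2 * lr (‖x - y‖ ^ 2) (helmProfile k₂)) := by
    rw [lrHess_sub, lrHess_sub]; linear_combination hb1 - hb2
  have hI := Complex.I_mul_I
  simp only [Medium.neumann, smul_eq_mul, dirDeriv, Fin.sum_univ_two, dotProduct, grad, hG.pd_eq,
    ker_4_1_eq S hk h, hE, ker_3_1, Medium.ker32Grad, Medium.C0, Pi.add_apply, Pi.smul_apply,
    Matrix.vecMul, helm_eq hk.ne_zero.1 h, helm_eq hk.ne_zero.2 h, rotA, perp, div_eq_mul_inv,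
    mul_inv] at *
  generalize ((P.lam + 2 * P.mu : ℝ) : ℂ)⁻¹ = L at *
  generalize toC (S.normal x) = n
  generalize lrHess (helmProfile k₁ - helmProfile k₂) x y = Q at *
  simp [-mul_eq_mul_left_iff, -mul_eq_mul_right_iff]
  rw [hs, hc]
  generalize (k₁ ^ 2 - k₂ ^ 2)⁻¹ = D at *
  -- Since i² = -1, the coefficient in front of ∂_ν of the gradient in E₁₂ is -C₀. Likewise `h2`
  -- finds the factor -1/(k₁²-k₂²) for E₂₂.
  have h1 : ∀ X : ℂ, Complex.I * P.beta * ((P.omega : ℂ)⁻¹ * (P.rhoF : ℂ)⁻¹) *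
      (Complex.I * P.omega * P.gam * (L * D) * X) =
      -(P.beta * P.gam * ((P.rhoF : ℂ)⁻¹ * L * D)) * X := fun X => by
    linear_combination P.beta * P.gam * (P.rhoF : ℂ)⁻¹ * L * D * X *
      ((P.omega : ℂ) * (P.omega : ℂ)⁻¹ * hI - ho)
  have h2 : ∀ X : ℂ, Complex.I * P.beta * ((P.omega : ℂ)⁻¹ * (P.rhoF : ℂ)⁻¹) *
      (p * (Complex.I * P.rhoF * P.omega * (P.beta⁻¹ * D) * X)) = -p * D * X := fun X => by
    linear_combination p * D * X * (P.beta * P.beta⁻¹ * ((P.omega : ℂ) * (P.omega : ℂ)⁻¹) *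
      ((P.rhoF : ℂ) * (P.rhoF : ℂ)⁻¹) * hI - P.beta * P.beta⁻¹ * ((P.omega : ℂ) * (P.omega : ℂ)⁻¹) *
        hr - P.beta * P.beta⁻¹ * ho - hb)
  linear_combination n 0 * h1 (u 0 * Q 0 0 + u 1 * Q 0 1) + n 1 * h1 (u 0 * Q 0 1 + u 1 * Q 1 1) +
    n 0 * h2 ((P.kP ^ 2 - k₁ ^ 2) * lrGrad (helmProfile k₁) x y 0 -
      (P.kP ^ 2 - k₂ ^ 2) * lrGrad (helmProfile k₂) x y 0) +
    n 1 * h2 ((P.kP ^ 2 - k₁ ^ 2) * lrGrad (helmProfile k₁) x y 1 -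
      (P.kP ^ 2 - k₂ ^ 2) * lrGrad (helmProfile k₂) x y 1) -
    P.beta * P.gam * ((P.rhoF : ℂ)⁻¹ * L * D) * (n 0 * u 0 + n 1 * u 1) * hh0

end SmoothBoundary

end

section

/-! ### Differentiation of integrals with a singular diagonal -/

open Asymptotics in
/-- Differentiation under the integral sign at `t₀` when the integrand is singular on the diagonal:
away from the diagonal the derivative is dominated, and near the diagonal the increments have
negligible mean. -/
theorem hasDerivAt_integral_of_near_diagonal {μ : Measure ℝ} {K K' : ℝ → ℝ → ℂ} {t₀ δ : ℝ}
    {g : ℝ → ℝ} (hδ : 0 < δ) (hK : ∀ t, |t - t₀| < δ → Integrable (K t) μ)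
    (hK' : AEStronglyMeasurable (K' t₀) μ) (hg : Integrable g μ)
    (hd : ∀ᵐ τ ∂μ, τ ≠ t₀ ∧ ∀ t, |t - t₀| < δ → 2 * |t - t₀| < |τ - t₀| →
      HasDerivAt (fun s => K s τ) (K' t τ) t ∧ ‖K' t τ‖ ≤ g τ)
    (hn : (fun t => ∫ τ in {τ | |τ - t₀| ≤ 2 * |t - t₀|}, ‖K t τ - K t₀ τ‖ ∂μ) =o[𝓝 t₀]
      fun t => t - t₀) :
    Integrable (K' t₀) μ ∧ HasDerivAt (fun t => ∫ τ, K t τ ∂μ) (∫ τ, K' t₀ τ ∂μ) t₀ := by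
  classical
  -- The far set grows to everything except t₀ as t → t₀.
  set far : ℝ → Set ℝ := fun t => {τ | 2 * |t - t₀| < |τ - t₀|} with hfar
  have hfarm : ∀ t, MeasurableSet (far t) := fun t =>
    measurableSet_lt measurable_const (by fun_prop)
  -- Freezing the integrand at t₀ on the near set makes its increment vanish there, so the usual
  -- dominated differentiation theorem applies to F. The error K - F is controlled by `hn`.
  set F : ℝ → ℝ → ℂ := fun t => (far t).piecewise (K t) (K t₀) with hF
  have h0 : Integrable (K t₀) μ := hK t₀ (by simpa using hδ)
  have hFint : ∀ t, |t - t₀| < δ → Integrable (F t) μ := fun t ht =>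
    Integrable.piecewise (hfarm t) (hK t ht).integrableOn h0.integrableOn
  have hball : Metric.ball t₀ δ ∈ 𝓝 t₀ := Metric.ball_mem_nhds _ hδ
  set L : ℂ →L[ℝ] ℝ →L[ℝ] ℂ := ContinuousLinearMap.smulRightL ℝ ℝ ℂ 1
  have hm : AEStronglyMeasurable (L ∘ K' t₀) μ := L.continuous.comp_aestronglyMeasurable hK'
  have key0 := hasFDerivAt_integral_of_dominated_loc_of_lip' (μ := μ) (F := F)
    (x₀ := t₀) (s := Metric.ball t₀ δ) (F' := L ∘ K' t₀) (bound := g) hball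
    (fun t ht => (hFint t (by simpa [Real.dist_eq] using ht)).aestronglyMeasurable)
    (hFint t₀ (by simpa using hδ)) hm ?_ hg ?_
  · obtain ⟨hi, key⟩ := key0
    have hi' : Integrable (K' t₀) μ := by
      rw [← integrable_norm_iff hm] at hi
      simpa [L, (· ∘ ·), integrable_norm_iff hK'] using! hi
    refine ⟨hi', ?_⟩
    have key' : HasDerivAt (fun t => ∫ τ, F t τ ∂μ) (∫ τ, K' t₀ τ ∂μ) t₀ := by
      rw [hasDerivAt_iff_hasFDerivAt]
      simpa only [(· ∘ ·), ContinuousLinearMap.integral_comp_comm _ hi'] using! key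
    have hrem : HasDerivAt (fun t => (∫ τ, K t τ ∂μ) - ∫ τ, F t τ ∂μ) 0 t₀ := by
      rw [hasDerivAt_iff_isLittleO]
      have hz : (∫ τ, K t₀ τ ∂μ) - ∫ τ, F t₀ τ ∂μ = 0 := by
        have : F t₀ = K t₀ := by ext τ; simp [hF]
        rw [this, sub_self]
      simp only [hz, smul_zero, sub_zero]
      refine IsBigO.trans_isLittleO (IsBigO.of_bound 1 ?_) hn
      filter_upwards [hball] with t ht
      have ht' : |t - t₀| < δ := by simpa [Real.dist_eq] using ht
      have hc : {τ | |τ - t₀| ≤ 2 * |t - t₀|} = (far t)ᶜ := by ext τ; simp [hfar]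
      rw [← integral_sub (hK t ht') (hFint t ht'), one_mul, hc,
        ← integral_indicator (hfarm t).compl]
      refine (norm_integral_le_integral_norm _).trans (le_trans (le_of_eq ?_) (le_abs_self _))
      congr 1
      ext τ
      by_cases hτ : τ ∈ far t
      · simp [hF, hτ]
      · simp [hF, hτ]
    simpa using! hrem.fun_add key'
  · filter_upwards [hd] with τ hτ t ht
    have ht' : |t - t₀| < δ := by simpa [Real.dist_eq] using ht
    have hF0 : F t₀ τ = K t₀ τ := by simp [hF]
    rw [hF0]
    by_cases hf : τ ∈ far t
    -- If τ is far for t, it is far for every s between t₀ and t, so the mean value inequality may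
    -- use the bound g(τ) along the whole segment.
    · have hcv : Convex ℝ (Set.uIcc t₀ t) := convex_uIcc _ _
      have hle : ∀ s ∈ Set.uIcc t₀ t, |s - t₀| ≤ |t - t₀| := fun s hs =>
        Set.abs_sub_left_of_mem_uIcc hs
      have := hcv.norm_image_sub_le_of_norm_hasDerivWithin_le (f := fun s => K s τ)
        (f' := fun s => K' s τ) (C := g τ)
        (fun s hs => ((hτ.2 s ((hle s hs).trans_lt ht') (by
          have : 2 * |t - t₀| < |τ - t₀| := hf
          have := hle s hs; linarith)).1).hasDerivWithinAt)
        (fun s hs => (hτ.2 s ((hle s hs).trans_lt ht') (by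
          have : 2 * |t - t₀| < |τ - t₀| := hf
          have := hle s hs; linarith)).2) Set.left_mem_uIcc Set.right_mem_uIcc
      simpa [hF, hf] using this
    · have h1 := (norm_nonneg _).trans (hτ.2 t₀ (by simpa using hδ)
        (by simpa [sub_eq_zero] using hτ.1)).2
      simp only [hF, hf, Set.piecewise, if_false, sub_self, norm_zero]
      positivity
  · filter_upwards [hd] with τ hτ
    have h1 : HasDerivAt (fun s => K s τ) (K' t₀ τ) t₀ :=
      (hτ.2 t₀ (by simpa using hδ) (by simpa [sub_eq_zero] using hτ.1)).1
    refine (h1.congr_of_eventuallyEq ?_).hasFDerivAt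
    have hpos : 0 < |τ - t₀| := by simpa [sub_eq_zero] using hτ.1
    have : Metric.ball t₀ (|τ - t₀| / 2) ∈ 𝓝 t₀ := Metric.ball_mem_nhds _ (by positivity)
    filter_upwards [this] with t ht
    have : τ ∈ far t := by
      have : |t - t₀| < |τ - t₀| / 2 := by simpa [Real.dist_eq] using ht
      show 2 * |t - t₀| < |τ - t₀|
      linarith
    simp [hF, this]

/-! ### Integrability of powers of the distance -/

theorem integrableOn_abs_sub_rpow (t₀ : ℝ) {e : ℝ} (he : -1 < e) (a b : ℝ) :
    IntegrableOn (fun τ => |τ - t₀| ^ e) (Set.Ioc a b) := by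
  have h0 : ∀ c : ℝ, IntervalIntegrable (fun s : ℝ => |s| ^ e) volume 0 c := by
    have hpos : ∀ c : ℝ, 0 ≤ c → IntervalIntegrable (fun s : ℝ => |s| ^ e) volume 0 c := by
      intro c hc
      refine (intervalIntegral.intervalIntegrable_rpow' he (a := 0) (b := c)).congr fun s hs => ?_
      rw [Set.uIoc_of_le hc] at hs
      simp only [abs_of_pos hs.1]
    intro c
    rcases le_total 0 c with hc | hc
    · exact hpos c hc
    · rw [IntervalIntegrable.iff_comp_neg]
      simpa using hpos (-c) (by linarith)
  have h1 : IntervalIntegrable (fun s : ℝ => |s| ^ e) volume (a - t₀) (b - t₀) :=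
    (h0 _).symm.trans (h0 _)
  have h2 := h1.comp_sub_right t₀
  simp only [sub_add_cancel] at h2
  exact h2.1

theorem ae_ne (μ : Measure ℝ) [NullSingletonClass μ] (t : ℝ) : ∀ᵐ τ ∂μ, τ ≠ t :=
  compl_mem_ae_iff.2 (measure_singleton t)

/-! ### The logarithmic kernel -/

/-- By the antiderivative s log s - s the derivative at t₀ is log w - log(-w), which is 0 because
`Real.log` is even. The centred interval is essential. -/
theorem hasDerivAt_integral_log (t₀ : ℝ) {w : ℝ} (hw : 0 < w) :
    HasDerivAt (fun t => ∫ τ in Set.Ioc (t₀ - w) (t₀ + w), (Real.log (t - τ) : ℂ)) 0 t₀ := by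
  have h1 : ∀ t, ∫ τ in Set.Ioc (t₀ - w) (t₀ + w), (Real.log (t - τ) : ℂ) =
      (((t - t₀ + w) * Real.log (t - t₀ + w) - (t - t₀ - w) * Real.log (t - t₀ - w) - 2 * w : ℝ) :
        ℂ) := by
    intro t
    rw [integral_complex_ofReal, ← intervalIntegral.integral_of_le (by linarith),
      intervalIntegral.integral_comp_sub_left (fun s => Real.log s), integral_log]
    ring_nf
  simp only [h1]
  rw [← Complex.ofReal_zero]
  refine HasDerivAt.ofReal_comp ?_
  have e1 : HasDerivAt (fun t => t - t₀ + w) 1 t₀ := ((hasDerivAt_id t₀).sub_const t₀).add_const w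
  have e2 : HasDerivAt (fun t => t - t₀ - w) 1 t₀ := ((hasDerivAt_id t₀).sub_const t₀).sub_const w
  have l1 := (Real.hasDerivAt_mul_log (x := t₀ - t₀ + w) (by simpa using hw.ne')).comp t₀ e1
  have l2 := (Real.hasDerivAt_mul_log (x := t₀ - t₀ - w) (by simpa using hw.ne')).comp t₀ e2
  refine ((l1.sub l2).sub_const (2 * w)).congr_deriv ?_
  simp

theorem integrableOn_log_sub (t a b : ℝ) :
    IntegrableOn (fun τ => Real.log (t - τ)) (Set.Ioc a b) := by
  have h := (intervalIntegral.intervalIntegrable_log' (a := t - a) (b := t - b)).comp_sub_left t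
  simp only [sub_sub_cancel] at h
  exact h.1

/-- For s ≤ 1 the logarithm has one sign and can be integrated explicitly. The factor 1 - log s is
later beaten by a power of s coming from the density. -/
theorem integral_abs_log_le {s : ℝ} (hs : 0 < s) (hs1 : s ≤ 1) (t : ℝ) :
    ∫ τ in Set.Ioc (t - s) (t + s), |Real.log (t - τ)| = 2 * s * (1 - Real.log s) := by
  have : ∀ τ ∈ Set.Ioc (t - s) (t + s), |Real.log (t - τ)| = -Real.log (t - τ) := by
    intro τ hτ
    refine abs_of_nonpos ?_
    rw [← Real.log_abs]
    refine Real.log_nonpos (abs_nonneg _) ?_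
    rw [abs_le]; constructor <;> linarith [hτ.1, hτ.2]
  rw [setIntegral_congr_fun measurableSet_Ioc this, integral_neg,
    ← intervalIntegral.integral_of_le (by linarith),
    intervalIntegral.integral_comp_sub_left (fun s => Real.log s), integral_log]
  have : Real.log (t - (t + s)) = Real.log s := by
    rw [show t - (t + s) = -s by ring, Real.log_neg_eq_log]
  rw [this, sub_sub_cancel]
  ring

open Asymptotics in
/-- The derivative of the logarithmic potential of a Hölder continuous density. -/
theorem hasDerivAt_integral_log_mul {t₀ w C r : ℝ} (hw : 0 < w) (hr : 0 < r) {ψ : ℝ → ℂ}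
    (hψ : Continuous ψ) (hH : ∀ τ, |τ - t₀| ≤ w → ‖ψ τ - ψ t₀‖ ≤ C * |τ - t₀| ^ r) :
    IntegrableOn (fun τ => (ψ τ - ψ t₀) / ((t₀ - τ : ℝ) : ℂ)) (Set.Ioc (t₀ - w) (t₀ + w)) ∧
    HasDerivAt (fun t => ∫ τ in Set.Ioc (t₀ - w) (t₀ + w), (Real.log (t - τ) : ℂ) * ψ τ)
      (∫ τ in Set.Ioc (t₀ - w) (t₀ + w), (ψ τ - ψ t₀) / ((t₀ - τ : ℝ) : ℂ)) t₀ := by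
  set W := Set.Ioc (t₀ - w) (t₀ + w) with hW
  have hmemW : ∀ τ ∈ W, |τ - t₀| ≤ w := fun τ hτ => by
    rw [abs_le]; constructor <;> linarith [hτ.1, hτ.2]
  have hC : 0 ≤ C := by
    have := (norm_nonneg _).trans (hH (t₀ + w) (by simp [abs_of_pos hw]))
    simp only [add_sub_cancel_left, abs_of_pos hw] at this
    exact nonneg_of_mul_nonneg_left this (by positivity)
  have hlogm : ∀ t, IntegrableOn (fun τ => (Real.log (t - τ) : ℂ)) W := fun t =>
    (integrableOn_log_sub t _ _).ofReal
  have hint : ∀ (φ : ℝ → ℂ), Continuous φ → ∀ t,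
      IntegrableOn (fun τ => (Real.log (t - τ) : ℂ) * φ τ) W := by
    intro φ hφ t
    obtain ⟨B, hB⟩ := (isCompact_Icc (a := t₀ - w) (b := t₀ + w)).exists_bound_of_continuousOn
      hφ.continuousOn
    refine Integrable.mul_bdd (c := B) (hlogm t) hφ.aestronglyMeasurable ?_
    exact (ae_restrict_iff' measurableSet_Ioc).2 (Eventually.of_forall fun τ hτ =>
      hB τ ⟨hτ.1.le, hτ.2⟩)
  -- In the far region |t-τ| ≥ |τ-t₀|/2, which replaces the moving singularity by a fixed one of
  -- exponent r - 1 > -1.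
  have hbd : ∀ τ ∈ W, τ ≠ t₀ → ∀ t, 2 * |t - t₀| < |τ - t₀| →
      ‖((t - τ : ℝ) : ℂ)⁻¹ * (ψ τ - ψ t₀)‖ ≤ 2 * C * |τ - t₀| ^ (r - 1) := by
    intro τ hτ hne t ht
    have hp : 0 < |τ - t₀| := by simpa [sub_eq_zero] using hne
    have h1 : |τ - t₀| / 2 ≤ |t - τ| := by
      have := abs_sub_le τ t t₀
      rw [abs_sub_comm τ t] at this
      linarith
    rw [norm_mul, norm_inv, Complex.norm_real, Real.norm_eq_abs, Real.rpow_sub hp, Real.rpow_one]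
    have h2 := hH τ (hmemW τ hτ)
    calc |t - τ|⁻¹ * ‖ψ τ - ψ t₀‖ ≤ (|τ - t₀| / 2)⁻¹ * (C * |τ - t₀| ^ r) := by gcongr
      _ = 2 * C * (|τ - t₀| ^ r / |τ - t₀|) := by field_simp
  have hA := hasDerivAt_integral_of_near_diagonal (μ := volume.restrict W)
    (K := fun t τ => (Real.log (t - τ) : ℂ) * (ψ τ - ψ t₀))
    (K' := fun t τ => ((t - τ : ℝ) : ℂ)⁻¹ * (ψ τ - ψ t₀)) (t₀ := t₀)
    (g := fun τ => 2 * C * |τ - t₀| ^ (r - 1)) one_pos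
    (fun t _ => hint _ (hψ.sub continuous_const) t) (by
      refine Measurable.aestronglyMeasurable ?_
      have := hψ.measurable
      fun_prop)
    ((integrableOn_abs_sub_rpow t₀ (by linarith) _ _).const_mul _) (by
      filter_upwards [ae_ne (volume.restrict W) t₀, ae_restrict_mem measurableSet_Ioc]
        with τ hτ hτW
      refine ⟨hτ, fun t _ ht2 => ⟨?_, hbd τ hτW hτ t ht2⟩⟩
      have hne : t - τ ≠ 0 := by
        intro h0
        rw [sub_eq_zero] at h0
        rw [h0] at ht2
        linarith [abs_nonneg (τ - t₀)]
      have h1 : HasDerivAt (fun s => Real.log (s - τ)) (t - τ)⁻¹ t := by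
        simpa using ((hasDerivAt_id t).sub_const τ).log hne
      have h2 := h1.ofReal_comp.mul_const (ψ τ - ψ t₀)
      simpa using h2) ?_
  · obtain ⟨hA1, hA2⟩ := hA
    have e : ∀ τ, ((t₀ - τ : ℝ) : ℂ)⁻¹ * (ψ τ - ψ t₀) = (ψ τ - ψ t₀) / ((t₀ - τ : ℝ) : ℂ) :=
      fun τ => by rw [div_eq_mul_inv, mul_comm]
    simp only [e] at hA1 hA2
    refine ⟨hA1, ?_⟩
    -- The density is split as (ψ - ψ(t₀)) + ψ(t₀); the constant part contributes derivative 0.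
    have h3 := hA2.fun_add ((hasDerivAt_integral_log t₀ hw).mul_const (ψ t₀))
    simp only [zero_mul, add_zero] at h3
    refine h3.congr_of_eventuallyEq (Eventually.of_forall fun t => ?_)
    beta_reduce
    rw [← integral_mul_const, ← integral_add (hint (fun τ => ψ τ - ψ t₀) (by fun_prop) t)
      ((hlogm t).mul_const _)]
    congr 1; ext τ; ring
  -- The near-diagonal contribution divided by h = |t-t₀|. It tends to 0 because h^r log h does.
  · have hlim : Tendsto (fun h : ℝ => C * (2 * h) ^ r * (2 * (6 * (1 - Real.log (3 * h)))))
        (𝓝[>] 0) (𝓝 0) := by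
      have h1 : Tendsto (fun h : ℝ => Real.log h * h ^ r) (𝓝[>] 0) (𝓝 0) :=
        tendsto_log_mul_rpow_nhdsGT_zero hr
      have h2 : Tendsto (fun h : ℝ => h ^ r) (𝓝[>] 0) (𝓝 0) := by
        have := (Real.continuousAt_rpow_const 0 r (Or.inr hr.le)).tendsto
        rw [Real.zero_rpow hr.ne'] at this
        exact this.mono_left nhdsWithin_le_nhds
      have h3 := ((h2.const_mul (1 - Real.log 3)).sub h1).const_mul (C * 2 ^ r * 12)
      simp only [mul_zero, sub_zero] at h3
      refine h3.congr' ?_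
      filter_upwards [self_mem_nhdsWithin] with h hh
      have hh : (0 : ℝ) < h := hh
      rw [Real.mul_rpow two_pos.le hh.le, Real.log_mul (by norm_num) hh.ne']
      ring
    rw [isLittleO_iff]
    intro c hc
    have hev := (hlim.eventually (gt_mem_nhds hc))
    rw [eventually_nhdsWithin_iff] at hev
    have habs : Tendsto (fun t => |t - t₀|) (𝓝 t₀) (𝓝 0) := by
      have : Continuous fun t => |t - t₀| := by fun_prop
      simpa using this.tendsto t₀
    filter_upwards [habs.eventually hev, habs.eventually (gt_mem_nhds (show (0 : ℝ) < 1 / 3 by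
      norm_num))] with t ht ht3
    rcases eq_or_ne t t₀ with rfl | hne
    · simp
    have hp : 0 < |t - t₀| := by simpa [sub_eq_zero] using hne
    have ht := ht hp
    set h := |t - t₀|
    have hlogb : ∀ t', IntegrableOn (fun τ => |Real.log (t' - τ)|) (Set.Ioc (t' - 3 * h) (t' + 3 * h)) :=
      fun t' => (integrableOn_log_sub t' _ _).abs
    have hnm : MeasurableSet {τ : ℝ | |τ - t₀| ≤ 2 * h} :=
      measurableSet_le (by fun_prop) measurable_const
    -- From |τ-t₀| ≤ 2h and |t'-t₀| ≤ h follows |τ-t'| ≤ 3h. The requirement 3h ≤ 1 of the logarithm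
    -- integral explains the restriction h < 1/3.
    have hsub : ∀ t', |t' - t₀| ≤ h → {τ : ℝ | |τ - t₀| ≤ 2 * h} ∩ W ⊆
        Set.Icc (t' - 3 * h) (t' + 3 * h) := by
      intro t' ht' τ hτ
      have h1 := abs_le.1 (show |τ - t₀| ≤ 2 * h from hτ.1)
      have h2 := abs_le.1 ht'
      constructor <;> linarith [h1.1, h1.2, h2.1, h2.2]
    have hJ : ∀ t', |t' - t₀| ≤ h → ∫ τ in {τ : ℝ | |τ - t₀| ≤ 2 * h} ∩ W, |Real.log (t' - τ)| ≤
        6 * h * (1 - Real.log (3 * h)) := by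
      intro t' ht'
      have h1 : IntegrableOn (fun τ => |Real.log (t' - τ)|) (Set.Icc (t' - 3 * h) (t' + 3 * h)) := by
        rw [integrableOn_Icc_iff_integrableOn_Ioc]; exact hlogb t'
      have := setIntegral_mono_set h1 (Eventually.of_forall fun τ => abs_nonneg _)
        (hsub t' ht').eventuallyLE
      rw [integral_Icc_eq_integral_Ioc, integral_abs_log_le (by positivity) (by linarith)] at this
      linarith
    have hIi : ∀ t', IntegrableOn (fun τ => |Real.log (t' - τ)|) ({τ : ℝ | |τ - t₀| ≤ 2 * h} ∩ W) :=
      fun t' => IntegrableOn.mono_set (show IntegrableOn (fun τ => |Real.log (t' - τ)|) W volume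
        from
        (integrableOn_log_sub t' (t₀ - w) (t₀ + w)).abs) Set.inter_subset_right
    rw [Measure.restrict_restrict hnm]
    have hle : ∫ τ in {τ : ℝ | |τ - t₀| ≤ 2 * h} ∩ W,
        ‖(Real.log (t - τ) : ℂ) * (ψ τ - ψ t₀) - (Real.log (t₀ - τ) : ℂ) * (ψ τ - ψ t₀)‖ ≤
        ∫ τ in {τ : ℝ | |τ - t₀| ≤ 2 * h} ∩ W,
          C * (2 * h) ^ r * (|Real.log (t - τ)| + |Real.log (t₀ - τ)|) := by
      refine integral_mono_of_nonneg (Eventually.of_forall fun τ => norm_nonneg _)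
        (((hIi t).add (hIi t₀)).const_mul _) ?_
      refine (ae_restrict_iff' (hnm.inter measurableSet_Ioc)).2 (Eventually.of_forall fun τ hτ => ?_)
      have h1 : ‖ψ τ - ψ t₀‖ ≤ C * (2 * h) ^ r :=
        (hH τ (hmemW τ hτ.2)).trans (by
          have : |τ - t₀| ≤ 2 * h := hτ.1
          gcongr)
      have h2 : ‖((Real.log (t - τ) : ℝ) : ℂ) - ((Real.log (t₀ - τ) : ℝ) : ℂ)‖ ≤
          |Real.log (t - τ)| + |Real.log (t₀ - τ)| := by
        refine (norm_sub_le _ _).trans (le_of_eq ?_)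
        simp [Complex.norm_real]
      simp only
      rw [← sub_mul, norm_mul, mul_comm]
      gcongr
    rw [integral_const_mul, integral_add (hIi t) (hIi t₀)] at hle
    rw [Real.norm_of_nonneg (integral_nonneg fun τ => norm_nonneg _), Real.norm_eq_abs]
    refine hle.trans ?_
    have h5 := hJ t le_rfl
    have h6 := hJ t₀ (by simp [hp.le])
    have h7 : 0 ≤ C * (2 * h) ^ r := by positivity
    calc C * (2 * h) ^ r * ((∫ τ in {τ : ℝ | |τ - t₀| ≤ 2 * h} ∩ W, |Real.log (t - τ)|) +
          ∫ τ in {τ : ℝ | |τ - t₀| ≤ 2 * h} ∩ W, |Real.log (t₀ - τ)|)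
        ≤ C * (2 * h) ^ r * (6 * h * (1 - Real.log (3 * h)) + 6 * h * (1 - Real.log (3 * h))) := by
          gcongr
      _ = C * (2 * h) ^ r * (2 * (6 * (1 - Real.log (3 * h)))) * h := by ring
      _ ≤ c * h := by gcongr

end

section

/-! ### Kernels that are regular up to a mild singularity on the diagonal -/

/-- A function of `(t, τ)`, for `t` near `t₀` and `|τ - t₀| ≤ w`, that is bounded off the diagonal,
has a limit at `(t₀, t₀)`, and whose `t`-derivative is weakly singular. -/
def MildlySingular {E : Type*} [NormedAddCommGroup E] [NormedSpace ℝ E] (t₀ w : ℝ)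
    (m : ℝ → ℝ → E) : Prop :=
  (∃ C : ℝ, ∀ t τ, |t - t₀| < 1 → |τ - t₀| ≤ w → t ≠ τ →
    DifferentiableAt ℝ (fun s => m s τ) t ∧ ‖m t τ‖ ≤ C ∧
      ‖deriv (fun s => m s τ) t‖ ≤ C * |t - τ| ^ (-(1 / 2) : ℝ)) ∧
  ∃ l : E, Tendsto (fun a : ℝ × ℝ => m a.1 a.2) (𝓝[{a | a.1 ≠ a.2}] (t₀, t₀)) (𝓝 l)

theorem ae_mem_Ioc_abs {t₀ w : ℝ} : ∀ᵐ τ ∂volume.restrict (Set.Ioc (t₀ - w) (t₀ + w)),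
    |τ - t₀| ≤ w := by
  filter_upwards [ae_restrict_mem measurableSet_Ioc] with τ hτ
  rw [abs_le]; constructor <;> linarith [hτ.1, hτ.2]

open Asymptotics in
-- The near set has measure at most 4|t-t₀|, and on it both M(t,·) and M(t₀,·) are close to the
-- common limit l, so their difference contributes o(|t-t₀|). Boundedness alone would give only
-- O(|t-t₀|). In the far region the derivative is dominated by a multiple of |τ-t₀|^{-1/2}.
theorem MildlySingular.hasDerivAt_integral {t₀ w : ℝ} {M M' : ℝ → ℝ → ℂ} {ψ : ℝ → ℂ}
    (hM : MildlySingular t₀ w M)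
    (hM' : ∀ t τ, |t - t₀| < 1 → |τ - t₀| ≤ w → t ≠ τ → HasDerivAt (fun s => M s τ) (M' t τ) t)
    (hMm : ∀ t, |t - t₀| < 1 →
      AEStronglyMeasurable (M t) (volume.restrict (Set.Ioc (t₀ - w) (t₀ + w))))
    (hMm' : AEStronglyMeasurable (M' t₀) (volume.restrict (Set.Ioc (t₀ - w) (t₀ + w))))
    (hψ : Continuous ψ) :
    (∀ t, |t - t₀| < 1 → IntegrableOn (fun τ => M t τ * ψ τ) (Set.Ioc (t₀ - w) (t₀ + w))) ∧
    IntegrableOn (fun τ => M' t₀ τ * ψ τ) (Set.Ioc (t₀ - w) (t₀ + w)) ∧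
    HasDerivAt (fun t => ∫ τ in Set.Ioc (t₀ - w) (t₀ + w), M t τ * ψ τ)
      (∫ τ in Set.Ioc (t₀ - w) (t₀ + w), M' t₀ τ * ψ τ) t₀ := by
  set W := Set.Ioc (t₀ - w) (t₀ + w) with hW
  obtain ⟨⟨C, hC⟩, l, hl⟩ := hM
  obtain ⟨B, hB⟩ := (isCompact_Icc (a := t₀ - w) (b := t₀ + w)).exists_bound_of_continuousOn
    hψ.continuousOn
  have hBW : ∀ τ, |τ - t₀| ≤ w → ‖ψ τ‖ ≤ B := fun τ hτ => by
    have := abs_le.1 hτ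
    exact hB τ ⟨by linarith, by linarith⟩
  have hint : ∀ t, |t - t₀| < 1 → IntegrableOn (fun τ => M t τ * ψ τ) W := by
    intro t ht
    refine Integrable.of_bound ((hMm t ht).mul hψ.aestronglyMeasurable) (C * B) ?_
    filter_upwards [ae_mem_Ioc_abs (t₀ := t₀) (w := w), ae_ne _ t] with τ hτ hne
    have h1 := (hC t τ ht hτ hne.symm).2.1
    rw [norm_mul]
    have := (norm_nonneg _).trans h1
    have := hBW τ hτ
    gcongr
  refine ⟨hint, ?_⟩
  refine hasDerivAt_integral_of_near_diagonal (μ := volume.restrict W)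
    (K := fun t τ => M t τ * ψ τ) (K' := fun t τ => M' t τ * ψ τ)
    (g := fun τ => (C * B) * (|τ - t₀| / 2) ^ (-(1 / 2) : ℝ)) one_pos hint
    (hMm'.mul hψ.aestronglyMeasurable) ?_ ?_ ?_
  · refine Integrable.const_mul ?_ _
    have : (fun τ => (|τ - t₀| / 2) ^ (-(1 / 2) : ℝ)) =
        fun τ => |τ - t₀| ^ (-(1 / 2) : ℝ) / 2 ^ (-(1 / 2) : ℝ) := by
      ext τ; rw [Real.div_rpow (abs_nonneg _) two_pos.le]
    rw [this]
    exact (integrableOn_abs_sub_rpow t₀ (by norm_num) _ _).div_const _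
  · filter_upwards [ae_mem_Ioc_abs (t₀ := t₀) (w := w), ae_ne _ t₀] with τ hτ hne
    refine ⟨hne, fun t ht1 ht2 => ?_⟩
    have hp : 0 < |τ - t₀| := by simpa [sub_eq_zero] using hne
    have h1 : |τ - t₀| / 2 ≤ |t - τ| := by
      have := abs_sub_le τ t t₀
      rw [abs_sub_comm τ t] at this
      linarith
    have htne : t ≠ τ := by
      rintro rfl
      simp only [sub_self, abs_zero] at h1
      linarith
    have hd := hM' t τ ht1 hτ htne
    refine ⟨hd.mul_const _, ?_⟩
    obtain ⟨-, hb0, hb1⟩ := hC t τ ht1 hτ htne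
    rw [hd.deriv] at hb1
    have hC0 : 0 ≤ C := (norm_nonneg _).trans hb0
    have hB0 : 0 ≤ B := (norm_nonneg _).trans (hBW τ hτ)
    rw [norm_mul]
    calc ‖M' t τ‖ * ‖ψ τ‖ ≤ (C * |t - τ| ^ (-(1 / 2) : ℝ)) * B := by
          gcongr; exact hBW τ hτ
      _ ≤ (C * (|τ - t₀| / 2) ^ (-(1 / 2) : ℝ)) * B := by
          have := Real.rpow_le_rpow_of_nonpos (by positivity) h1
            (show (-(1 / 2) : ℝ) ≤ 0 by norm_num)
          gcongr
      _ = _ := by ring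
  · rw [isLittleO_iff]
    intro c hc
    have hB0 : 0 ≤ |B| := abs_nonneg B
    -- The final estimate is (increment 2η) · (density |B|) · (measure 4h), which must not exceed
    -- ch.
    set η : ℝ := c / (8 * (|B| + 1)) with hη
    have hη0 : 0 < η := by positivity
    have hev := Metric.tendsto_nhds.1 hl η hη0
    rw [eventually_nhdsWithin_iff, Metric.eventually_nhds_iff] at hev
    obtain ⟨d, hd0, hd⟩ := hev
    have hlim : ∀ t τ, |t - t₀| < d → |τ - t₀| < d → t ≠ τ → ‖M t τ - l‖ < η := by
      intro t τ ht hτ hne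
      have := hd (y := (t, τ)) (by
        rw [Prod.dist_eq]; exact max_lt (by simpa [Real.dist_eq] using ht)
          (by simpa [Real.dist_eq] using hτ)) hne
      simpa [dist_eq_norm] using this
    have : Metric.ball t₀ (d / 2) ∈ 𝓝 t₀ := Metric.ball_mem_nhds _ (by positivity)
    filter_upwards [this] with t ht
    have ht : |t - t₀| < d / 2 := by simpa [Real.dist_eq] using ht
    set h := |t - t₀| with hh
    have hh0 : 0 ≤ h := abs_nonneg _
    have hnm : MeasurableSet {τ : ℝ | |τ - t₀| ≤ 2 * h} :=
      measurableSet_le (by fun_prop) measurable_const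
    rw [Measure.restrict_restrict hnm, Real.norm_of_nonneg (integral_nonneg fun τ => norm_nonneg _),
      Real.norm_eq_abs]
    have hset : {τ : ℝ | |τ - t₀| ≤ 2 * h} ⊆ Set.Icc (t₀ - 2 * h) (t₀ + 2 * h) := fun τ hτ => by
      have := abs_le.1 (show |τ - t₀| ≤ 2 * h from hτ)
      constructor <;> linarith
    have hvol : (volume ({τ : ℝ | |τ - t₀| ≤ 2 * h} ∩ W)) ≤ ENNReal.ofReal (4 * h) := by
      refine (measure_mono (Set.inter_subset_left.trans hset)).trans ?_
      rw [Real.volume_Icc]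
      exact le_of_eq (by congr 1; ring)
    have hfin : volume ({τ : ℝ | |τ - t₀| ≤ 2 * h} ∩ W) < ⊤ := hvol.trans_lt ENNReal.ofReal_lt_top
    have hbound : ∀ᵐ τ ∂volume.restrict ({τ : ℝ | |τ - t₀| ≤ 2 * h} ∩ W),
        ‖‖M t τ * ψ τ - M t₀ τ * ψ τ‖‖ ≤ 2 * η * |B| := by
      filter_upwards [ae_restrict_mem (hnm.inter measurableSet_Ioc), ae_ne _ t, ae_ne _ t₀]
        with τ hτ h1 h2
      have hτd : |τ - t₀| < d := lt_of_le_of_lt (show |τ - t₀| ≤ 2 * h from hτ.1) (by linarith)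
      have hτw : |τ - t₀| ≤ w := by
        rw [abs_le]; constructor <;> linarith [hτ.2.1, hτ.2.2]
      have e1 := hlim t τ (by linarith) hτd h1.symm
      have e2 := hlim t₀ τ (by simpa using hd0) hτd h2.symm
      rw [norm_norm, ← sub_mul, norm_mul]
      have e3 : ‖M t τ - M t₀ τ‖ ≤ 2 * η := by
        rw [show M t τ - M t₀ τ = (M t τ - l) - (M t₀ τ - l) by ring]
        refine (norm_sub_le _ _).trans ?_
        linarith
      have e4 := (hBW τ hτw).trans (le_abs_self B)
      gcongr
    have h5 := norm_setIntegral_le_of_norm_le_const_ae hfin hbound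
    rw [Real.norm_of_nonneg (integral_nonneg fun τ => norm_nonneg _)] at h5
    have h6 : (volume.real ({τ : ℝ | |τ - t₀| ≤ 2 * h} ∩ W)) ≤ 4 * h :=
      ENNReal.toReal_le_of_le_ofReal (by positivity) hvol
    refine h5.trans ?_
    calc 2 * η * |B| * volume.real ({τ : ℝ | |τ - t₀| ≤ 2 * h} ∩ W) ≤ 2 * η * |B| * (4 * h) := by
          gcongr
      _ = 8 * |B| * η * h := by ring
      _ ≤ c * h := by
          refine mul_le_mul_of_nonneg_right ?_ hh0
          rw [hη]
          have : 8 * |B| * (c / (8 * (|B| + 1))) = c * (|B| / (|B| + 1)) := by field_simp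
          rw [this]
          exact mul_le_of_le_one_right hc.le (div_le_one_of_le₀ (by linarith) (by positivity))

/-! ### Truncated integrals -/

theorem tendsto_integral_truncation {μ : Measure ℝ} {f : ℝ → ℂ} {D : ℝ → ℝ} (hf : Integrable f μ)
    (hD : Measurable D) (hD0 : ∀ᵐ τ ∂μ, 0 < D τ) :
    Tendsto (fun ε : ℝ => ∫ τ, (if ε < D τ then f τ else 0) ∂μ) (𝓝[>] 0) (𝓝 (∫ τ, f τ ∂μ)) := by
  refine tendsto_integral_filter_of_dominated_convergence (fun τ => ‖f τ‖) ?_ ?_ hf.norm ?_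
  · refine Eventually.of_forall fun ε => ?_
    exact (hf.indicator (measurableSet_lt (measurable_const (a := ε)) hD)).aestronglyMeasurable.congr
      (Eventually.of_forall fun τ => by simp [Set.indicator_apply])
  · refine Eventually.of_forall fun ε => Eventually.of_forall fun τ => ?_
    split_ifs <;> simp
  · filter_upwards [hD0] with τ hτ
    refine tendsto_const_nhds.congr' ?_
    filter_upwards [nhdsWithin_le_nhds (gt_mem_nhds hτ)] with ε hε
    rw [if_pos hε]

/-- The Cauchy principal value of `1/(t₀ - τ)` vanishes, when the truncation is by a distance `D`
that is proportional to `|τ - t₀|` up to second order. -/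
theorem tendsto_pv_inv {t₀ w a c C : ℝ} (hw : 0 < w) (ha : 0 < a) (hc : 0 < c) (hC : 0 ≤ C)
    {D : ℝ → ℝ} (hDm : Measurable D) (hDc : ∀ τ, |τ - t₀| ≤ w → c * |τ - t₀| ≤ D τ)
    (hDa : ∀ τ, |τ - t₀| ≤ w → abs (D τ - a * |τ - t₀|) ≤ C * |τ - t₀| ^ 2) :
    (∀ ε > 0, IntegrableOn (fun τ => if ε < D τ then ((t₀ - τ : ℝ) : ℂ)⁻¹ else 0)
      (Set.Ioc (t₀ - w) (t₀ + w))) ∧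
    Tendsto (fun ε : ℝ => ∫ τ in Set.Ioc (t₀ - w) (t₀ + w),
      if ε < D τ then ((t₀ - τ : ℝ) : ℂ)⁻¹ else 0) (𝓝[>] 0) (𝓝 0) := by
  set W := Set.Ioc (t₀ - w) (t₀ + w) with hW
  have hint : ∀ (D' : ℝ → ℝ) (c' : ℝ), 0 < c' → Measurable D' → (∀ τ, |τ - t₀| ≤ w →
      D' τ ≤ c' * |τ - t₀|) → ∀ ε > 0,
      IntegrableOn (fun τ => if ε < D' τ then ((t₀ - τ : ℝ) : ℂ)⁻¹ else 0) W := by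
    intro D' c' hc' hD' hle ε hε
    refine Integrable.of_bound (Measurable.aestronglyMeasurable ?_) (c' / ε) ?_
    · exact Measurable.ite (measurableSet_lt measurable_const hD') (by fun_prop) measurable_const
    · filter_upwards [ae_mem_Ioc_abs (t₀ := t₀) (w := w)] with τ hτ
      split_ifs with h
      · have h1 := h.trans_le (hle τ hτ)
        have hp : 0 < |τ - t₀| := by
          by_contra h0
          have : |τ - t₀| = 0 := le_antisymm (not_lt.1 h0) (abs_nonneg _)
          rw [this, mul_zero] at h1; linarith
        rw [norm_inv, Complex.norm_real, Real.norm_eq_abs, abs_sub_comm, inv_le_comm₀ hp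
          (by positivity), inv_div, div_le_iff₀ hc']
        linarith
      · rw [norm_zero]; positivity
  have hi1 := hint D (a + C * w) (by positivity) hDm (fun τ hτ => by
    have h1 := (abs_le.1 (hDa τ hτ)).2
    have h2 : |τ - t₀| ^ 2 ≤ w * |τ - t₀| := by
      rw [sq]; gcongr
    nlinarith)
  have hi2 := hint (fun τ => a * |τ - t₀|) a ha (by fun_prop) (fun τ _ => le_rfl)
  refine ⟨hi1, ?_⟩
  -- With the cutoff a|τ-t₀| the integrand is odd about the centre of the interval, so it remains to
  -- compare the two cutoffs.
  have hodd : ∀ ε : ℝ, ∫ τ in W, (if ε < a * |τ - t₀| then ((t₀ - τ : ℝ) : ℂ)⁻¹ else 0) = 0 := by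
    intro ε
    have e1 : ∫ τ in W, (if ε < a * |τ - t₀| then ((t₀ - τ : ℝ) : ℂ)⁻¹ else 0) =
        ∫ s in (-w)..w, (if ε < a * |s| then ((s : ℝ) : ℂ)⁻¹ else 0) := by
      rw [← intervalIntegral.integral_of_le (by linarith)]
      have := intervalIntegral.integral_comp_sub_left
        (fun s : ℝ => if ε < a * |s| then ((s : ℝ) : ℂ)⁻¹ else 0) t₀ (a := t₀ - w) (b := t₀ + w)
      simp only [abs_sub_comm t₀] at this
      rw [this]
      congr 1 <;> ring
    rw [e1]
    have e2 := intervalIntegral.integral_comp_neg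
      (fun s : ℝ => if ε < a * |s| then ((s : ℝ) : ℂ)⁻¹ else 0) (a := -w) (b := w)
    have e3 : (fun s : ℝ => if ε < a * |(-s)| then (((-s : ℝ)) : ℂ)⁻¹ else 0) =
        fun s : ℝ => -(if ε < a * |s| then ((s : ℝ) : ℂ)⁻¹ else 0) := by
      ext s; rw [abs_neg]; split_ifs <;> simp [inv_neg]
    rw [e3, intervalIntegral.integral_neg, neg_neg] at e2
    have : (2 : ℂ) * ∫ s in (-w)..w, (if ε < a * |s| then ((s : ℝ) : ℂ)⁻¹ else 0) = 0 := by
      linear_combination -e2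
    simpa using this
  -- If the cutoffs disagree, either a|τ-t₀| ≤ ε or D(τ) ≤ ε, whence |τ-t₀| is at most ε/a or ε/c.
  -- Either way C|τ-t₀|² ≤ C'ε².
  set C' : ℝ := C / a ^ 2 + C / c ^ 2 with hC'
  have hC'0 : 0 ≤ C' := by positivity
  have hkey : ∀ᶠ ε : ℝ in 𝓝[>] 0, ‖∫ τ in W, (if ε < D τ then ((t₀ - τ : ℝ) : ℂ)⁻¹ else 0)‖ ≤
      8 * C' * ε := by
    have hsmall : ∀ᶠ ε : ℝ in 𝓝[>] 0, C' * ε < 1 / 2 := by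
      have : Tendsto (fun ε : ℝ => C' * ε) (𝓝 0) (𝓝 (C' * 0)) := tendsto_id.const_mul _
      rw [mul_zero] at this
      exact nhdsWithin_le_nhds (this.eventually (gt_mem_nhds (by norm_num)))
    filter_upwards [hsmall, self_mem_nhdsWithin] with ε hε1 hε
    have hε : (0 : ℝ) < ε := hε
    -- The cutoffs can disagree only where a|τ-t₀| is within C'ε² of ε: two intervals of total
    -- length 4C'ε²/a. There the integrand is at most 2a/ε, as C'ε < 1/2 keeps a|τ-t₀| ≥ ε/2, and
    -- the product is 8C'ε.
    set Bd : Set ℝ := Set.Icc (t₀ + (ε - C' * ε ^ 2) / a) (t₀ + (ε + C' * ε ^ 2) / a) ∪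
      Set.Icc (t₀ - (ε + C' * ε ^ 2) / a) (t₀ - (ε - C' * ε ^ 2) / a) with hBd
    have hBm : MeasurableSet Bd := measurableSet_Icc.union measurableSet_Icc
    have hvol : volume Bd ≤ ENNReal.ofReal (4 * C' * ε ^ 2 / a) := by
      refine (measure_union_le _ _).trans ?_
      rw [Real.volume_Icc, Real.volume_Icc, ← ENNReal.ofReal_add]
      · exact le_of_eq (by congr 1; field_simp; ring)
      all_goals
        ring_nf
        positivity
    have hmem : ∀ τ, abs (a * |τ - t₀| - ε) ≤ C' * ε ^ 2 → τ ∈ Bd := by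
      intro τ h
      have h1 := abs_le.1 h
      have u1 : (ε - C' * ε ^ 2) / a ≤ |τ - t₀| := by rw [div_le_iff₀ ha]; linarith
      have u2 : |τ - t₀| ≤ (ε + C' * ε ^ 2) / a := by rw [le_div_iff₀ ha]; linarith
      rcases abs_cases (τ - t₀) with ⟨h2, h3⟩ | ⟨h2, h3⟩
      · left; rw [h2] at u1 u2; constructor <;> linarith
      · right; rw [h2] at u1 u2; constructor <;> linarith
    have hdiff : ∀ τ, |τ - t₀| ≤ w →
        ‖(if ε < D τ then ((t₀ - τ : ℝ) : ℂ)⁻¹ else 0) -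
          (if ε < a * |τ - t₀| then ((t₀ - τ : ℝ) : ℂ)⁻¹ else 0)‖ ≤
        Bd.indicator (fun _ => 2 * a / ε) τ := by
      intro τ hτ
      have hDτ := abs_le.1 (hDa τ hτ)
      have hnn : 0 ≤ Bd.indicator (fun _ => 2 * a / ε) τ :=
        Set.indicator_nonneg (fun _ _ => by positivity) _
      have hs0 := abs_nonneg (τ - t₀)
      have hinv : ε / 2 ≤ a * |τ - t₀| → ‖((t₀ - τ : ℝ) : ℂ)⁻¹‖ ≤ 2 * a / ε := by
        intro h
        have hp : 0 < |τ - t₀| := by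
          by_contra h0
          have : |τ - t₀| = 0 := le_antisymm (not_lt.1 h0) (abs_nonneg _)
          rw [this, mul_zero] at h; linarith
        rw [norm_inv, Complex.norm_real, Real.norm_eq_abs, abs_sub_comm, inv_le_comm₀ hp
          (by positivity), inv_div, div_le_iff₀ (by positivity)]
        linarith
      by_cases h1 : ε < D τ <;> by_cases h2 : ε < a * |τ - t₀|
      · rw [if_pos h1, if_pos h2, sub_self, norm_zero]; exact hnn
      · rw [if_pos h1, if_neg h2, sub_zero]
        have h3 : |τ - t₀| ≤ ε / a := by rw [le_div_iff₀ ha]; linarith [not_lt.1 h2]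
        have h4 : C * |τ - t₀| ^ 2 ≤ C' * ε ^ 2 := by
          calc C * |τ - t₀| ^ 2 ≤ C * (ε / a) ^ 2 := by gcongr
            _ = C / a ^ 2 * ε ^ 2 := by ring
            _ ≤ C' * ε ^ 2 := by
              refine mul_le_mul_of_nonneg_right ?_ (by positivity)
              rw [hC']; linarith [show 0 ≤ C / c ^ 2 by positivity]
        have h5 : C' * ε ^ 2 ≤ ε / 2 := by nlinarith
        have h6 := not_lt.1 h2
        rw [Set.indicator_of_mem (hmem τ (abs_le.2 ⟨by linarith, by linarith⟩))]
        exact hinv (by linarith)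
      · rw [if_neg h1, if_pos h2, zero_sub, norm_neg]
        have h3 : |τ - t₀| ≤ ε / c := by
          rw [le_div_iff₀ hc]; linarith [not_lt.1 h1, hDc τ hτ]
        have h4 : C * |τ - t₀| ^ 2 ≤ C' * ε ^ 2 := by
          calc C * |τ - t₀| ^ 2 ≤ C * (ε / c) ^ 2 := by gcongr
            _ = C / c ^ 2 * ε ^ 2 := by ring
            _ ≤ C' * ε ^ 2 := by
              refine mul_le_mul_of_nonneg_right ?_ (by positivity)
              rw [hC']; linarith [show 0 ≤ C / a ^ 2 by positivity]
        have h6 := not_lt.1 h1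
        have h7 : 0 ≤ C' * ε ^ 2 := by positivity
        rw [Set.indicator_of_mem (hmem τ (abs_le.2 ⟨by linarith, by linarith⟩))]
        exact hinv (by linarith)
      · rw [if_neg h1, if_neg h2, sub_self, norm_zero]; exact hnn
    have hi1ε : IntegrableOn (fun τ => if ε < D τ then ((t₀ - τ : ℝ) : ℂ)⁻¹ else 0) W := hi1 ε hε
    have e0 := integral_sub hi1ε (hi2 ε hε)
    rw [hodd ε, sub_zero] at e0
    rw [← e0]
    have hfin : volume Bd < ⊤ := hvol.trans_lt ENNReal.ofReal_lt_top
    have hindi : IntegrableOn (Bd.indicator (fun _ => 2 * a / ε)) W :=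
      ((integrable_indicator_iff hBm).2 (integrableOn_const hfin.ne)).integrableOn
    refine (norm_integral_le_integral_norm _).trans ((integral_mono_of_nonneg
      (Eventually.of_forall fun τ => norm_nonneg _) hindi ?_).trans ?_)
    · filter_upwards [ae_mem_Ioc_abs (t₀ := t₀) (w := w)] with τ hτ using hdiff τ hτ
    · have h1 : ∫ τ in W, Bd.indicator (fun _ => 2 * a / ε) τ ≤
          ∫ τ, Bd.indicator (fun _ => 2 * a / ε) τ :=
        setIntegral_le_integral ((integrable_indicator_iff hBm).2 (integrableOn_const hfin.ne))
          (Eventually.of_forall fun τ => Set.indicator_nonneg (fun _ _ => by positivity) _)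
      refine h1.trans ?_
      rw [integral_indicator hBm, setIntegral_const, smul_eq_mul]
      have h2 : volume.real Bd ≤ 4 * C' * ε ^ 2 / a :=
        ENNReal.toReal_le_of_le_ofReal (by positivity) hvol
      calc volume.real Bd * (2 * a / ε) ≤ 4 * C' * ε ^ 2 / a * (2 * a / ε) := by gcongr
        _ = 8 * C' * ε := by field_simp; ring
  refine squeeze_zero_norm' hkey ?_
  have : Tendsto (fun ε : ℝ => 8 * C' * ε) (𝓝 0) (𝓝 (8 * C' * 0)) := tendsto_id.const_mul _
  rw [mul_zero] at this
  exact this.mono_left nhdsWithin_le_nhds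

end

section

/-! ### Logarithmic kernels -/

/-- The potential of a kernel with a logarithmic diagonal singularity and a Hölder continuous
density is differentiable, and its derivative is a Cauchy principal value. -/
theorem hasDerivAt_integral_logKernel {t₀ w a c C Cψ r : ℝ} (hw : 0 < w) (ha : 0 < a) (hc : 0 < c)
    (hC : 0 ≤ C) (hr : 0 < r) {κ κ' : ℝ → ℝ → ℂ} {A : ℂ} {ψ : ℝ → ℂ} {D : ℝ → ℝ}
    (hM : MildlySingular t₀ w fun t τ => κ t τ - A * (Real.log (t - τ) : ℂ))
    (hκ' : ∀ t τ, |t - t₀| < 1 → |τ - t₀| ≤ w → t ≠ τ → HasDerivAt (fun s => κ s τ) (κ' t τ) t)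
    (hκm : ∀ t, |t - t₀| < 1 →
      AEStronglyMeasurable (κ t) (volume.restrict (Set.Ioc (t₀ - w) (t₀ + w))))
    (hκm' : AEStronglyMeasurable (κ' t₀) (volume.restrict (Set.Ioc (t₀ - w) (t₀ + w))))
    (hψ : Continuous ψ) (hH : ∀ τ, |τ - t₀| ≤ w → ‖ψ τ - ψ t₀‖ ≤ Cψ * |τ - t₀| ^ r)
    (hDm : Measurable D) (hDc : ∀ τ, |τ - t₀| ≤ w → c * |τ - t₀| ≤ D τ)
    (hDa : ∀ τ, |τ - t₀| ≤ w → abs (D τ - a * |τ - t₀|) ≤ C * |τ - t₀| ^ 2) :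
    ∃ v : ℂ, HasDerivAt (fun t => ∫ τ in Set.Ioc (t₀ - w) (t₀ + w), κ t τ * ψ τ) v t₀ ∧
      Tendsto (fun ε : ℝ => ∫ τ in Set.Ioc (t₀ - w) (t₀ + w),
        if ε < D τ then κ' t₀ τ * ψ τ else 0) (𝓝[>] 0) (𝓝 v) := by
  set W := Set.Ioc (t₀ - w) (t₀ + w) with hW
  have hlogm : ∀ t, Measurable fun τ : ℝ => (Real.log (t - τ) : ℂ) := fun t => by fun_prop
  obtain ⟨hMi, hMi', hMd⟩ := hM.hasDerivAt_integral (ψ := ψ)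
    (M' := fun t τ => κ' t τ - A * ((t - τ : ℝ) : ℂ)⁻¹)
    (fun t τ ht hτ hne => by
      have h1 : HasDerivAt (fun s => Real.log (s - τ)) (t - τ)⁻¹ t := by
        simpa using ((hasDerivAt_id t).sub_const τ).log (sub_ne_zero.2 hne)
      have h2 := h1.ofReal_comp.const_mul A
      simpa using (hκ' t τ ht hτ hne).fun_sub h2)
    (fun t ht => (hκm t ht).sub ((hlogm t).const_mul A).aestronglyMeasurable)
    (hκm'.sub (Measurable.aestronglyMeasurable (by fun_prop))) hψ
  obtain ⟨hLi, hLd⟩ := hasDerivAt_integral_log_mul hw hr hψ hH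
  obtain ⟨hPi, hPt⟩ := tendsto_pv_inv hw ha hc hC hDm hDc hDa
  have hlogi : ∀ t, IntegrableOn (fun τ => (Real.log (t - τ) : ℂ) * ψ τ) W := by
    intro t
    obtain ⟨B, hB⟩ := (isCompact_Icc (a := t₀ - w) (b := t₀ + w)).exists_bound_of_continuousOn
      hψ.continuousOn
    refine Integrable.mul_bdd (c := B)
      (show IntegrableOn (fun τ => (Real.log (t - τ) : ℂ)) W volume from
        (integrableOn_log_sub t (t₀ - w) (t₀ + w)).ofReal)
      hψ.aestronglyMeasurable ?_
    exact (ae_restrict_iff' measurableSet_Ioc).2 (Eventually.of_forall fun τ hτ =>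
      hB τ ⟨hτ.1.le, hτ.2⟩)
  refine ⟨_, (hMd.fun_add (hLd.const_mul A)).congr_of_eventuallyEq ?_, ?_⟩
  · have : Metric.ball t₀ 1 ∈ 𝓝 t₀ := Metric.ball_mem_nhds _ one_pos
    filter_upwards [this] with t ht
    have ht : |t - t₀| < 1 := by simpa [Real.dist_eq] using ht
    rw [← integral_const_mul, ← integral_add (hMi t ht) ((hlogi t).const_mul A)]
    congr 1; ext τ; ring
  -- κ'ψ is the sum of (κ' - A/(t₀-τ))ψ, A(ψ-ψ(t₀))/(t₀-τ) and Aψ(t₀)/(t₀-τ). The first two are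
  -- integrable, and the principal value of the third is 0.
  · have hI : IntegrableOn (fun τ => (κ' t₀ τ - A * ((t₀ - τ : ℝ) : ℂ)⁻¹) * ψ τ +
        A * ((ψ τ - ψ t₀) / ((t₀ - τ : ℝ) : ℂ))) W := hMi'.add (hLi.const_mul A)
    have hD0 : ∀ᵐ τ ∂volume.restrict W, 0 < D τ := by
      filter_upwards [ae_mem_Ioc_abs (t₀ := t₀) (w := w), ae_ne _ t₀] with τ hτ hne
      have hp : 0 < |τ - t₀| := by simpa [sub_eq_zero] using hne
      exact lt_of_lt_of_le (by positivity) (hDc τ hτ)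
    have h1 := (tendsto_integral_truncation hI hDm hD0).add (hPt.const_mul (A * ψ t₀))
    rw [integral_add hMi' (hLi.const_mul A), integral_const_mul, mul_zero, add_zero] at h1
    refine h1.congr' ?_
    filter_upwards [self_mem_nhdsWithin] with ε hε
    rw [← integral_const_mul, ← integral_add]
    · congr 1; ext τ
      split_ifs <;> ring
    · exact (hI.indicator (measurableSet_lt (measurable_const (a := ε)) hDm)).congr
        (Eventually.of_forall fun τ => by simp [Set.indicator_apply])
    · exact (hPi ε hε).const_mul _

/-! ### Closure properties -/

section MildlySingular

variable {E : Type*} [NormedAddCommGroup E] [NormedSpace ℝ E] {t₀ w : ℝ}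

/-- Agreement off the diagonal suffices: t ≠ τ is an open condition on t, and the limit ignores the
diagonal. -/
theorem MildlySingular.congr {m m' : ℝ → ℝ → E} (hw : 0 < w) (h : MildlySingular t₀ w m)
    (he : ∀ t τ, |t - t₀| < 1 → |τ - t₀| ≤ w → t ≠ τ → m' t τ = m t τ) :
    MildlySingular t₀ w m' := by
  obtain ⟨⟨C, hC⟩, l, hl⟩ := h
  refine ⟨⟨C, fun t τ ht hτ hne => ?_⟩, l, hl.congr' ?_⟩
  · have hev : (fun s => m' s τ) =ᶠ[𝓝 t] fun s => m s τ := by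
      have o1 : IsOpen {s : ℝ | |s - t₀| < 1} := isOpen_lt (by fun_prop) continuous_const
      filter_upwards [o1.mem_nhds ht, isOpen_ne.mem_nhds hne] with s hs hsne using he s τ hs hτ hsne
    rw [hev.deriv_eq, he t τ ht hτ hne]
    exact ⟨hev.differentiableAt_iff.2 (hC t τ ht hτ hne).1, (hC t τ ht hτ hne).2⟩
  · have o1 : IsOpen {a : ℝ × ℝ | |a.1 - t₀| < 1 ∧ |a.2 - t₀| < w} :=
      (isOpen_lt (f := fun a : ℝ × ℝ => |a.1 - t₀|) (by fun_prop) continuous_const).inter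
        (isOpen_lt (f := fun a : ℝ × ℝ => |a.2 - t₀|) (by fun_prop) continuous_const)
    filter_upwards [self_mem_nhdsWithin, nhdsWithin_le_nhds (o1.mem_nhds (x := (t₀, t₀))
      (by simp [hw]))] with a ha hb
    exact (he a.1 a.2 hb.1 hb.2.le ha).symm

theorem MildlySingular.add {m m' : ℝ → ℝ → E} (h : MildlySingular t₀ w m)
    (h' : MildlySingular t₀ w m') : MildlySingular t₀ w fun t τ => m t τ + m' t τ := by
  obtain ⟨⟨C, hC⟩, l, hl⟩ := h
  obtain ⟨⟨C', hC'⟩, l', hl'⟩ := h'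
  refine ⟨⟨C + C', fun t τ ht hτ hne => ?_⟩, l + l', hl.add hl'⟩
  obtain ⟨a1, a2, a3⟩ := hC t τ ht hτ hne
  obtain ⟨b1, b2, b3⟩ := hC' t τ ht hτ hne
  refine ⟨a1.fun_add b1, (norm_add_le _ _).trans (add_le_add a2 b2), ?_⟩
  rw [deriv_fun_add a1 b1, add_mul]
  exact (norm_add_le _ _).trans (add_le_add a3 b3)

theorem MildlySingular.mul {E : Type*} [NormedRing E] [NormedAlgebra ℝ E] {m m' : ℝ → ℝ → E}
    (h : MildlySingular t₀ w m) (h' : MildlySingular t₀ w m') :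
    MildlySingular t₀ w fun t τ => m t τ * m' t τ := by
  obtain ⟨⟨C, hC⟩, l, hl⟩ := h
  obtain ⟨⟨C', hC'⟩, l', hl'⟩ := h'
  refine ⟨⟨2 * (C * C'), fun t τ ht hτ hne => ?_⟩, l * l', hl.mul hl'⟩
  obtain ⟨a1, a2, a3⟩ := hC t τ ht hτ hne
  obtain ⟨b1, b2, b3⟩ := hC' t τ ht hτ hne
  have hC0 := (norm_nonneg _).trans a2
  have hC0' := (norm_nonneg _).trans b2
  refine ⟨a1.fun_mul b1, ?_, ?_⟩
  · have := (norm_mul_le (m t τ) (m' t τ)).trans (mul_le_mul a2 b2 (norm_nonneg _) hC0)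
    nlinarith [mul_nonneg hC0 hC0']
  · rw [deriv_fun_mul a1 b1]
    calc _ ≤ ‖deriv (fun s => m s τ) t‖ * ‖m' t τ‖ + ‖m t τ‖ * ‖deriv (fun s => m' s τ) t‖ :=
          (norm_add_le _ _).trans (add_le_add (norm_mul_le _ _) (norm_mul_le _ _))
      _ ≤ C * |t - τ| ^ (-(1 / 2) : ℝ) * C' + C * (C' * |t - τ| ^ (-(1 / 2) : ℝ)) := by gcongr
      _ = 2 * (C * C') * |t - τ| ^ (-(1 / 2) : ℝ) := by ring

/-- Since |t-τ| ≤ 1 + w, a bounded derivative also satisfies a bound by |t-τ|^{-1/2}. -/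
theorem one_le_mul_rpow (hw : 0 < w) {t τ : ℝ} (ht : |t - t₀| < 1) (hτ : |τ - t₀| ≤ w)
    (hne : t ≠ τ) : 1 ≤ (1 + w) * |t - τ| ^ (-(1 / 2) : ℝ) := by
  have hp : 0 < |t - τ| := by simpa [sub_eq_zero] using hne
  have h1 : |t - τ| ≤ 1 + w := by
    have := abs_sub_le t t₀ τ
    rw [abs_sub_comm t₀ τ] at this
    linarith
  have h2 : (1 + w) ^ (-(1 / 2) : ℝ) ≤ |t - τ| ^ (-(1 / 2) : ℝ) :=
    Real.rpow_le_rpow_of_nonpos hp h1 (by norm_num)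
  have h3 : (1 + w) ^ (-1 : ℝ) ≤ (1 + w) ^ (-(1 / 2) : ℝ) :=
    Real.rpow_le_rpow_of_exponent_le (by linarith) (by norm_num)
  rw [Real.rpow_neg_one] at h3
  calc (1 : ℝ) = (1 + w) * (1 + w)⁻¹ := (mul_inv_cancel₀ (by positivity)).symm
    _ ≤ _ := by gcongr; exact h3.trans h2

theorem mildlySingular_of_contDiff (hw : 0 < w) {m : ℝ → ℝ → E}
    (h : ContDiff ℝ 1 fun a : ℝ × ℝ => m a.1 a.2) : MildlySingular t₀ w m := by
  set f : ℝ × ℝ → E := fun a => m a.1 a.2 with hf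
  have hK : IsCompact (Set.Icc (t₀ - 1) (t₀ + 1) ×ˢ Set.Icc (t₀ - w) (t₀ + w)) :=
    isCompact_Icc.prod isCompact_Icc
  obtain ⟨C, hC⟩ := hK.exists_bound_of_continuousOn h.continuous.continuousOn
  have hdc : Continuous fun a : ℝ × ℝ => fderiv ℝ f a (1, 0) :=
    (h.continuous_fderiv one_ne_zero).clm_apply continuous_const
  obtain ⟨C', hC'⟩ := hK.exists_bound_of_continuousOn hdc.continuousOn
  refine ⟨⟨max C (C' * (1 + w)), fun t τ ht hτ hne => ?_⟩, f (t₀, t₀),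
    (h.continuous.tendsto (t₀, t₀)).mono_left nhdsWithin_le_nhds⟩
  have h1 := abs_lt.1 ht
  have h2 := abs_le.1 hτ
  have hmem : (t, τ) ∈ Set.Icc (t₀ - 1) (t₀ + 1) ×ˢ Set.Icc (t₀ - w) (t₀ + w) :=
    ⟨⟨by linarith, by linarith⟩, ⟨by linarith, by linarith⟩⟩
  have hd : HasDerivAt (fun s => m s τ) (fderiv ℝ f (t, τ) (1, 0)) t := by
    have hfd : HasFDerivAt f (fderiv ℝ f (t, τ)) (t, τ) :=
      ((h.differentiable one_ne_zero) _).hasFDerivAt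
    exact hfd.comp_hasDerivAt t ((hasDerivAt_id t).prodMk (hasDerivAt_const t τ))
  refine ⟨hd.differentiableAt, (hC _ hmem).trans (le_max_left _ _), ?_⟩
  rw [hd.deriv]
  have h3 := hC' _ hmem
  have h4 : 0 ≤ C' := (norm_nonneg _).trans h3
  have h5 := one_le_mul_rpow hw ht hτ hne
  calc ‖fderiv ℝ f (t, τ) (1, 0)‖ ≤ C' * 1 := by simpa using h3
    _ ≤ C' * ((1 + w) * |t - τ| ^ (-(1 / 2) : ℝ)) := by gcongr
    _ = C' * (1 + w) * |t - τ| ^ (-(1 / 2) : ℝ) := by ring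
    _ ≤ _ := by gcongr; exact le_max_right _ _

theorem mildlySingular_const (hw : 0 < w) (e : E) : MildlySingular t₀ w fun _ _ => e :=
  mildlySingular_of_contDiff hw contDiff_const

theorem MildlySingular.const_mul {m : ℝ → ℝ → ℂ} (hw : 0 < w) (e : ℂ)
    (h : MildlySingular t₀ w m) : MildlySingular t₀ w fun t τ => e * m t τ :=
  (mildlySingular_const hw e).mul h

/-- The values of m stay in a compact interval [c, C] of (0, ∞), where φ and φ' are bounded. The
limit of m is at least c because the off-diagonal filter is nontrivial. -/
theorem MildlySingular.comp {m : ℝ → ℝ → ℝ} {c : ℝ} (hw : 0 < w) (hc : 0 < c)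
    (h : MildlySingular t₀ w m)
    (hm : ∀ t τ, |t - t₀| < 1 → |τ - t₀| ≤ w → t ≠ τ → c ≤ m t τ) {φ : ℝ → E}
    (hφ : ContDiffOn ℝ 1 φ (Set.Ioi 0)) : MildlySingular t₀ w fun t τ => φ (m t τ) := by
  obtain ⟨⟨C, hC⟩, l, hl⟩ := h
  have hsub : Set.Icc c C ⊆ Set.Ioi 0 := fun s hs => hc.trans_le hs.1
  obtain ⟨B, hB⟩ := (isCompact_Icc (a := c) (b := C)).exists_bound_of_continuousOn
    (hφ.continuousOn.mono hsub)
  obtain ⟨B', hB'⟩ := (isCompact_Icc (a := c) (b := C)).exists_bound_of_continuousOn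
    ((hφ.continuousOn_deriv_of_isOpen isOpen_Ioi le_rfl).mono hsub)
  have hlc : c ≤ l := by
    have o1 : IsOpen {a : ℝ × ℝ | |a.1 - t₀| < 1 ∧ |a.2 - t₀| < w} :=
      (isOpen_lt (f := fun a : ℝ × ℝ => |a.1 - t₀|) (by fun_prop) continuous_const).inter
        (isOpen_lt (f := fun a : ℝ × ℝ => |a.2 - t₀|) (by fun_prop) continuous_const)
    have : (𝓝[{a : ℝ × ℝ | a.1 ≠ a.2}] (t₀, t₀)).NeBot := by
      rw [← mem_closure_iff_nhdsWithin_neBot, Metric.mem_closure_iff]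
      intro ε hε
      refine ⟨(t₀ + ε / 2, t₀), by simp [hε.ne'], ?_⟩
      rw [Prod.dist_eq]
      simp [abs_of_pos hε, hε]
    refine ge_of_tendsto hl ?_
    filter_upwards [self_mem_nhdsWithin, nhdsWithin_le_nhds (o1.mem_nhds (x := (t₀, t₀))
      (by simp [hw]))] with a ha hb
    exact hm a.1 a.2 hb.1 hb.2.le ha
  have hl0 : 0 < l := hc.trans_le hlc
  refine ⟨⟨max B (B' * C), fun t τ ht hτ hne => ?_⟩, φ l,
    ((hφ.continuousOn.continuousAt (Ioi_mem_nhds hl0)).tendsto).comp hl⟩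
  obtain ⟨a1, a2, a3⟩ := hC t τ ht hτ hne
  have hmem : m t τ ∈ Set.Icc c C := ⟨hm t τ ht hτ hne, (le_abs_self _).trans a2⟩
  have hφd : HasDerivAt φ (deriv φ (m t τ)) (m t τ) :=
    ((hφ.differentiableOn one_ne_zero).differentiableAt (Ioi_mem_nhds (hsub hmem))).hasDerivAt
  have hd : HasDerivAt (fun s => φ (m s τ)) (deriv (fun s => m s τ) t • deriv φ (m t τ)) t :=
    hφd.scomp t a1.hasDerivAt
  refine ⟨hd.differentiableAt, (hB _ hmem).trans (le_max_left _ _), ?_⟩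
  rw [hd.deriv, norm_smul]
  have h1 := hB' _ hmem
  have h2 := (norm_nonneg _).trans h1
  have h3 := (norm_nonneg _).trans a2
  calc ‖deriv (fun s => m s τ) t‖ * ‖deriv φ (m t τ)‖ ≤ (C * |t - τ| ^ (-(1 / 2) : ℝ)) * B' := by
        gcongr
    _ = B' * C * |t - τ| ^ (-(1 / 2) : ℝ) := by ring
    _ ≤ _ := by gcongr; exact le_max_right _ _

theorem MildlySingular.ofReal {m : ℝ → ℝ → ℝ} (h : MildlySingular t₀ w m) :
    MildlySingular t₀ w fun t τ => (m t τ : ℂ) := by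
  obtain ⟨⟨C, hC⟩, l, hl⟩ := h
  refine ⟨⟨C, fun t τ ht hτ hne => ?_⟩, (l : ℂ), (Complex.continuous_ofReal.tendsto l).comp hl⟩
  obtain ⟨a1, a2, a3⟩ := hC t τ ht hτ hne
  have hd : HasDerivAt (fun s => (m s τ : ℂ)) ((deriv (fun s => m s τ) t : ℝ) : ℂ) t :=
    a1.hasDerivAt.ofReal_comp
  refine ⟨hd.differentiableAt, by simpa using a2, ?_⟩
  rw [hd.deriv, Complex.norm_real]
  exact a3

/-- Below 1 use s^{1/2}|log s| < 2, above 1 use log s ≤ s - 1. -/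
theorem abs_log_le_rpow {s : ℝ} (hs : 0 < s) : |Real.log s| ≤ 2 * s ^ (-(1 / 2) : ℝ) + s := by
  rcases le_total s 1 with h | h
  · have h1 := (Real.abs_log_mul_self_rpow_lt s (1 / 2) hs h (by norm_num)).le
    rw [abs_mul, abs_of_pos (Real.rpow_pos_of_pos hs _)] at h1
    have h2 : |Real.log s| ≤ 2 * s ^ (-(1 / 2) : ℝ) := by
      rw [Real.rpow_neg hs.le, ← div_eq_mul_inv, le_div_iff₀ (Real.rpow_pos_of_pos hs _)]
      simpa using h1
    linarith
  · rw [abs_of_nonneg (Real.log_nonneg h)]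
    have := Real.log_le_sub_one_of_pos hs
    have := Real.rpow_pos_of_pos hs (-(1 / 2))
    linarith

/-- The function extends continuously by 0, but its derivative log(t-τ) + 1 is unbounded. This is
why mild singularity allows |t-τ|^{-1/2} in the derivative. -/
theorem mildlySingular_mul_log (hw : 0 < w) :
    MildlySingular t₀ w fun t τ => (t - τ) * Real.log (t - τ) := by
  have hcont : Continuous fun a : ℝ × ℝ => (a.1 - a.2) * Real.log (a.1 - a.2) :=
    Real.continuous_mul_log.comp (by fun_prop : Continuous fun a : ℝ × ℝ => a.1 - a.2)
  have hK : IsCompact (Set.Icc (t₀ - 1) (t₀ + 1) ×ˢ Set.Icc (t₀ - w) (t₀ + w)) :=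
    isCompact_Icc.prod isCompact_Icc
  obtain ⟨C, hC⟩ := hK.exists_bound_of_continuousOn hcont.continuousOn
  refine ⟨⟨max C (2 + (1 + w) * (2 + w)), fun t τ ht hτ hne => ?_⟩, _,
    (hcont.tendsto (t₀, t₀)).mono_left nhdsWithin_le_nhds⟩
  have h1 := abs_lt.1 ht
  have h2 := abs_le.1 hτ
  have hmem : (t, τ) ∈ Set.Icc (t₀ - 1) (t₀ + 1) ×ˢ Set.Icc (t₀ - w) (t₀ + w) :=
    ⟨⟨by linarith, by linarith⟩, ⟨by linarith, by linarith⟩⟩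
  have hd : HasDerivAt (fun s => (s - τ) * Real.log (s - τ)) (Real.log (t - τ) + 1) t := by
    simpa [Function.comp_def] using (Real.hasDerivAt_mul_log (sub_ne_zero.2 hne)).comp t
      ((hasDerivAt_id t).sub_const τ)
  refine ⟨hd.differentiableAt, (hC _ hmem).trans (le_max_left _ _), ?_⟩
  rw [hd.deriv]
  have hp : 0 < |t - τ| := by simpa [sub_eq_zero] using hne
  have h3 := abs_log_le_rpow hp
  rw [Real.log_abs] at h3
  have h4 : |t - τ| ≤ 1 + w := by
    have := abs_sub_le t t₀ τ
    rw [abs_sub_comm t₀ τ] at this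
    linarith
  have h5 := one_le_mul_rpow hw ht hτ hne
  have h6 := Real.rpow_pos_of_pos hp (-(1 / 2))
  calc ‖Real.log (t - τ) + 1‖ ≤ |Real.log (t - τ)| + 1 := by
        simpa using norm_add_le (Real.log (t - τ)) 1
    _ ≤ 2 * |t - τ| ^ (-(1 / 2) : ℝ) + (2 + w) * 1 := by linarith
    _ ≤ 2 * |t - τ| ^ (-(1 / 2) : ℝ) + (2 + w) * ((1 + w) * |t - τ| ^ (-(1 / 2) : ℝ)) := by gcongr
    _ = (2 + (1 + w) * (2 + w)) * |t - τ| ^ (-(1 / 2) : ℝ) := by ring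
    _ ≤ _ := by gcongr; exact le_max_right _ _

end MildlySingular

end

section

/-! ### Geometry of smooth loops -/

/-- A smooth regular simple closed curve, parametrized with period `2π`. -/
structure IsSmoothLoop (z : ℝ → Plane) : Prop where
  smooth : ContDiff ℝ ∞ z
  periodic : Function.Periodic z (2 * Real.pi)
  regular : ∀ t, deriv z t ≠ 0
  simple : ∀ s t, z s = z t → ∃ m : ℤ, t = s + m * (2 * Real.pi)

theorem SmoothBoundary.isSmoothLoop {Ω : Set Plane} (S : SmoothBoundary Ω) (j : Fin S.n) :
    IsSmoothLoop (S.z j) :=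
  ⟨S.smooth j, S.periodic j, S.regular j, fun s t h => (S.simple j j s t h).2⟩

/-- The mean velocity of the curve `z` between the parameters `τ` and `t`. -/
def meanVelocity (z : ℝ → Plane) (t τ : ℝ) : Plane :=
  ∫ s in (0 : ℝ)..1, deriv z (τ + s * (t - τ))

namespace IsSmoothLoop

variable {z : ℝ → Plane}

theorem hasDerivAt (hz : IsSmoothLoop z) (t : ℝ) : HasDerivAt z (deriv z t) t :=
  ((hz.smooth.differentiable (by simp)) t).hasDerivAt

theorem contDiff_deriv (hz : IsSmoothLoop z) : ContDiff ℝ ∞ (deriv z) :=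
  (contDiff_infty_iff_deriv.1 hz.smooth).2

theorem continuous (hz : IsSmoothLoop z) : Continuous z := hz.smooth.continuous

theorem continuous_deriv (hz : IsSmoothLoop z) : Continuous (deriv z) := hz.contDiff_deriv.continuous

theorem periodic_deriv (hz : IsSmoothLoop z) : Function.Periodic (deriv z) (2 * Real.pi) := fun t => by
  have := SmoothBoundary.deriv_add_period 1 hz.periodic t
  simpa using this

theorem periodic_deriv_deriv (hz : IsSmoothLoop z) : Function.Periodic (deriv (deriv z)) (2 * Real.pi) := fun t => by
  have := SmoothBoundary.deriv_add_period 1 hz.periodic_deriv t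
  simpa using this

theorem exists_bound_of_periodic {f : ℝ → Plane} (hf : Continuous f)
    (hp : Function.Periodic f (2 * Real.pi)) : ∃ L : ℝ, 0 ≤ L ∧ ∀ t, ‖f t‖ ≤ L := by
  obtain ⟨L, hL⟩ := (hp.isBounded_of_continuous Real.two_pi_pos.ne' hf).exists_norm_le
  exact ⟨L, (norm_nonneg _).trans (hL (f 0) ⟨0, rfl⟩), fun t => hL _ ⟨t, rfl⟩⟩

theorem exists_lipschitz (hz : IsSmoothLoop z) : ∃ L : ℝ, 0 ≤ L ∧ ∀ t τ, ‖z t - z τ‖ ≤ L * |t - τ| := by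
  obtain ⟨L, hL0, hL⟩ := exists_bound_of_periodic hz.continuous_deriv hz.periodic_deriv
  refine ⟨L, hL0, fun t τ => ?_⟩
  exact convex_univ.norm_image_sub_le_of_norm_hasDerivWithin_le
    (fun s _ => (hz.hasDerivAt s).hasDerivWithinAt) (fun s _ => hL s) trivial trivial

/-- Mean value inequality in s for z(t) - z(s) - (t-s)z'(t), whose derivative z'(t) - z'(s) is
O(|t-s|). Periodicity of z'' makes the constant uniform. -/
theorem exists_taylor (hz : IsSmoothLoop z) : ∃ L : ℝ, 0 ≤ L ∧
    ∀ t τ, ‖z t - z τ - (t - τ) • deriv z t‖ ≤ L * |t - τ| ^ 2 := by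
  obtain ⟨L, hL0, hL⟩ := exists_bound_of_periodic (hz.contDiff_deriv.continuous_deriv (by simp))
    hz.periodic_deriv_deriv
  have hlip : ∀ t τ, ‖deriv z t - deriv z τ‖ ≤ L * |t - τ| := fun t τ =>
    convex_univ.norm_image_sub_le_of_norm_hasDerivWithin_le
      (fun s _ => (((hz.contDiff_deriv.differentiable (by simp)) s).hasDerivAt).hasDerivWithinAt)
      (fun s _ => hL s) trivial trivial
  refine ⟨L, hL0, fun t τ => ?_⟩
  have h := (convex_uIcc t τ).norm_image_sub_le_of_norm_hasDerivWithin_le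
    (f := fun s => z t - z s - (t - s) • deriv z t) (f' := fun s => deriv z t - deriv z s)
    (C := L * |t - τ|) (x := t) (y := τ) (fun s _ => by
      have h1 := ((hz.hasDerivAt s).const_sub (z t)).fun_sub
        (((hasDerivAt_id s).const_sub t).smul_const (deriv z t))
      refine (h1.congr_deriv ?_).hasDerivWithinAt
      simp; abel) (fun s hs => (hlip t s).trans (by
        have := Set.abs_sub_left_of_mem_uIcc hs
        rw [abs_sub_comm t s, abs_sub_comm t τ]
        gcongr)) Set.left_mem_uIcc Set.right_mem_uIcc
  simp only [sub_self, zero_smul, sub_zero] at h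
  rw [Real.norm_eq_abs, abs_sub_comm τ t] at h
  calc _ ≤ _ := h
    _ = L * |t - τ| ^ 2 := by ring

theorem smul_meanVelocity (hz : IsSmoothLoop z) (t τ : ℝ) : (t - τ) • meanVelocity z t τ = z t - z τ := by
  have h := intervalIntegral.integral_eq_sub_of_hasDerivAt
    (f := fun s => z (τ + s * (t - τ))) (f' := fun s => (t - τ) • deriv z (τ + s * (t - τ)))
    (a := 0) (b := 1) (fun s _ => by
      have h1 : HasDerivAt (fun s : ℝ => τ + s * (t - τ)) (t - τ) s := by
        simpa using ((hasDerivAt_id s).mul_const (t - τ)).const_add τ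
      exact (hz.hasDerivAt _).scomp s h1) (by
      have := hz.continuous_deriv
      exact Continuous.intervalIntegrable (by fun_prop) _ _)
  rw [intervalIntegral.integral_smul] at h
  simpa [meanVelocity] using h

theorem meanVelocity_self (t : ℝ) : meanVelocity z t t = deriv z t := by
  simp [meanVelocity]

theorem continuous_meanVelocity (hz : IsSmoothLoop z) : Continuous fun a : ℝ × ℝ => meanVelocity z a.1 a.2 := by
  have := hz.continuous_deriv
  exact intervalIntegral.continuous_parametric_intervalIntegral_of_continuous' (by fun_prop) _ _

/-- The mean velocity is continuous and has no zero for |t-τ| ≤ π + 1 < 2π: on the diagonal because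
the curve is regular, elsewhere because it is simple. Compactness modulo the period gives the lower
bound. The range π + 1 covers t within 1 and τ within π of a common t₀. -/
theorem exists_chord (hz : IsSmoothLoop z) : ∃ c : ℝ, 0 < c ∧ ∀ t τ, |t - τ| ≤ Real.pi + 1 →
    c ≤ ‖meanVelocity z t τ‖ ∧ c * |t - τ| ≤ ‖z t - z τ‖ := by
  have hpi := Real.pi_gt_three
  have hpi4 := Real.pi_le_four
  have hne : ∀ t τ, |t - τ| ≤ Real.pi + 1 → meanVelocity z t τ ≠ 0 := by
    intro t τ h h0
    rcases eq_or_ne t τ with rfl | hne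
    · exact hz.regular t (by rw [← meanVelocity_self t, h0])
    · have h1 := hz.smul_meanVelocity t τ
      rw [h0, smul_zero, eq_comm, sub_eq_zero] at h1
      obtain ⟨m, hm⟩ := hz.simple t τ h1
      have hm' : t - τ = -(m * (2 * Real.pi)) := by linarith
      have hm0 : m ≠ 0 := by
        rintro rfl
        exact hne (by simpa using hm.symm)
      have : (1 : ℝ) ≤ |(m : ℝ)| := by exact_mod_cast Int.one_le_abs hm0
      rw [hm', abs_neg, abs_mul, abs_of_pos Real.two_pi_pos] at h
      nlinarith
  -- With τ ∈ [0, 2π] and |t-τ| ≤ π + 1, the bound π ≤ 4 leaves t in [-5, 13].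
  have hK : IsCompact ((Set.Icc (-5 : ℝ) 13 ×ˢ Set.Icc (0 : ℝ) (2 * Real.pi)) ∩
      {a : ℝ × ℝ | |a.1 - a.2| ≤ Real.pi + 1}) :=
    (isCompact_Icc.prod isCompact_Icc).inter_right
      (isClosed_le (f := fun a : ℝ × ℝ => |a.1 - a.2|) (by fun_prop) continuous_const)
  have hKne : ((Set.Icc (-5 : ℝ) 13 ×ˢ Set.Icc (0 : ℝ) (2 * Real.pi)) ∩
      {a : ℝ × ℝ | |a.1 - a.2| ≤ Real.pi + 1}).Nonempty :=
    ⟨(0, 0), ⟨⟨by norm_num, by norm_num⟩, le_rfl, Real.two_pi_pos.le⟩, by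
      simp; linarith⟩
  obtain ⟨a, ha, hmin⟩ := hK.exists_isMinOn hKne hz.continuous_meanVelocity.norm.continuousOn
  have hmain : ∀ t τ, |t - τ| ≤ Real.pi + 1 →
      ‖meanVelocity z a.1 a.2‖ ≤ ‖meanVelocity z t τ‖ := by
    intro t τ h
    obtain ⟨τ', hτ', hm⟩ : ∃ τ' ∈ Set.Ico (0 : ℝ) (0 + 2 * Real.pi), ∃ m : ℤ,
        τ' = τ - m * (2 * Real.pi) := by
      obtain ⟨m, hm, -⟩ := existsUnique_sub_zsmul_mem_Ico Real.two_pi_pos τ 0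
      exact ⟨_, hm, m, by simp⟩
    obtain ⟨m, hm⟩ := hm
    -- Moving both parameters by the same multiple of the period changes nothing, so τ may be taken
    -- in one period.
    have hper : meanVelocity z t τ = meanVelocity z (t - m * (2 * Real.pi)) τ' := by
      rw [meanVelocity, meanVelocity, hm]
      refine intervalIntegral.integral_congr fun s _ => ?_
      have := hz.periodic_deriv.sub_int_mul_eq m (x := τ + s * (t - τ))
      show deriv z (τ + s * (t - τ)) = _
      rw [← this]
      congr 1; ring
    rw [hper]
    have h1 : t - m * (2 * Real.pi) - τ' = t - τ := by rw [hm]; ring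
    have h2 := abs_le.1 h
    refine isMinOn_iff.1 hmin (t - m * (2 * Real.pi), τ')
      ⟨⟨⟨?_, ?_⟩, ⟨hτ'.1, by linarith [hτ'.2]⟩⟩, ?_⟩
    · have := hτ'.1; show -5 ≤ t - m * (2 * Real.pi); linarith
    · have := hτ'.2; show t - m * (2 * Real.pi) ≤ 13; linarith
    · show |t - m * (2 * Real.pi) - τ'| ≤ _
      rw [h1]; exact h
  refine ⟨‖meanVelocity z a.1 a.2‖, norm_pos_iff.2 (hne _ _ ha.2), fun t τ h =>
    ⟨hmain t τ h, ?_⟩⟩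
  rw [← hz.smul_meanVelocity, norm_smul, Real.norm_eq_abs, mul_comm]
  exact mul_le_mul_of_nonneg_left (hmain t τ h) (abs_nonneg _)

theorem norm_curveNormal (hz : IsSmoothLoop z) (t : ℝ) : ‖curveNormal z t‖ = 1 := by
  have h : 0 < ‖deriv z t‖ := norm_pos_iff.2 (hz.regular t)
  have h2 : ‖(!₂[deriv z t 1, -(deriv z t 0)] : Plane)‖ = ‖deriv z t‖ := by
    rw [EuclideanSpace.norm_eq, EuclideanSpace.norm_eq]
    simp [Fin.sum_univ_two, add_comm]
  rw [curveNormal, norm_smul, norm_inv, norm_norm, h2, inv_mul_cancel₀ h.ne']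

theorem continuous_curveNormal (hz : IsSmoothLoop z) : Continuous (curveNormal z) := by
  have h := hz.continuous_deriv
  have h1 : Continuous fun t => (!₂[deriv z t 1, -(deriv z t 0)] : Plane) := by
    fun_prop
  exact (h.norm.inv₀ fun t => (norm_pos_iff.2 (hz.regular t)).ne').smul h1

theorem normal_dotProduct_deriv (t : ℝ) :
    toC (curveNormal z t) ⬝ᵥ toC (deriv z t) = 0 := by
  simp [curveNormal, toC, dotProduct, Fin.sum_univ_two]
  ring

/-- The parametrization runs in the direction ν^⊥, so d/dt is |z'| times the tangential derivative.
-/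
theorem toC_deriv (hz : IsSmoothLoop z) (t : ℝ) :
    toC (deriv z t) = (‖deriv z t‖ : ℂ) • perp (curveNormal z t) := by
  have h : (‖deriv z t‖ : ℂ) ≠ 0 := by exact_mod_cast (norm_pos_iff.2 (hz.regular t)).ne'
  funext i
  fin_cases i <;> simp [curveNormal, toC, perp, h]

/-- The linear Taylor term (t-τ)z'(t) is orthogonal to the normal, so only the quadratic remainder
is left. -/
theorem exists_normal_bound (hz : IsSmoothLoop z) : ∃ L : ℝ, 0 ≤ L ∧ ∀ t τ,
    ‖toC (curveNormal z t) ⬝ᵥ dif (z t) (z τ)‖ ≤ L * |t - τ| ^ 2 := by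
  obtain ⟨L, hL0, hL⟩ := hz.exists_taylor
  refine ⟨2 * L, by positivity, fun t τ => ?_⟩
  have h1 : toC (curveNormal z t) ⬝ᵥ dif (z t) (z τ) =
      toC (curveNormal z t) ⬝ᵥ toC (z t - z τ - (t - τ) • deriv z t) := by
    have h0 := normal_dotProduct_deriv (z := z) t
    simp only [dotProduct, Fin.sum_univ_two, toC, dif, PiLp.sub_apply, PiLp.smul_apply,
      smul_eq_mul] at h0 ⊢
    push_cast
    linear_combination ((t : ℂ) - τ) * h0
  have hn : ∀ i, ‖toC (curveNormal z t) i‖ ≤ 1 := fun i => by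
    rw [toC, Complex.norm_real, ← hz.norm_curveNormal t]; exact PiLp.norm_apply_le _ i
  have hv : ∀ i, ‖toC (z t - z τ - (t - τ) • deriv z t) i‖ ≤ L * |t - τ| ^ 2 := fun i => by
    rw [toC, Complex.norm_real]; exact (PiLp.norm_apply_le _ i).trans (hL t τ)
  rw [h1, dotProduct, Fin.sum_univ_two]
  refine (norm_add_le _ _).trans ?_
  rw [norm_mul, norm_mul]
  have := mul_le_mul (hn 0) (hv 0) (norm_nonneg _) zero_le_one
  have := mul_le_mul (hn 1) (hv 1) (norm_nonneg _) zero_le_one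
  linarith

end IsSmoothLoop

end

section

/-! ### Building blocks of the kernels along a smooth loop -/

/-- A function of `(t, τ)` that is `A log (t - τ)` up to a mildly singular term. -/
def HasLogDiagonal (t₀ w : ℝ) (m : ℝ → ℝ → ℂ) : Prop :=
  ∃ A : ℂ, MildlySingular t₀ w fun t τ => m t τ - A * (Real.log (t - τ) : ℂ)

section

variable {t₀ w : ℝ} {m m' : ℝ → ℝ → ℂ}

theorem MildlySingular.hasLogDiagonal (h : MildlySingular t₀ w m) : HasLogDiagonal t₀ w m :=
  ⟨0, by simpa using h⟩

theorem HasLogDiagonal.add (hw : 0 < w) (h : HasLogDiagonal t₀ w m) (h' : HasLogDiagonal t₀ w m') :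
    HasLogDiagonal t₀ w fun t τ => m t τ + m' t τ := by
  obtain ⟨A, hA⟩ := h
  obtain ⟨A', hA'⟩ := h'
  exact ⟨A + A', (hA.add hA').congr hw fun t τ _ _ _ => by ring⟩

theorem HasLogDiagonal.const_mul (hw : 0 < w) (e : ℂ) (h : HasLogDiagonal t₀ w m) :
    HasLogDiagonal t₀ w fun t τ => e * m t τ := by
  obtain ⟨A, hA⟩ := h
  exact ⟨e * A, (hA.const_mul hw e).congr hw fun t τ _ _ _ => by ring⟩

theorem HasLogDiagonal.congr (hw : 0 < w) (h : HasLogDiagonal t₀ w m)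
    (he : ∀ t τ, |t - t₀| < 1 → |τ - t₀| ≤ w → t ≠ τ → m' t τ = m t τ) :
    HasLogDiagonal t₀ w m' := by
  obtain ⟨A, hA⟩ := h
  exact ⟨A, hA.congr hw fun t τ h1 h2 h3 => by rw [he t τ h1 h2 h3]⟩

end

namespace IsSmoothLoop

variable {z : ℝ → Plane}

theorem contDiff_dif (hz : IsSmoothLoop z) (i : Fin 2) :
    ContDiff ℝ 1 fun a : ℝ × ℝ => dif (z a.1) (z a.2) i := by
  have h1 : ContDiff ℝ 1 z := hz.smooth.of_le (by exact_mod_cast le_top)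
  have hL : ContDiff ℝ 1 fun v : Plane => toC v i :=
    (Complex.ofRealCLM ∘L (EuclideanSpace.proj i : Plane →L[ℝ] ℝ)).contDiff
  exact (hL.comp (h1.comp contDiff_fst)).sub (hL.comp (h1.comp contDiff_snd))

theorem contDiff_normSq (hz : IsSmoothLoop z) :
    ContDiff ℝ 1 fun a : ℝ × ℝ => ‖z a.1 - z a.2‖ ^ 2 := by
  have h1 : ContDiff ℝ 1 z := hz.smooth.of_le (by exact_mod_cast le_top)
  exact ((h1.comp contDiff_fst).sub (h1.comp contDiff_snd)).norm_sq ℝ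

variable {t₀ w : ℝ}

theorem mildlySingular_dif (hz : IsSmoothLoop z) (hw : 0 < w) (i : Fin 2) :
    MildlySingular t₀ w fun t τ => dif (z t) (z τ) i :=
  mildlySingular_of_contDiff hw (hz.contDiff_dif i)

theorem mildlySingular_ps (hz : IsSmoothLoop z) (hw : 0 < w) (c : entireCoeff) :
    MildlySingular t₀ w fun t τ => ps (‖z t - z τ‖ ^ 2) c :=
  mildlySingular_of_contDiff hw ((contDiff_ps c).comp hz.contDiff_normSq)

/-- Off the diagonal this is the difference quotient of z, whose t-derivative is minus the Taylor
remainder divided by (t-τ)², hence bounded. -/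
theorem mildlySingular_meanVelocity (hz : IsSmoothLoop z) (hw : 0 < w) (i : Fin 2) :
    MildlySingular t₀ w fun t τ => meanVelocity z t τ i := by
  obtain ⟨L₁, hL₁0, hL₁⟩ := hz.exists_lipschitz
  obtain ⟨L₂, hL₂0, hL₂⟩ := hz.exists_taylor
  have hc : Continuous fun a : ℝ × ℝ => meanVelocity z a.1 a.2 i := by
    have := hz.continuous_meanVelocity
    fun_prop
  have heq : ∀ t τ, t ≠ τ → meanVelocity z t τ i = (t - τ)⁻¹ * (z t i - z τ i) := by
    intro t τ hne
    have h := congrArg (fun v : Plane => v i) (hz.smul_meanVelocity t τ)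
    simp only [PiLp.smul_apply, PiLp.sub_apply, smul_eq_mul] at h
    rw [← h, inv_mul_cancel_left₀ (sub_ne_zero.2 hne)]
  refine ⟨⟨max L₁ (L₂ * (1 + w)), fun t τ ht hτ hne => ?_⟩, _,
    (hc.tendsto (t₀, t₀)).mono_left nhdsWithin_le_nhds⟩
  have h0 : t - τ ≠ 0 := sub_ne_zero.2 hne
  have hp : 0 < |t - τ| := abs_pos.2 h0
  have hev : (fun s => meanVelocity z s τ i) =ᶠ[𝓝 t] fun s => (s - τ)⁻¹ * (z s i - z τ i) := by
    filter_upwards [isOpen_ne.mem_nhds hne] with s hs using heq s τ hs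
  have hzi : HasDerivAt (fun s => z s i) (deriv z t i) t :=
    (EuclideanSpace.proj i : Plane →L[ℝ] ℝ).hasFDerivAt.comp_hasDerivAt t (hz.hasDerivAt t)
  have hd : HasDerivAt (fun s => meanVelocity z s τ i)
      (-((t - τ) ^ 2)⁻¹ * (z t - z τ - (t - τ) • deriv z t) i) t := by
    have h1 := (((hasDerivAt_id t).sub_const τ).fun_inv h0).fun_mul (hzi.sub_const (z τ i))
    refine (h1.congr_of_eventuallyEq hev).congr_deriv ?_
    simp only [PiLp.smul_apply, PiLp.sub_apply, smul_eq_mul, id]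
    field_simp
    ring
  refine ⟨hd.differentiableAt, ?_, ?_⟩
  · refine le_trans ?_ (le_max_left _ _)
    beta_reduce
    rw [heq t τ hne, norm_mul, norm_inv, Real.norm_eq_abs, inv_mul_le_iff₀ hp, mul_comm]
    exact (PiLp.norm_apply_le (z t - z τ) i).trans (hL₁ t τ)
  · rw [hd.deriv, norm_mul, norm_neg, norm_inv, norm_pow, Real.norm_eq_abs]
    have h2 := (PiLp.norm_apply_le (z t - z τ - (t - τ) • deriv z t) i).trans (hL₂ t τ)
    have h5 := one_le_mul_rpow hw ht hτ hne
    calc (|t - τ| ^ 2)⁻¹ * ‖(z t - z τ - (t - τ) • deriv z t) i‖ ≤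
          (|t - τ| ^ 2)⁻¹ * (L₂ * |t - τ| ^ 2) := by gcongr
      _ = L₂ * 1 := by field_simp
      _ ≤ L₂ * ((1 + w) * |t - τ| ^ (-(1 / 2) : ℝ)) := by gcongr
      _ = L₂ * (1 + w) * |t - τ| ^ (-(1 / 2) : ℝ) := by ring
      _ ≤ _ := by gcongr; exact le_max_right _ _

/-- The square of the mean velocity. -/
theorem normSq_eq (hz : IsSmoothLoop z) (t τ : ℝ) :
    ‖z t - z τ‖ ^ 2 = (t - τ) ^ 2 * ‖meanVelocity z t τ‖ ^ 2 := by
  rw [← hz.smul_meanVelocity, norm_smul, mul_pow, Real.norm_eq_abs, sq_abs]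

theorem dif_eq (hz : IsSmoothLoop z) (t τ : ℝ) (i : Fin 2) :
    dif (z t) (z τ) i = ((t - τ : ℝ) : ℂ) * (meanVelocity z t τ i : ℂ) := by
  have h := congrArg (fun v : Plane => v i) (hz.smul_meanVelocity t τ)
  simp only [PiLp.smul_apply, PiLp.sub_apply, smul_eq_mul] at h
  rw [dif, toC, toC, ← Complex.ofReal_sub, ← h, Complex.ofReal_mul]

theorem mildlySingular_comp_velocitySq (hz : IsSmoothLoop z) {φ : ℝ → ℂ}
    (hφ : ContDiffOn ℝ 1 φ (Set.Ioi 0)) :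
    MildlySingular t₀ Real.pi fun t τ => φ (‖meanVelocity z t τ‖ ^ 2) := by
  obtain ⟨c, hc0, hc⟩ := hz.exists_chord
  have hG : MildlySingular t₀ Real.pi fun t τ => ‖meanVelocity z t τ‖ ^ 2 := by
    have h0 := hz.mildlySingular_meanVelocity (t₀ := t₀) Real.pi_pos 0
    have h1 := hz.mildlySingular_meanVelocity (t₀ := t₀) Real.pi_pos 1
    refine ((h0.mul h0).add (h1.mul h1)).congr Real.pi_pos fun t τ _ _ _ => ?_
    rw [EuclideanSpace.norm_sq_eq, Fin.sum_univ_two]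
    simp [sq]
  refine hG.comp Real.pi_pos (pow_pos hc0 2) (fun t τ ht hτ _ => ?_) hφ
  refine pow_le_pow_left₀ hc0.le (hc t τ ?_).1 2
  have := abs_sub_le t t₀ τ
  rw [abs_sub_comm t₀ τ] at this
  linarith

theorem velocitySq_pos (hz : IsSmoothLoop z) {t τ : ℝ} (ht : |t - t₀| < 1)
    (hτ : |τ - t₀| ≤ Real.pi) : 0 < ‖meanVelocity z t τ‖ ^ 2 := by
  obtain ⟨c, hc0, hc⟩ := hz.exists_chord
  have := abs_sub_le t t₀ τ
  rw [abs_sub_comm t₀ τ] at this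
  have := (hc t τ (by linarith)).1
  have : 0 < ‖meanVelocity z t τ‖ := by linarith
  positivity

theorem mildlySingular_log_velocitySq (hz : IsSmoothLoop z) :
    MildlySingular t₀ Real.pi fun t τ => (Real.log (‖meanVelocity z t τ‖ ^ 2) : ℂ) :=
  hz.mildlySingular_comp_velocitySq (φ := fun s => (Real.log s : ℂ))
    (Complex.ofRealCLM.contDiff.comp_contDiffOn
      (Real.contDiffOn_log.mono fun _ hs => (ne_of_gt hs)))

/-- The chord is |t-τ| times the length of the mean velocity. As `Real.log` ignores the sign,
log(t-τ) serves on both sides of the diagonal. -/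
theorem log_normSq_eq (hz : IsSmoothLoop z) {t τ : ℝ} (ht : |t - t₀| < 1)
    (hτ : |τ - t₀| ≤ Real.pi) (hne : t ≠ τ) :
    (Real.log (‖z t - z τ‖ ^ 2) : ℂ) = 2 * (Real.log (t - τ) : ℂ) +
      (Real.log (‖meanVelocity z t τ‖ ^ 2) : ℂ) := by
  rw [hz.normSq_eq, Real.log_mul (pow_ne_zero 2 (sub_ne_zero.2 hne)) (hz.velocitySq_pos ht hτ).ne',
    Real.log_pow]
  push_cast; ring

/-- A coordinate of the chord contains the factor t-τ, which tames the logarithm to (t-τ) log(t-τ).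
-/
theorem mildlySingular_dif_mul_log (hz : IsSmoothLoop z) (i : Fin 2) :
    MildlySingular t₀ Real.pi fun t τ =>
      dif (z t) (z τ) i * (Real.log (‖z t - z τ‖ ^ 2) : ℂ) := by
  refine ((((hz.mildlySingular_meanVelocity Real.pi_pos i).ofReal.mul
    (mildlySingular_mul_log Real.pi_pos).ofReal).const_mul Real.pi_pos 2).add
    ((hz.mildlySingular_dif Real.pi_pos i).mul hz.mildlySingular_log_velocitySq)).congr
      Real.pi_pos fun t τ ht hτ hne => ?_
  rw [hz.log_normSq_eq ht hτ hne, hz.dif_eq]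
  push_cast; ring

theorem mildlySingular_dif_mul_lr (hz : IsSmoothLoop z) (i : Fin 2) (p : Profile) :
    MildlySingular t₀ Real.pi fun t τ => dif (z t) (z τ) i * lr (‖z t - z τ‖ ^ 2) p := by
  refine (((hz.mildlySingular_dif_mul_log i).mul (hz.mildlySingular_ps Real.pi_pos p.1)).add
    ((hz.mildlySingular_dif Real.pi_pos i).mul (hz.mildlySingular_ps Real.pi_pos p.2))).congr
      Real.pi_pos fun t τ _ _ _ => ?_
  rw [lr_apply]; ring

/-- The factors (t-τ)² cancel and leave v_i v_j/|v|² in the mean velocity v. In the plane this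
quotient has no limit at the diagonal; along the curve it has one. -/
theorem mildlySingular_dif_mul_dif_div (hz : IsSmoothLoop z) (i j : Fin 2) :
    MildlySingular t₀ Real.pi fun t τ =>
      dif (z t) (z τ) i * dif (z t) (z τ) j * ((‖z t - z τ‖ ^ 2 : ℝ) : ℂ)⁻¹ := by
  refine (((hz.mildlySingular_meanVelocity Real.pi_pos i).ofReal.mul
    (hz.mildlySingular_meanVelocity Real.pi_pos j).ofReal).mul
      (hz.mildlySingular_comp_velocitySq (φ := fun s => ((s⁻¹ : ℝ) : ℂ))
        (Complex.ofRealCLM.contDiff.comp_contDiffOn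
          (contDiffOn_id.inv fun _ hs => (ne_of_gt hs))))).congr
            Real.pi_pos fun t τ ht hτ hne => ?_
  have h0 : ((t - τ : ℝ) : ℂ) ≠ 0 := by exact_mod_cast sub_ne_zero.2 hne
  have h1 : ((‖meanVelocity z t τ‖ ^ 2 : ℝ) : ℂ) ≠ 0 := by
    exact_mod_cast (hz.velocitySq_pos ht hτ).ne'
  rw [hz.normSq_eq, hz.dif_eq, hz.dif_eq, Complex.ofReal_inv, Complex.ofReal_mul,
    Complex.ofReal_pow (t - τ)]
  generalize ((‖meanVelocity z t τ‖ ^ 2 : ℝ) : ℂ) = G at *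
  field_simp

/-- In a(ρ) = a(0) + ρ ã(ρ) the term ρ ã(ρ) log ρ is mild, so the logarithm enters only as a(0) log
ρ. The 2 in the coefficient stems from ρ being a squared distance. -/
theorem hasLogDiagonal_lr (hz : IsSmoothLoop z) (p : Profile) :
    HasLogDiagonal t₀ Real.pi fun t τ => lr (‖z t - z τ‖ ^ 2) p := by
  refine ⟨2 * logCoeff p, ?_⟩
  have hd : ∀ i, MildlySingular t₀ Real.pi fun t τ =>
      dif (z t) (z τ) i * (dif (z t) (z τ) i * (Real.log (‖z t - z τ‖ ^ 2) : ℂ)) := fun i =>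
    (hz.mildlySingular_dif Real.pi_pos i).mul (hz.mildlySingular_dif_mul_log i)
  refine (((hz.mildlySingular_log_velocitySq.const_mul Real.pi_pos (logCoeff p)).add
    (((hd 0).add (hd 1)).mul (hz.mildlySingular_ps Real.pi_pos (shiftCoeff p.1)))).add
      (hz.mildlySingular_ps Real.pi_pos p.2)).congr Real.pi_pos fun t τ ht hτ hne => ?_
  have h1 := hz.log_normSq_eq ht hτ hne
  have h2 : (logCoeff p : ℂ) = p.1.1 0 := rfl
  beta_reduce
  rw [lr_apply, ps_eq_add_mul_shift _ p.1, h2]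
  have h3 := normSq_sub_dif (z t) (z τ)
  linear_combination p.1.1 0 * h1 + (Real.log (‖z t - z τ‖ ^ 2) : ℂ) *
    ps (‖z t - z τ‖ ^ 2) (shiftCoeff p.1) * h3

/-- The second derivatives of a profile without leading logarithm. -/
theorem hasLogDiagonal_lrHess (hz : IsSmoothLoop z) {p : Profile} (hp : logCoeff p = 0)
    (i j : Fin 2) : HasLogDiagonal t₀ Real.pi fun t τ => lrHess p (z t) (z τ) i j := by
  refine (((hz.hasLogDiagonal_lr (derivProfile p)).const_mul Real.pi_pos
    (if i = j then 2 else 0)).add Real.pi_pos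
    ((((hz.mildlySingular_dif_mul_dif_div i j).const_mul Real.pi_pos
      (4 * logCoeff (derivProfile p))).add
      (((hz.mildlySingular_dif Real.pi_pos i).mul (hz.mildlySingular_dif_mul_lr j
        (derivProfile (derivProfile p)))).const_mul Real.pi_pos 4)).hasLogDiagonal)).congr
        Real.pi_pos fun t τ _ _ _ => ?_
  rw [lrHess, lr2_apply, lr1_apply, lr1_apply, hp]
  ring

/-- The first derivatives of a profile without leading logarithm. -/
theorem mildlySingular_lrGrad (hz : IsSmoothLoop z) {p : Profile} (hp : logCoeff p = 0)
    (i : Fin 2) : MildlySingular t₀ Real.pi fun t τ => lrGrad p (z t) (z τ) i := by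
  refine ((hz.mildlySingular_dif_mul_lr i (derivProfile p)).const_mul Real.pi_pos 2).congr
    Real.pi_pos fun t τ _ _ _ => ?_
  rw [lrGrad, lr1_apply, hp]
  ring

end IsSmoothLoop

/-! ### Kernels smooth off the diagonal -/

/-- A kernel that is continuously differentiable off the diagonal. -/
def SmoothOffDiagonal (k : Plane → Plane → ℂ) : Prop :=
  ContDiffOn ℝ 1 (fun w : Plane × Plane => k w.1 w.2) {w | w.1 ≠ w.2}

theorem isOpen_offDiagonal : IsOpen {w : Plane × Plane | w.1 ≠ w.2} :=
  isOpen_ne_fun continuous_fst continuous_snd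

section

variable {k k' : Plane → Plane → ℂ}

theorem SmoothOffDiagonal.add (h : SmoothOffDiagonal k) (h' : SmoothOffDiagonal k') :
    SmoothOffDiagonal fun x y => k x y + k' x y := ContDiffOn.add h h'

theorem SmoothOffDiagonal.mul (h : SmoothOffDiagonal k) (h' : SmoothOffDiagonal k') :
    SmoothOffDiagonal fun x y => k x y * k' x y := ContDiffOn.mul h h'

theorem smoothOffDiagonal_const (e : ℂ) : SmoothOffDiagonal fun _ _ => e := contDiffOn_const

theorem SmoothOffDiagonal.const_mul (e : ℂ) (h : SmoothOffDiagonal k) :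
    SmoothOffDiagonal fun x y => e * k x y := (smoothOffDiagonal_const e).mul h

theorem SmoothOffDiagonal.congr (h : SmoothOffDiagonal k) (he : ∀ x y, x ≠ y → k' x y = k x y) :
    SmoothOffDiagonal k' := ContDiffOn.congr h fun w hw => he w.1 w.2 hw

theorem smoothOffDiagonal_dif (i : Fin 2) : SmoothOffDiagonal fun x y => dif x y i := by
  have hL : ContDiff ℝ 1 fun v : Plane => toC v i :=
    (Complex.ofRealCLM ∘L (EuclideanSpace.proj i : Plane →L[ℝ] ℝ)).contDiff
  exact ((hL.comp contDiff_fst).sub (hL.comp contDiff_snd)).contDiffOn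

theorem smoothOffDiagonal_comp_normSq {φ : ℝ → ℂ} (hφ : ContDiffOn ℝ 1 φ (Set.Ioi 0)) :
    SmoothOffDiagonal fun x y => φ (‖x - y‖ ^ 2) :=
  hφ.comp (((contDiff_fst.sub contDiff_snd).norm_sq ℝ).contDiffOn) fun _ hw => normSq_sub_pos hw

theorem contDiffOn_lr (p : Profile) : ContDiffOn ℝ 1 (fun ρ => lr ρ p) (Set.Ioi 0) :=
  ((Complex.ofRealCLM.contDiff.comp_contDiffOn
    (Real.contDiffOn_log.mono fun _ hs => (ne_of_gt hs))).mul (contDiff_ps p.1).contDiffOn).add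
      (contDiff_ps p.2).contDiffOn

theorem contDiffOn_lr1 (p : Profile) : ContDiffOn ℝ 1 (fun ρ => lr1 ρ p) (Set.Ioi 0) := by
  refine (ContDiffOn.mul ?_ contDiffOn_const).add (contDiffOn_lr (derivProfile p))
  exact (Complex.ofRealCLM.contDiff.contDiffOn).inv fun ρ hρ => by
    simpa using (ne_of_gt hρ : ρ ≠ 0)

theorem contDiffOn_lr2 (p : Profile) : ContDiffOn ℝ 1 (fun ρ => lr2 ρ p) (Set.Ioi 0) := by
  refine (ContDiffOn.mul ?_ contDiffOn_const).add (contDiffOn_lr1 (derivProfile p))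
  exact ((Complex.ofRealCLM.contDiff.contDiffOn.pow 2).inv fun ρ hρ => by
    simpa using (ne_of_gt hρ : ρ ≠ 0)).neg

theorem smoothOffDiagonal_lr (p : Profile) : SmoothOffDiagonal fun x y => lr (‖x - y‖ ^ 2) p :=
  smoothOffDiagonal_comp_normSq (contDiffOn_lr p)

theorem smoothOffDiagonal_lrGrad (p : Profile) (i : Fin 2) :
    SmoothOffDiagonal fun x y => lrGrad p x y i :=
  ((smoothOffDiagonal_dif i).const_mul 2).mul (smoothOffDiagonal_comp_normSq (contDiffOn_lr1 p))

theorem smoothOffDiagonal_lrHess (p : Profile) (i j : Fin 2) :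
    SmoothOffDiagonal fun x y => lrHess p x y i j :=
  ((smoothOffDiagonal_comp_normSq (contDiffOn_lr1 p)).const_mul (if i = j then 2 else 0)).add
    ((((smoothOffDiagonal_dif i).mul (smoothOffDiagonal_dif j)).const_mul 4).mul
      (smoothOffDiagonal_comp_normSq (contDiffOn_lr2 p)))

/-- The gradient in x is part of the total derivative in (x, y), which is continuous off the
diagonal. This supplies measurability of the differentiated kernel in y. -/
theorem SmoothOffDiagonal.continuousOn_grad (h : SmoothOffDiagonal k)
    {g : Plane → Plane → Fin 2 → ℂ}
    (hg : ∀ x y, x ≠ y → HasGrad (fun x' => k x' y) (g x y) x) (l : Fin 2) :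
    ContinuousOn (fun w : Plane × Plane => g w.1 w.2 l) {w | w.1 ≠ w.2} := by
  have hc := (ContDiffOn.continuousOn_fderiv_of_isOpen h isOpen_offDiagonal le_rfl).clm_apply
    (continuousOn_const (c := ((EuclideanSpace.single l (1 : ℝ) : Plane), (0 : Plane))))
  refine hc.congr fun w hw => ?_
  have hd : HasFDerivAt (fun w : Plane × Plane => k w.1 w.2)
      (fderiv ℝ (fun w : Plane × Plane => k w.1 w.2) w) w :=
    ((ContDiffOn.differentiableOn h one_ne_zero).differentiableAt
      (isOpen_offDiagonal.mem_nhds hw)).hasFDerivAt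
  have h1 : HasFDerivAt (fun x' : Plane => (x', w.2))
      (ContinuousLinearMap.inl ℝ Plane Plane) w.1 := hasFDerivAt_prodMk_left _ _
  have h2 := (HasFDerivAt.comp (f := fun x' : Plane => (x', w.2)) w.1 hd h1).fderiv
  have h3 := (hg w.1 w.2 hw).pd_eq l
  rw [pd] at h3
  rw [← h3]
  exact congrArg (fun L : Plane →L[ℝ] ℂ => L (EuclideanSpace.single l (1 : ℝ))) h2

end

end

section

/-! ### Derivatives of weakly singular integrals over smooth loops -/

theorem aestronglyMeasurable_restrict_Ioc {f : ℝ → ℂ} {a b t : ℝ}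
    (hf : ContinuousOn f (Set.Ioc a b \ {t})) :
    AEStronglyMeasurable f (volume.restrict (Set.Ioc a b)) := by
  have h1 := ContinuousOn.aestronglyMeasurable (μ := volume) hf
    (measurableSet_Ioc.diff (measurableSet_singleton t))
  rwa [Measure.restrict_congr_set (sdiff_null_ae_eq_self (measure_singleton t))] at h1

section

variable {k : Plane → Plane → ℂ} {g : Plane → Plane → Fin 2 → ℂ}

theorem SmoothOffDiagonal.continuousOn_right (hk : SmoothOffDiagonal k) (x : Plane) :
    ContinuousOn (fun y => k x y) {x}ᶜ :=
  (ContDiffOn.continuousOn hk).comp (by fun_prop : Continuous fun y : Plane => (x, y)).continuousOn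
    fun _ hy => Ne.symm hy

theorem SmoothOffDiagonal.continuousOn_grad_dotProduct (hk : SmoothOffDiagonal k)
    (hg : ∀ x y, x ≠ y → HasGrad (fun x' => k x' y) (g x y) x) (x : Plane) (e : Fin 2 → ℂ) :
    ContinuousOn (fun y => g x y ⬝ᵥ e) {x}ᶜ := by
  have h : ∀ l, ContinuousOn (fun y => g x y l) {x}ᶜ := fun l =>
    (hk.continuousOn_grad hg l).comp
      (by fun_prop : Continuous fun y : Plane => (x, y)).continuousOn fun _ hy => Ne.symm hy
  simp only [dotProduct, Fin.sum_univ_two]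
  exact ((h 0).mul continuousOn_const).add ((h 1).mul continuousOn_const)

/-- The cutoff D(τ) is the chord length: the chord estimate bounds it below, and Taylor's formula
gives D(τ) = |z'(t₀)||τ-t₀| + O(|τ-t₀|²). -/
theorem IsSmoothLoop.exists_hasDerivAt_integral {z : ℝ → Plane} (hz : IsSmoothLoop z)
    (hk : SmoothOffDiagonal k) (hg : ∀ x y, x ≠ y → HasGrad (fun x' => k x' y) (g x y) x) {t₀ : ℝ}
    (hlog : HasLogDiagonal t₀ Real.pi fun t τ => k (z t) (z τ)) {ψ : ℝ → ℂ} (hψ : Continuous ψ)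
    {C r : ℝ} (hr : 0 < r) (hH : ∀ τ, |τ - t₀| ≤ Real.pi → ‖ψ τ - ψ t₀‖ ≤ C * |τ - t₀| ^ r) :
    ∃ v : ℂ, HasDerivAt (fun t => ∫ τ in Set.Ioc (t₀ - Real.pi) (t₀ + Real.pi),
        k (z t) (z τ) * ψ τ) v t₀ ∧
      Tendsto (fun ε : ℝ => ∫ τ in Set.Ioc (t₀ - Real.pi) (t₀ + Real.pi),
        if ε < ‖z t₀ - z τ‖ then (g (z t₀) (z τ) ⬝ᵥ toC (deriv z t₀)) * ψ τ else 0)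
          (𝓝[>] 0) (𝓝 v) := by
  obtain ⟨A, hA⟩ := hlog
  obtain ⟨c, hc0, hc⟩ := hz.exists_chord
  obtain ⟨L, hL0, hL⟩ := hz.exists_taylor
  have habs : ∀ t τ, |t - t₀| < 1 → |τ - t₀| ≤ Real.pi → |t - τ| ≤ Real.pi + 1 := by
    intro t τ ht hτ
    have := abs_sub_le t t₀ τ
    rw [abs_sub_comm t₀ τ] at this
    linarith
  have hne : ∀ t τ, |t - t₀| < 1 → |τ - t₀| ≤ Real.pi → t ≠ τ → z t ≠ z τ := by
    intro t τ ht hτ h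
    have h1 := (hc t τ (habs t τ ht hτ)).2
    have h2 : 0 < |t - τ| := abs_pos.2 (sub_ne_zero.2 h)
    rw [← sub_ne_zero, ← norm_pos_iff]
    exact (mul_pos hc0 h2).trans_le h1
  have hmaps : ∀ t, |t - t₀| < 1 →
      Set.MapsTo z (Set.Ioc (t₀ - Real.pi) (t₀ + Real.pi) \ {t}) {z t}ᶜ := by
    intro t ht τ hτ
    refine (hne t τ ht ?_ (Ne.symm hτ.2)).symm
    rw [abs_le]; constructor <;> linarith [hτ.1.1, hτ.1.2]
  refine hasDerivAt_integral_logKernel (a := ‖deriv z t₀‖) (c := c) (C := L)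
    (κ' := fun t τ => g (z t) (z τ) ⬝ᵥ toC (deriv z t))
    Real.pi_pos (norm_pos_iff.2 (hz.regular t₀)) hc0 hL0 hr hA ?_ ?_ ?_ hψ hH ?_ ?_ ?_
  · exact fun t τ ht hτ h => (hg _ _ (hne t τ ht hτ h)).comp_curve (hz.hasDerivAt t)
  · exact fun t ht => aestronglyMeasurable_restrict_Ioc (t := t)
      ((hk.continuousOn_right (z t)).comp hz.continuous.continuousOn (hmaps t ht))
  · exact aestronglyMeasurable_restrict_Ioc (t := t₀)
      ((hk.continuousOn_grad_dotProduct hg (z t₀) _).comp hz.continuous.continuousOn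
        (hmaps t₀ (by simp)))
  · have := hz.continuous
    exact Continuous.measurable (by fun_prop)
  · intro τ hτ
    rw [abs_sub_comm]
    refine (hc t₀ τ ?_).2
    rw [abs_sub_comm]; linarith
  · intro τ hτ
    have h1 := abs_norm_sub_norm_le (z t₀ - z τ) ((t₀ - τ) • deriv z t₀)
    rw [norm_smul, Real.norm_eq_abs, abs_sub_comm t₀ τ, mul_comm |τ - t₀|] at h1
    refine h1.trans ?_
    have := hL t₀ τ
    rwa [abs_sub_comm t₀ τ] at this

/-- Between disjoint curves the kernel is continuously differentiable, so the principal value is an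
ordinary integral. -/
theorem exists_hasDerivAt_integral_of_disjoint {z ζ : ℝ → Plane} (hz : IsSmoothLoop z)
    (hζ : IsSmoothLoop ζ) (hne : ∀ t τ, z t ≠ ζ τ)
    (hk : SmoothOffDiagonal k) (hg : ∀ x y, x ≠ y → HasGrad (fun x' => k x' y) (g x y) x) (t₀ : ℝ)
    {ψ : ℝ → ℂ} (hψ : Continuous ψ) :
    ∃ v : ℂ, HasDerivAt (fun t => ∫ τ in Set.Ioc (t₀ - Real.pi) (t₀ + Real.pi),
        k (z t) (ζ τ) * ψ τ) v t₀ ∧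
      Tendsto (fun ε : ℝ => ∫ τ in Set.Ioc (t₀ - Real.pi) (t₀ + Real.pi),
        if ε < ‖z t₀ - ζ τ‖ then (g (z t₀) (ζ τ) ⬝ᵥ toC (deriv z t₀)) * ψ τ else 0)
          (𝓝[>] 0) (𝓝 v) := by
  have hz1 : ContDiff ℝ 1 z := hz.smooth.of_le (by exact_mod_cast le_top)
  have hζ1 : ContDiff ℝ 1 ζ := hζ.smooth.of_le (by exact_mod_cast le_top)
  have hkc : ContDiff ℝ 1 fun a : ℝ × ℝ => k (z a.1) (ζ a.2) :=
    contDiffOn_univ.1 (ContDiffOn.comp (f := fun a : ℝ × ℝ => (z a.1, ζ a.2)) hk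
      (((hz1.comp contDiff_fst).prodMk (hζ1.comp contDiff_snd)).contDiffOn)
        fun a _ => hne a.1 a.2)
  have h := (mildlySingular_of_contDiff (t₀ := t₀) Real.pi_pos hkc).hasDerivAt_integral
    (M' := fun t τ => g (z t) (ζ τ) ⬝ᵥ toC (deriv z t)) (ψ := ψ)
    (fun t τ _ _ _ => (hg _ _ (hne t τ)).comp_curve (hz.hasDerivAt t))
    (fun t _ => ((hkc.continuous.comp (by fun_prop : Continuous fun τ : ℝ => (t, τ))
      :)).aestronglyMeasurable)
    (aestronglyMeasurable_restrict_Ioc (t := t₀)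
      ((hk.continuousOn_grad_dotProduct hg (z t₀) _).comp hζ.continuous.continuousOn
        fun τ _ => (hne t₀ τ).symm)) hψ
  have := hζ.continuous
  exact ⟨_, h.2.2, tendsto_integral_truncation h.2.1 (Continuous.measurable (by fun_prop))
    (Eventually.of_forall fun τ => norm_pos_iff.2 (sub_ne_zero.2 (hne t₀ τ)))⟩

end

theorem rpow_le_mul_rpow {x w r s : ℝ} (hx : 0 ≤ x) (hxw : x ≤ w) (hs : 0 < s) (hsr : s ≤ r) :
    x ^ r ≤ w ^ (r - s) * x ^ s := by
  have h : x ^ r = x ^ (r - s) * x ^ s := by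
    rw [← Real.rpow_add_of_nonneg hx (sub_nonneg.2 hsr) hs.le, sub_add_cancel]
  rw [h]
  have := Real.rpow_le_rpow hx hxw (sub_nonneg.2 hsr)
  gcongr

/-! ### Principal values over smooth boundaries -/

namespace SmoothBoundary

variable {Ω : Set Plane} (S : SmoothBoundary Ω)
variable {W : Type*} [NormedAddCommGroup W] [NormedSpace ℝ W]

theorem mem_frontier (j : Fin S.n) (t : ℝ) : S.z j t ∈ frontier Ω := by
  rw [← S.range_eq]; exact Set.mem_iUnion.2 ⟨j, t, rfl⟩

theorem exists_eq {x : Plane} (hx : x ∈ frontier Ω) : ∃ j t, S.z j t = x := by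
  rw [← S.range_eq] at hx
  obtain ⟨j, t, h⟩ := Set.mem_iUnion.1 hx
  exact ⟨j, t, h⟩

/-- The density of the arc length, multiplied by a function on the boundary, in the parameter of a
boundary curve. -/
def pullback (φ : Plane → ℂ) (j : Fin S.n) (τ : ℝ) : ℂ := (‖deriv (S.z j) τ‖ : ℂ) * φ (S.z j τ)

variable {φ : Plane → ℂ}

theorem continuous_comp (hφ : IsHolderOn (frontier Ω) φ) (j : Fin S.n) :
    Continuous fun τ => φ (S.z j τ) := by
  obtain ⟨C, r, hr, h⟩ := hφ
  exact (h.continuousOn hr).comp_continuous (S.isSmoothLoop j).continuous (S.mem_frontier j)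

theorem continuous_pullback (hφ : IsHolderOn (frontier Ω) φ) (j : Fin S.n) :
    Continuous (S.pullback φ j) :=
  (Complex.continuous_ofReal.comp (S.isSmoothLoop j).continuous_deriv.norm).mul
    (S.continuous_comp hφ j)

theorem exists_holder_pullback (hφ : IsHolderOn (frontier Ω) φ) (j : Fin S.n) (t₀ : ℝ) :
    ∃ C r : ℝ, 0 < r ∧ ∀ τ, |τ - t₀| ≤ Real.pi →
      ‖S.pullback φ j τ - S.pullback φ j t₀‖ ≤ C * |τ - t₀| ^ r := by
  obtain ⟨K, r, hr, h⟩ := hφ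
  have hz := S.isSmoothLoop j
  obtain ⟨L, hL0, hL⟩ := hz.exists_lipschitz
  obtain ⟨B, hB0, hB⟩ := IsSmoothLoop.exists_bound_of_periodic hz.continuous_deriv hz.periodic_deriv
  obtain ⟨B', hB'0, hB'⟩ := IsSmoothLoop.exists_bound_of_periodic
    (hz.contDiff_deriv.continuous_deriv (by simp)) hz.periodic_deriv_deriv
  have hlip : ∀ t τ, ‖deriv (S.z j) t - deriv (S.z j) τ‖ ≤ B' * |t - τ| := fun t τ =>
    convex_univ.norm_image_sub_le_of_norm_hasDerivWithin_le
      (fun s _ => (((hz.contDiff_deriv.differentiable (by simp)) s).hasDerivAt).hasDerivWithinAt)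
      (fun s _ => hB' s) trivial trivial
  -- The product of the Lipschitz speed and a density of exponent r has exponent min(r, 1); r may
  -- exceed 1. Powers are lowered by means of |τ-t₀| ≤ π.
  set s : ℝ := min (r : ℝ) 1 with hs
  have hs0 : 0 < s := lt_min (by exact_mod_cast hr) one_pos
  refine ⟨B * (K * (L ^ (r : ℝ) * Real.pi ^ ((r : ℝ) - s))) +
    B' * Real.pi ^ (1 - s) * ‖φ (S.z j t₀)‖, s, hs0, fun τ hτ => ?_⟩
  have h1 : ‖φ (S.z j τ) - φ (S.z j t₀)‖ ≤
      K * (L ^ (r : ℝ) * Real.pi ^ ((r : ℝ) - s)) * |τ - t₀| ^ s := by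
    have h2 := h.dist_le (S.mem_frontier j τ) (S.mem_frontier j t₀)
    rw [dist_eq_norm, dist_eq_norm] at h2
    refine h2.trans ?_
    rw [mul_assoc]
    refine mul_le_mul_of_nonneg_left ?_ K.2
    calc ‖S.z j τ - S.z j t₀‖ ^ (r : ℝ) ≤ (L * |τ - t₀|) ^ (r : ℝ) :=
          Real.rpow_le_rpow (norm_nonneg _) (hL τ t₀) r.2
      _ = L ^ (r : ℝ) * |τ - t₀| ^ (r : ℝ) := Real.mul_rpow hL0 (abs_nonneg _)
      _ ≤ L ^ (r : ℝ) * (Real.pi ^ ((r : ℝ) - s) * |τ - t₀| ^ s) := by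
          have := rpow_le_mul_rpow (abs_nonneg _) hτ hs0 (min_le_left (r : ℝ) 1)
          gcongr
      _ = _ := by ring
  have h3 : abs (‖deriv (S.z j) τ‖ - ‖deriv (S.z j) t₀‖) ≤
      B' * Real.pi ^ (1 - s) * |τ - t₀| ^ s := by
    have h4 := rpow_le_mul_rpow (abs_nonneg _) hτ hs0 (min_le_right (r : ℝ) 1)
    rw [Real.rpow_one] at h4
    rw [mul_assoc]
    exact (abs_norm_sub_norm_le _ _).trans ((hlip τ t₀).trans
      (mul_le_mul_of_nonneg_left h4 hB'0))
  have h5 : S.pullback φ j τ - S.pullback φ j t₀ =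
      (‖deriv (S.z j) τ‖ : ℂ) * (φ (S.z j τ) - φ (S.z j t₀)) +
        ((‖deriv (S.z j) τ‖ - ‖deriv (S.z j) t₀‖ : ℝ) : ℂ) * φ (S.z j t₀) := by
    simp only [pullback]; push_cast; ring
  rw [h5]
  refine (norm_add_le _ _).trans ?_
  rw [norm_mul, norm_mul, Complex.norm_real, Complex.norm_real, norm_norm, Real.norm_eq_abs, add_mul]
  refine add_le_add ?_ ?_
  · rw [mul_assoc]
    exact mul_le_mul (hB τ) h1 (norm_nonneg _) hB0
  · calc _ ≤ B' * Real.pi ^ (1 - s) * |τ - t₀| ^ s * ‖φ (S.z j t₀)‖ := by gcongr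
      _ = _ := by ring

/-- The integral over a boundary curve may be taken over any period. -/
theorem intervalIntegral_eq (f : Plane → W) (j : Fin S.n) (t₀ : ℝ) :
    ∫ τ in (0 : ℝ)..(2 * Real.pi), ‖deriv (S.z j) τ‖ • f (S.z j τ) =
      ∫ τ in Set.Ioc (t₀ - Real.pi) (t₀ + Real.pi), ‖deriv (S.z j) τ‖ • f (S.z j τ) := by
  have hp : Function.Periodic (fun τ => ‖deriv (S.z j) τ‖ • f (S.z j τ)) (2 * Real.pi) := fun τ => by
    beta_reduce
    rw [(S.isSmoothLoop j).periodic_deriv, S.periodic j]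
  have h := hp.intervalIntegral_add_eq 0 (t₀ - Real.pi)
  rw [zero_add, show t₀ - Real.pi + 2 * Real.pi = t₀ + Real.pi by ring] at h
  rw [h, intervalIntegral.integral_of_le (by linarith [Real.pi_pos])]

/-- The principal value at `x` of the boundary integral of `f` exists and equals `v`. -/
def PVTo (f : Plane → W) (x : Plane) (v : W) : Prop :=
  (∀ ε : ℝ, 0 < ε → S.Integrable fun y => open Classical in if ε < ‖x - y‖ then f y else 0) ∧
    Tendsto (S.truncIntegral f x) (𝓝[>] 0) (𝓝 v)

/-- The truncated function lives on a compact parameter set that stays away from x, where f is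
continuous. -/
theorem integrable_trunc {f : Plane → ℂ} {x : Plane}
    (hf : ContinuousOn f {y | y ∈ frontier Ω ∧ y ≠ x}) {ε : ℝ} (hε : 0 < ε) :
    S.Integrable fun y => open Classical in if ε < ‖x - y‖ then f y else 0 := by
  intro j
  have hz := S.isSmoothLoop j
  have hzc := hz.continuous
  set K := Set.Icc (0 : ℝ) (2 * Real.pi) ∩ {τ | ε ≤ ‖x - S.z j τ‖} with hK
  have hKc : IsCompact K := isCompact_Icc.inter_right
    (isClosed_le continuous_const (by fun_prop))
  have hF : ContinuousOn (fun τ => ‖deriv (S.z j) τ‖ • f (S.z j τ)) K :=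
    (hz.continuous_deriv.norm.continuousOn).smul (hf.comp hzc.continuousOn fun τ hτ =>
      ⟨S.mem_frontier j τ, fun h => by
        have := hτ.2
        simp [h] at this
        linarith⟩)
  have hI := hF.integrableOn_compact (μ := volume) hKc
  rw [intervalIntegrable_iff_integrableOn_Ioc_of_le Real.two_pi_pos.le]
  have hm : MeasurableSet {τ | ε < ‖x - S.z j τ‖} :=
    (isOpen_lt continuous_const (by fun_prop)).measurableSet
  have h2 : IntegrableOn ({τ | ε < ‖x - S.z j τ‖}.indicator
      fun τ => ‖deriv (S.z j) τ‖ • f (S.z j τ)) (Set.Ioc 0 (2 * Real.pi)) := by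
    rw [IntegrableOn, integrable_indicator_iff hm, IntegrableOn, Measure.restrict_restrict hm]
    exact hI.mono_set fun τ hτ => ⟨Set.Ioc_subset_Icc_self hτ.2, (show ε < ‖x - S.z j τ‖ from hτ.1).le⟩
  refine h2.congr (Eventually.of_forall fun τ => ?_)
  beta_reduce
  by_cases h : ε < ‖x - S.z j τ‖ <;> simp [h]

/-- A weakly singular boundary integral is differentiable along the boundary, and its derivative is
the principal value of the integral of the differentiated kernel. -/
theorem arcDeriv_integral {k : Plane → Plane → ℂ} {g : Plane → Plane → Fin 2 → ℂ}
    (hk : SmoothOffDiagonal k) (hg : ∀ x y, x ≠ y → HasGrad (fun x' => k x' y) (g x y) x)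
    (hlog : ∀ j t₀, HasLogDiagonal t₀ Real.pi fun t τ => k (S.z j t) (S.z j τ))
    (hφ : IsHolderOn (frontier Ω) φ) {x : Plane} (hx : x ∈ frontier Ω) :
    S.ArcDifferentiableAt (fun x => S.integral fun y => k x y * φ y) x ∧
      S.PVTo (fun y => (g x y ⬝ᵥ perp (S.normal x)) * φ y) x
        (S.arcDeriv (fun x => S.integral fun y => k x y * φ y) x) := by
  have hφc : ContinuousOn φ (frontier Ω) := by
    obtain ⟨C, r, hr, h⟩ := hφ
    exact h.continuousOn hr
  have hmain : ∀ (j₀ : Fin S.n) (t₀ : ℝ), ∃ v : ℂ,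
      HasDerivAt (fun t => S.integral fun y => k (S.z j₀ t) y * φ y) v t₀ ∧
      Tendsto (S.truncIntegral (fun y => (g (S.z j₀ t₀) y ⬝ᵥ toC (deriv (S.z j₀) t₀)) * φ y)
        (S.z j₀ t₀)) (𝓝[>] 0) (𝓝 v) := by
    intro j₀ t₀
    have hj : ∀ j, ∃ v : ℂ, HasDerivAt (fun t => ∫ τ in Set.Ioc (t₀ - Real.pi) (t₀ + Real.pi),
          k (S.z j₀ t) (S.z j τ) * S.pullback φ j τ) v t₀ ∧
        Tendsto (fun ε : ℝ => ∫ τ in Set.Ioc (t₀ - Real.pi) (t₀ + Real.pi),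
          if ε < ‖S.z j₀ t₀ - S.z j τ‖ then
            (g (S.z j₀ t₀) (S.z j τ) ⬝ᵥ toC (deriv (S.z j₀) t₀)) * S.pullback φ j τ else 0)
          (𝓝[>] 0) (𝓝 v) := by
      intro j
      -- Only the curve through the point carries a singularity.
      rcases eq_or_ne j₀ j with rfl | hne
      · obtain ⟨C, r, hr, hH⟩ := S.exists_holder_pullback hφ j₀ t₀
        exact (S.isSmoothLoop j₀).exists_hasDerivAt_integral hk hg (hlog j₀ t₀)
          (S.continuous_pullback hφ j₀) hr hH
      · exact exists_hasDerivAt_integral_of_disjoint (S.isSmoothLoop j₀) (S.isSmoothLoop j)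
          (fun t τ h => hne (S.simple _ _ _ _ h).1) hk hg t₀ (S.continuous_pullback hφ j)
    choose v hv hv' using hj
    refine ⟨∑ j, v j, (HasDerivAt.fun_sum fun j _ => hv j).congr_of_eventuallyEq
      (Eventually.of_forall fun t => ?_), (tendsto_finsetSum _ fun j _ => hv' j).congr fun ε => ?_⟩
    · refine Finset.sum_congr rfl fun j _ => ?_
      rw [S.intervalIntegral_eq (fun y => k (S.z j₀ t) y * φ y) j t₀]
      refine integral_congr_ae (Eventually.of_forall fun τ => ?_)
      simp only [pullback, Complex.real_smul]; ring
    · refine Finset.sum_congr rfl fun j _ => ?_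
      refine Eq.trans ?_ (S.intervalIntegral_eq (fun y => open Classical in
        if ε < ‖S.z j₀ t₀ - y‖ then (g (S.z j₀ t₀) y ⬝ᵥ toC (deriv (S.z j₀) t₀)) * φ y else 0)
          j t₀).symm
      refine integral_congr_ae (Eventually.of_forall fun τ => ?_)
      beta_reduce
      by_cases h : ε < ‖S.z j₀ t₀ - S.z j τ‖
      · simp only [h, if_true, pullback, Complex.real_smul]; ring
      · simp [h]
  refine ⟨fun j t h => ?_, fun ε hε => S.integrable_trunc ?_ hε, ?_⟩
  · obtain ⟨v, hv, -⟩ := hmain j t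
    exact hv.differentiableAt
  · exact ((hk.continuousOn_grad_dotProduct hg x _).mono fun y hy => hy.2).mul
      (hφc.mono fun y hy => hy.1)
  · obtain ⟨j₀, t₀, rfl⟩ := S.exists_eq hx
    obtain ⟨v, hv, hv'⟩ := hmain j₀ t₀
    have hz := S.isSmoothLoop j₀
    have hpos : (‖deriv (S.z j₀) t₀‖ : ℂ) ≠ 0 := by
      exact_mod_cast (norm_pos_iff.2 (hz.regular t₀)).ne'
    -- Division by the speed turns the limit in the direction z'(t₀) into one in the direction ν^⊥.
    rw [S.arcDeriv_apply, hv.deriv, Complex.real_smul]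
    refine (hv'.const_mul _).congr fun ε => ?_
    rw [truncIntegral, truncIntegral, integral, integral, Finset.mul_sum]
    refine Finset.sum_congr rfl fun j _ => ?_
    rw [← intervalIntegral.integral_const_mul]
    refine intervalIntegral.integral_congr fun τ _ => ?_
    beta_reduce
    split_ifs
    · rw [hz.toC_deriv, dotProduct_smul, S.normal_apply, Complex.real_smul, Complex.real_smul]
      push_cast
      field_simp
      simp only [smul_eq_mul]; ring
    · simp

end SmoothBoundary

end

section

/-! ### Kernels of given order of singularity -/

/-- The kernel `k` on `G` is continuous off the diagonal and `O(|x - y|^{-a})`. -/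
def SingularOfOrder (G : Set Plane) (a : ℝ) (k : Plane → Plane → ℂ) : Prop :=
  ContinuousOn (fun w : Plane × Plane => k w.1 w.2) {w | w.1 ∈ G ∧ w.2 ∈ G ∧ w.1 ≠ w.2} ∧
    ∃ C : ℝ, ∀ x ∈ G, ∀ y ∈ G, x ≠ y → ‖k x y‖ ≤ C * ‖x - y‖ ^ (-a)

namespace SingularOfOrder

variable {G : Set Plane} {a b : ℝ} {k k' : Plane → Plane → ℂ}

theorem weaklySingularOn (h : SingularOfOrder G a k) (ha : 0 ≤ a) (ha1 : a < 1) :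
    WeaklySingularOn G k :=
  ⟨h.1, h.2.choose, a, ha, ha1, h.2.choose_spec⟩

theorem congr (h : SingularOfOrder G a k) (he : ∀ x y, x ≠ y → k' x y = k x y) :
    SingularOfOrder G a k' :=
  ⟨h.1.congr fun w hw => he _ _ hw.2.2, h.2.choose, fun x hx y hy hxy => by
    rw [he x y hxy]; exact h.2.choose_spec x hx y hy hxy⟩

theorem add (h : SingularOfOrder G a k) (h' : SingularOfOrder G a k') :
    SingularOfOrder G a fun x y => k x y + k' x y := by
  obtain ⟨hc, C, hC⟩ := h
  obtain ⟨hc', C', hC'⟩ := h'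
  refine ⟨hc.add hc', C + C', fun x hx y hy hxy => ?_⟩
  rw [add_mul]
  exact (norm_add_le _ _).trans (add_le_add (hC x hx y hy hxy) (hC' x hx y hy hxy))

theorem mul (h : SingularOfOrder G a k) (h' : SingularOfOrder G b k') :
    SingularOfOrder G (a + b) fun x y => k x y * k' x y := by
  obtain ⟨hc, C, hC⟩ := h
  obtain ⟨hc', C', hC'⟩ := h'
  refine ⟨hc.mul hc', C * C', fun x hx y hy hxy => ?_⟩
  have hpos : 0 < ‖x - y‖ := norm_pos_iff.2 (sub_ne_zero.2 hxy)
  have h1 := hC x hx y hy hxy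
  rw [norm_mul, neg_add, Real.rpow_add hpos]
  calc _ ≤ (C * ‖x - y‖ ^ (-a)) * (C' * ‖x - y‖ ^ (-b)) :=
        mul_le_mul h1 (hC' x hx y hy hxy) (norm_nonneg _) ((norm_nonneg _).trans h1)
    _ = _ := by ring

theorem const (e : ℂ) : SingularOfOrder G 0 fun _ _ => e :=
  ⟨continuousOn_const, ‖e‖, fun x _ y _ _ => by simp⟩

theorem const_mul (e : ℂ) (h : SingularOfOrder G a k) :
    SingularOfOrder G a fun x y => e * k x y := by
  simpa using (const e).mul h

theorem sub (h : SingularOfOrder G a k) (h' : SingularOfOrder G a k') :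
    SingularOfOrder G a fun x y => k x y - k' x y :=
  (h.add (h'.const_mul (-1))).congr fun x y _ => by ring

theorem of_smooth (hk : SmoothOffDiagonal k)
    (hb : ∃ C : ℝ, ∀ x ∈ G, ∀ y ∈ G, x ≠ y → ‖k x y‖ ≤ C * ‖x - y‖ ^ (-a)) :
    SingularOfOrder G a k :=
  ⟨(ContDiffOn.continuousOn hk).mono fun _ hw => hw.2.2, hb⟩

theorem dif (i : Fin 2) : SingularOfOrder G (-1) fun x y => dif x y i :=
  of_smooth (smoothOffDiagonal_dif i) ⟨1, fun x _ y _ _ => by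
    rw [neg_neg, Real.rpow_one, one_mul, Poro.dif, toC, toC, ← Complex.ofReal_sub,
      Complex.norm_real]
    exact PiLp.norm_apply_le (x - y) i⟩

theorem inv_normSq : SingularOfOrder G 2 fun x y => ((‖x - y‖ ^ 2 : ℝ) : ℂ)⁻¹ := by
  refine of_smooth (smoothOffDiagonal_comp_normSq (φ := fun s : ℝ => (s : ℂ)⁻¹) ?_)
    ⟨1, fun x _ y _ _ => ?_⟩
  · exact (Complex.ofRealCLM.contDiff.contDiffOn).inv fun ρ hρ => by
      simpa using (ne_of_gt hρ : ρ ≠ 0)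
  · rw [norm_inv, Complex.norm_real, Real.norm_of_nonneg (by positivity), one_mul,
      Real.rpow_neg (norm_nonneg _)]
    norm_num

end SingularOfOrder

theorem exists_norm_sub_le {G : Set Plane} (hG : Bornology.IsBounded G) :
    ∃ D : ℝ, 0 < D ∧ ∀ x ∈ G, ∀ y ∈ G, ‖x - y‖ ≤ D := by
  obtain ⟨D, hD⟩ := Metric.isBounded_iff.1 hG
  exact ⟨max D 1, by positivity, fun x hx y hy => by
    rw [← dist_eq_norm]; exact (hD hx hy).trans (le_max_left _ _)⟩

namespace SingularOfOrder

variable {G : Set Plane} {a b : ℝ} {k : Plane → Plane → ℂ}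

/-- On a bounded set |x-y|^{b-a} is bounded when a ≤ b. -/
theorem mono (h : SingularOfOrder G a k) (hG : Bornology.IsBounded G) (hab : a ≤ b) :
    SingularOfOrder G b k := by
  obtain ⟨hc, C, hC⟩ := h
  obtain ⟨D, hD0, hD⟩ := exists_norm_sub_le hG
  refine ⟨hc, |C| * D ^ (b - a), fun x hx y hy hxy => ?_⟩
  have hpos : 0 < ‖x - y‖ := norm_pos_iff.2 (sub_ne_zero.2 hxy)
  have h1 : ‖x - y‖ ^ (-a) = ‖x - y‖ ^ (b - a) * ‖x - y‖ ^ (-b) := by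
    rw [← Real.rpow_add hpos]; congr 1; ring
  have h2 := Real.rpow_le_rpow hpos.le (hD x hx y hy) (sub_nonneg.2 hab)
  calc _ ≤ C * ‖x - y‖ ^ (-a) := hC x hx y hy hxy
    _ ≤ |C| * ‖x - y‖ ^ (-a) := by gcongr; exact le_abs_self C
    _ ≤ |C| * (D ^ (b - a) * ‖x - y‖ ^ (-b)) := by rw [h1]; gcongr
    _ = _ := by ring

theorem ps (hG : Bornology.IsBounded G) (c : entireCoeff) : SingularOfOrder G 0 fun x y => ps (‖x - y‖ ^ 2) c := by
  obtain ⟨D, hD0, hD⟩ := exists_norm_sub_le hG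
  obtain ⟨C, hC⟩ := (isCompact_Icc (a := (0 : ℝ)) (b := D ^ 2)).exists_bound_of_continuousOn
    (contDiff_ps c).continuous.continuousOn
  refine of_smooth (smoothOffDiagonal_comp_normSq (contDiff_ps c).contDiffOn)
    ⟨C, fun x hx y hy _ => ?_⟩
  rw [neg_zero, Real.rpow_zero, mul_one]
  exact hC _ ⟨by positivity, pow_le_pow_left₀ (norm_nonneg _) (hD x hx y hy) 2⟩

theorem log_normSq (hG : Bornology.IsBounded G) :
    SingularOfOrder G (1 / 2) fun x y => (Real.log (‖x - y‖ ^ 2) : ℂ) := by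
  obtain ⟨D, hD0, hD⟩ := exists_norm_sub_le hG
  refine of_smooth (smoothOffDiagonal_comp_normSq (φ := fun s : ℝ => (Real.log s : ℂ))
    (Complex.ofRealCLM.contDiff.comp_contDiffOn
      (Real.contDiffOn_log.mono fun _ hs => (ne_of_gt hs))))
    ⟨2 * (2 + D ^ (1 + 1 / 2 : ℝ)), fun x hx y hy hxy => ?_⟩
  have hpos : 0 < ‖x - y‖ := norm_pos_iff.2 (sub_ne_zero.2 hxy)
  have h1 := abs_log_le_rpow hpos
  have h2 : ‖x - y‖ ≤ D ^ (1 + 1 / 2 : ℝ) * ‖x - y‖ ^ (-(1 / 2) : ℝ) := by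
    have h3 : ‖x - y‖ = ‖x - y‖ ^ (1 + 1 / 2 : ℝ) * ‖x - y‖ ^ (-(1 / 2) : ℝ) := by
      rw [← Real.rpow_add hpos]; norm_num
    have h4 := Real.rpow_le_rpow hpos.le (hD x hx y hy) (by norm_num : (0 : ℝ) ≤ 1 + 1 / 2)
    nth_rewrite 1 [h3]
    gcongr
  rw [Complex.norm_real, Real.norm_eq_abs, Real.log_pow, abs_mul]
  norm_num at h1 h2 ⊢
  linarith

theorem lr (hG : Bornology.IsBounded G) (p : Profile) :
    SingularOfOrder G (1 / 2) fun x y => lr (‖x - y‖ ^ 2) p := by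
  have h := (((log_normSq hG).mul (ps hG p.1)).mono hG (by norm_num : _ ≤ (1 / 2 : ℝ))).add
    ((ps hG p.2).mono hG (by norm_num : _ ≤ (1 / 2 : ℝ)))
  exact h.congr fun x y _ => by rw [lr_apply]

theorem lrGrad (hG : Bornology.IsBounded G) {p : Profile} (hp : logCoeff p = 0) (i : Fin 2) :
    SingularOfOrder G (1 / 2) fun x y => lrGrad p x y i := by
  have h := (((dif i).mul (lr hG (derivProfile p))).mono hG
    (by norm_num : _ ≤ (1 / 2 : ℝ))).const_mul 2
  exact h.congr fun x y _ => by rw [Poro.lrGrad, lr1_apply, hp]; ring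

/-- Without the leading logarithm the strongest terms are a logarithm and (x-y)_i(x-y)_j/ρ, which
has order -1 - 1 + 2 = 0. -/
theorem lrHess (hG : Bornology.IsBounded G) {p : Profile} (hp : logCoeff p = 0) (i j : Fin 2) :
    SingularOfOrder G (1 / 2) fun x y => lrHess p x y i j := by
  have h := ((lr hG (derivProfile p)).const_mul (if i = j then 2 else 0)).add
    (((((((dif i).mul (dif j)).mul inv_normSq).const_mul (logCoeff (derivProfile p))).mono hG
      (by norm_num : _ ≤ (1 / 2 : ℝ))).add ((((dif i).mul (dif j)).mul
        (lr hG (derivProfile (derivProfile p)))).mono hG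
          (by norm_num : _ ≤ (1 / 2 : ℝ)))).const_mul 4)
  exact h.congr fun x y _ => by
    rw [Poro.lrHess, lr2_apply, lr1_apply, lr1_apply, hp]; ring

end SingularOfOrder

/-! ### The normal along a smooth boundary -/

namespace SmoothBoundary

variable {Ω : Set Plane} (S : SmoothBoundary Ω)

theorem isCompact_range (j : Fin S.n) : IsCompact (Set.range (S.z j)) := by
  rw [← (S.periodic j).image_Icc Real.two_pi_pos 0]
  exact isCompact_Icc.image (S.isSmoothLoop j).continuous

/-- The boundary curves form a finite closed cover of the boundary. On each of them the
parametrization of a compact period is a quotient map, along which the normal is continuous. -/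
theorem continuousOn_normal : ContinuousOn S.normal (frontier Ω) := by
  rw [← S.range_eq]
  refine (locallyFinite_of_finite _).continuousOn_iUnion
    (fun j => (S.isCompact_range j).isClosed) fun j => ?_
  have hz := S.isSmoothLoop j
  set e : Set.Icc (0 : ℝ) (0 + 2 * Real.pi) → Set.range (S.z j) := fun t => ⟨S.z j t, t, rfl⟩ with he
  have hec : Continuous e := (hz.continuous.comp continuous_subtype_val).subtype_mk _
  have hes : Function.Surjective e := by
    rintro ⟨y, hy⟩
    rw [← (S.periodic j).image_Icc Real.two_pi_pos 0] at hy
    obtain ⟨t, ht, rfl⟩ := hy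
    exact ⟨⟨t, ht⟩, rfl⟩
  rw [continuousOn_iff_continuous_domRestrict,
    (hec.isClosedMap.isQuotientMap hec hes).continuous_iff]
  refine (hz.continuous_curveNormal.comp continuous_subtype_val).congr fun t => ?_
  exact (S.normal_apply j t).symm

theorem norm_normal {x : Plane} (hx : x ∈ frontier Ω) : ‖S.normal x‖ = 1 := by
  obtain ⟨j, t, rfl⟩ := S.exists_eq hx
  rw [S.normal_apply, (S.isSmoothLoop j).norm_curveNormal]

theorem singularOfOrder_normal (i : Fin 2) :
    SingularOfOrder (frontier Ω) 0 fun x _ => toC (S.normal x) i := by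
  have hL : Continuous fun v : Plane => toC v i :=
    (Complex.ofRealCLM ∘L (EuclideanSpace.proj i : Plane →L[ℝ] ℝ)).continuous
  refine ⟨hL.comp_continuousOn (S.continuousOn_normal.comp continuousOn_fst fun w hw => hw.1), 1,
    fun x hx y _ _ => ?_⟩
  have h := PiLp.norm_apply_le (S.normal x) i
  rw [S.norm_normal hx] at h
  rw [neg_zero, Real.rpow_zero, mul_one]
  beta_reduce
  rwa [toC, Complex.norm_real]

/-- The angle between the chord and the tangent is of the order of the length of the chord. -/
theorem singularOfOrder_normal_dotProduct_dif :
    SingularOfOrder (frontier Ω) (-2) fun x y => toC (S.normal x) ⬝ᵥ dif x y := by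
  have hc := (((S.singularOfOrder_normal 0).mul (SingularOfOrder.dif 0)).add
    ((S.singularOfOrder_normal 1).mul (SingularOfOrder.dif 1)))
  have hij : ∀ i j : Fin S.n, ∃ C : ℝ, 0 ≤ C ∧ ∀ t τ,
      ‖toC (S.normal (S.z i t)) ⬝ᵥ dif (S.z i t) (S.z j τ)‖ ≤ C * ‖S.z i t - S.z j τ‖ ^ 2 := by
    intro i j
    rcases eq_or_ne i j with rfl | hne
    · have hz := S.isSmoothLoop i
      obtain ⟨c, hc0, hc⟩ := hz.exists_chord
      obtain ⟨L, hL0, hL⟩ := hz.exists_normal_bound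
      refine ⟨L * (c ^ 2)⁻¹, by positivity, fun t τ => ?_⟩
      -- The chord estimate needs a representative of the second point within half a period of t.
      obtain ⟨τ', hτ', he⟩ : ∃ τ', |t - τ'| ≤ Real.pi ∧ S.z i τ = S.z i τ' := by
        obtain ⟨m, hm, -⟩ := existsUnique_sub_zsmul_mem_Ico Real.two_pi_pos τ (t - Real.pi)
        refine ⟨_, ?_, ((S.periodic i).sub_zsmul_eq m).symm⟩
        rw [abs_le]; constructor <;> linarith [hm.1, hm.2]
      rw [he, S.normal_apply]
      refine (hL t τ').trans ?_
      have h1 := (hc t τ' (by linarith)).2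
      rw [mul_assoc]
      refine mul_le_mul_of_nonneg_left ?_ hL0
      rw [le_inv_mul_iff₀ (by positivity), ← mul_pow]
      exact pow_le_pow_left₀ (by positivity) h1 2
    -- Distinct curves have a positive distance δ, so |x-y| ≤ |x-y|²/δ on them.
    · obtain ⟨δ, hδ, h⟩ := Metric.exists_pos_forall_lt_edist (S.isCompact_range i)
        (S.isCompact_range j).isClosed (by
          rw [Set.disjoint_left]
          rintro _ ⟨t, rfl⟩ ⟨τ, hτ⟩
          exact hne (S.simple _ _ _ _ hτ.symm).1)
      have hδ' : (0 : ℝ) < δ := hδ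
      refine ⟨2 * (δ : ℝ)⁻¹, by positivity, fun t τ => ?_⟩
      have h1 : (δ : ℝ) ≤ ‖S.z i t - S.z j τ‖ := by
        have h2 := h _ ⟨t, rfl⟩ _ ⟨τ, rfl⟩
        rw [edist_nndist, ENNReal.coe_lt_coe] at h2
        rw [← dist_eq_norm]
        exact_mod_cast h2.le
      have hn : ∀ l, ‖toC (S.normal (S.z i t)) l * dif (S.z i t) (S.z j τ) l‖ ≤
          ‖S.z i t - S.z j τ‖ := fun l => by
        rw [norm_mul, dif, toC, toC, toC, ← Complex.ofReal_sub, Complex.norm_real,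
          Complex.norm_real]
        have h3 := PiLp.norm_apply_le (S.normal (S.z i t)) l
        rw [S.norm_normal (S.mem_frontier i t)] at h3
        have h4 := PiLp.norm_apply_le (S.z i t - S.z j τ) l
        calc _ ≤ 1 * ‖S.z i t - S.z j τ‖ := mul_le_mul h3 h4 (norm_nonneg _) zero_le_one
          _ = _ := one_mul _
      rw [dotProduct, Fin.sum_univ_two]
      refine (norm_add_le _ _).trans ((add_le_add (hn 0) (hn 1)).trans ?_)
      have h5 : 1 ≤ (δ : ℝ)⁻¹ * ‖S.z i t - S.z j τ‖ := by
        rw [le_inv_mul_iff₀ hδ']; linarith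
      nlinarith [norm_nonneg (S.z i t - S.z j τ)]
  choose C hC0 hC using hij
  refine ⟨hc.1.congr fun w _ => by simp [dotProduct, Fin.sum_univ_two], ∑ i, ∑ j, C i j,
    fun x hx y hy _ => ?_⟩
  obtain ⟨i, t, rfl⟩ := S.exists_eq hx
  obtain ⟨j, τ, rfl⟩ := S.exists_eq hy
  rw [neg_neg, Real.rpow_ofNat]
  refine (hC i j t τ).trans (mul_le_mul_of_nonneg_right ?_ (by positivity))
  exact (Finset.single_le_sum (fun j _ => hC0 i j) (Finset.mem_univ j)).trans
    (Finset.single_le_sum (f := fun i => ∑ j, C i j)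
      (fun i _ => Finset.sum_nonneg fun j _ => hC0 i j) (Finset.mem_univ i))

/-- Normal derivatives of profiles are weakly singular. -/
theorem singularOfOrder_normal_dotProduct_lrGrad (hΩ : Bornology.IsBounded (frontier Ω))
    (p : Profile) : SingularOfOrder (frontier Ω) (1 / 2) fun x y =>
      toC (S.normal x) ⬝ᵥ lrGrad p x y := by
  have hd := S.singularOfOrder_normal_dotProduct_dif
  have h := ((((hd.mul SingularOfOrder.inv_normSq).const_mul (logCoeff p)).mono hΩ
    (by norm_num : _ ≤ (1 / 2 : ℝ))).add ((hd.mul (SingularOfOrder.lr hΩ (derivProfile p))).mono hΩ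
      (by norm_num : _ ≤ (1 / 2 : ℝ)))).const_mul 2
  refine h.congr fun x y _ => ?_
  simp only [dotProduct, Fin.sum_univ_two, lrGrad, lr1_apply]
  ring

/-- On the curve through x the chord estimate turns the bound into |τ-t₀|^{-1/2}, after the period
is centred at t₀. On the other curves the integrand is continuous. -/
theorem integrable_of_singularOfOrder {k : Plane → Plane → ℂ} {φ : Plane → ℂ}
    (hk : SingularOfOrder (frontier Ω) (1 / 2) k) (hφ : IsHolderOn (frontier Ω) φ) {x : Plane}
    (hx : x ∈ frontier Ω) : S.Integrable fun y => k x y * φ y := by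
  intro j
  obtain ⟨j₀, t₀, rfl⟩ := S.exists_eq hx
  have hz := S.isSmoothLoop j
  obtain ⟨hkc, C, hC⟩ := hk
  have hcx : ContinuousOn (fun y => k (S.z j₀ t₀) y) {y | y ∈ frontier Ω ∧ y ≠ S.z j₀ t₀} :=
    hkc.comp (by fun_prop : Continuous fun y : Plane => (S.z j₀ t₀, y)).continuousOn
      fun y hy => ⟨hx, hy.1, Ne.symm hy.2⟩
  have hψ := S.continuous_pullback hφ j
  have heq : (fun τ => ‖deriv (S.z j) τ‖ • (k (S.z j₀ t₀) (S.z j τ) * φ (S.z j τ))) =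
      fun τ => k (S.z j₀ t₀) (S.z j τ) * S.pullback φ j τ := by
    funext τ; simp only [pullback, Complex.real_smul]; ring
  beta_reduce
  rw [heq]
  rcases eq_or_ne j₀ j with rfl | hne
  · have hper : Function.Periodic (fun τ => k (S.z j₀ t₀) (S.z j₀ τ) * S.pullback φ j₀ τ)
        (2 * Real.pi) := fun τ => by
      simp only [pullback]
      rw [hz.periodic_deriv, S.periodic j₀]
    refine hper.intervalIntegrable (t := t₀ - Real.pi) Real.two_pi_pos.ne' ?_ _ _
    obtain ⟨c, hc0, hc⟩ := hz.exists_chord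
    have hch : ∀ τ ∈ Set.Ioc (t₀ - Real.pi) (t₀ + Real.pi), c * |τ - t₀| ≤ ‖S.z j₀ t₀ - S.z j₀ τ‖ :=
      fun τ hτ => by
        rw [abs_sub_comm]
        refine (hc t₀ τ ?_).2
        rw [abs_le]; constructor <;> linarith [hτ.1, hτ.2]
    have hneq : ∀ τ ∈ Set.Ioc (t₀ - Real.pi) (t₀ + Real.pi), τ ≠ t₀ → S.z j₀ t₀ ≠ S.z j₀ τ := by
      intro τ hτ h
      rw [← sub_ne_zero, ← norm_pos_iff]
      exact (mul_pos hc0 (abs_pos.2 (sub_ne_zero.2 h))).trans_le (hch τ hτ)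
    obtain ⟨B, hB⟩ := (isCompact_Icc (a := t₀ - Real.pi)
      (b := t₀ + Real.pi)).exists_bound_of_continuousOn hψ.continuousOn
    rw [show t₀ - Real.pi + 2 * Real.pi = t₀ + Real.pi by ring,
      intervalIntegrable_iff_integrableOn_Ioc_of_le (by linarith [Real.pi_pos])]
    refine Integrable.mono' ((integrableOn_abs_sub_rpow t₀
      (by norm_num : (-1 : ℝ) < -(1 / 2)) _ _).const_mul (|C| * c ^ (-(1 / 2) : ℝ) * B)) ?_ ?_
    · exact (aestronglyMeasurable_restrict_Ioc (t := t₀) (hcx.comp hz.continuous.continuousOn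
        fun τ hτ => ⟨S.mem_frontier j₀ τ, (hneq τ hτ.1 hτ.2).symm⟩)).mul
          hψ.aestronglyMeasurable
    · filter_upwards [ae_ne _ t₀, ae_restrict_mem measurableSet_Ioc] with τ hτ hτW
      have hp : 0 < |τ - t₀| := abs_pos.2 (sub_ne_zero.2 hτ)
      have h1 := hC _ hx _ (S.mem_frontier j₀ τ) (hneq τ hτW hτ)
      have h2 : ‖S.z j₀ t₀ - S.z j₀ τ‖ ^ (-(1 / 2) : ℝ) ≤ c ^ (-(1 / 2) : ℝ) * |τ - t₀| ^ (-(1 / 2) : ℝ) := by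
        rw [← Real.mul_rpow hc0.le hp.le]
        exact Real.rpow_le_rpow_of_nonpos (mul_pos hc0 hp) (hch τ hτW) (by norm_num)
      rw [norm_mul]
      calc _ ≤ (|C| * (c ^ (-(1 / 2) : ℝ) * |τ - t₀| ^ (-(1 / 2) : ℝ))) * B := by
            refine mul_le_mul (h1.trans ?_) (hB τ (Set.Ioc_subset_Icc_self hτW)) (norm_nonneg _)
              (by positivity)
            exact mul_le_mul (le_abs_self C) h2 (by positivity) (abs_nonneg _)
        _ = _ := by ring
  · refine Continuous.intervalIntegrable (Continuous.mul ?_ hψ) _ _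
    exact hcx.comp_continuous hz.continuous fun τ =>
      ⟨S.mem_frontier j τ, fun h => hne (S.simple _ _ _ _ h).1.symm⟩

end SmoothBoundary

end

section

/-! ### The kernels of the regularized operators -/

theorem IsSmoothLoop.ne_of_abs_sub_le {z : ℝ → Plane} (hz : IsSmoothLoop z) {t₀ t τ : ℝ}
    (ht : |t - t₀| < 1) (hτ : |τ - t₀| ≤ Real.pi) (h : t ≠ τ) : z t ≠ z τ := by
  obtain ⟨c, hc0, hc⟩ := hz.exists_chord
  have := abs_sub_le t t₀ τ
  rw [abs_sub_comm t₀ τ] at this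
  have h1 := (hc t τ (by linarith)).2
  rw [← sub_ne_zero, ← norm_pos_iff]
  exact (mul_pos hc0 (abs_pos.2 (sub_ne_zero.2 h))).trans_le h1

/-- Kernels whose boundary integrals may be differentiated along the boundary: smooth off the
diagonal and, along the boundary, weakly singular with at most a logarithm and a function with a
weakly singular derivative. -/
structure SmoothBoundary.IsRegularKernel {Ω : Set Plane} (S : SmoothBoundary Ω)
    (k : Plane → Plane → ℂ) : Prop where
  smooth : SmoothOffDiagonal k
  log : ∀ j t₀, HasLogDiagonal t₀ Real.pi fun t τ => k (S.z j t) (S.z j τ)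
  singular : SingularOfOrder (frontier Ω) (1 / 2) k

namespace SmoothBoundary.IsRegularKernel

variable {Ω : Set Plane} {S : SmoothBoundary Ω} {k k' : Plane → Plane → ℂ}

theorem add (h : S.IsRegularKernel k) (h' : S.IsRegularKernel k') :
    S.IsRegularKernel fun x y => k x y + k' x y :=
  ⟨h.smooth.add h'.smooth, fun j t₀ => (h.log j t₀).add Real.pi_pos (h'.log j t₀),
    h.singular.add h'.singular⟩

theorem const_mul (e : ℂ) (h : S.IsRegularKernel k) : S.IsRegularKernel fun x y => e * k x y :=
  ⟨h.smooth.const_mul e, fun j t₀ => (h.log j t₀).const_mul Real.pi_pos e, h.singular.const_mul e⟩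

theorem congr (h : S.IsRegularKernel k) (he : ∀ x y, x ≠ y → k' x y = k x y) :
    S.IsRegularKernel k' :=
  ⟨h.smooth.congr he, fun j t₀ => (h.log j t₀).congr Real.pi_pos fun _ _ ht hτ hne =>
    he _ _ ((S.isSmoothLoop j).ne_of_abs_sub_le ht hτ hne), h.singular.congr he⟩

theorem sub (h : S.IsRegularKernel k) (h' : S.IsRegularKernel k') :
    S.IsRegularKernel fun x y => k x y - k' x y :=
  (h.add (h'.const_mul (-1))).congr fun x y _ => by ring

variable (S) in
theorem lr (hΩ : Bornology.IsBounded (frontier Ω)) (p : Profile) :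
    S.IsRegularKernel fun x y => lr (‖x - y‖ ^ 2) p :=
  ⟨smoothOffDiagonal_lr p, fun j _ => (S.isSmoothLoop j).hasLogDiagonal_lr p,
    SingularOfOrder.lr hΩ p⟩

variable (S) in
theorem lrGrad (hΩ : Bornology.IsBounded (frontier Ω)) {p : Profile} (hp : logCoeff p = 0)
    (i : Fin 2) : S.IsRegularKernel fun x y => lrGrad p x y i :=
  ⟨smoothOffDiagonal_lrGrad p i,
    fun j _ => ((S.isSmoothLoop j).mildlySingular_lrGrad hp i).hasLogDiagonal,
    SingularOfOrder.lrGrad hΩ hp i⟩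

variable (S) in
theorem lrHess (hΩ : Bornology.IsBounded (frontier Ω)) {p : Profile} (hp : logCoeff p = 0)
    (i j : Fin 2) : S.IsRegularKernel fun x y => lrHess p x y i j :=
  ⟨smoothOffDiagonal_lrHess p i j, fun l _ => (S.isSmoothLoop l).hasLogDiagonal_lrHess hp i j,
    SingularOfOrder.lrHess hΩ hp i j⟩

end SmoothBoundary.IsRegularKernel

/-- The value does not depend on k, so every combination of fundamental solutions whose weights sum
to 0 loses its leading logarithm. -/
theorem logCoeff_helmProfile (k : ℂ) : logCoeff (helmProfile k) = -(1 / (4 * Real.pi)) := by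
  simp [logCoeff, helmProfile, coeffJ]

theorem logCoeff_helmProfile_sub (k k' : ℂ) :
    logCoeff (helmProfile k - helmProfile k') = 0 := by
  rw [map_sub, logCoeff_helmProfile, logCoeff_helmProfile, sub_self]

variable {P : Medium} {k₁ k₂ : ℂ} {Ω : Set Plane}

/-- The weights 1, -(k_p²-k₂²)/(k₁²-k₂²) and (k_p²-k₁²)/(k₁²-k₂²) sum to 0. -/
theorem Medium.logCoeff_psiProfile (hne : k₁ ^ 2 ≠ k₂ ^ 2) :
    logCoeff (P.psiProfile k₁ k₂) = 0 := by
  have h := sub_ne_zero.2 hne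
  simp only [psiProfile, map_add, map_sub, map_smul, logCoeff_helmProfile, smul_eq_mul]
  field_simp
  ring

namespace SmoothBoundary

variable (S : SmoothBoundary Ω)

theorem isRegularKernel_helm (hΩ : Bornology.IsBounded (frontier Ω)) {k : ℂ} (hk : k ≠ 0) :
    S.IsRegularKernel (helm k) :=
  (IsRegularKernel.lr S hΩ (helmProfile k)).congr fun _ _ h => helm_eq hk h

theorem isRegularKernel_grad (hΩ : Bornology.IsBounded (frontier Ω)) (hk : P.IsWaveNumbers k₁ k₂)
    (i : Fin 2) :
    S.IsRegularKernel fun x y => grad (fun x' => helm k₁ x' y - helm k₂ x' y) x i :=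
  (IsRegularKernel.lrGrad S hΩ (logCoeff_helmProfile_sub k₁ k₂) i).congr
    fun _ _ h => congrFun (Medium.grad_helm_sub hk h) i

theorem isRegularKernel_E11 (hΩ : Bornology.IsBounded (frontier Ω)) (hne : k₁ ^ 2 ≠ k₂ ^ 2)
    (hk : P.IsWaveNumbers k₁ k₂) (i j : Fin 2) :
    S.IsRegularKernel fun x y => P.E11 k₁ k₂ x y i j :=
  (((IsRegularKernel.lr S hΩ (helmProfile P.kS)).const_mul (if i = j then 1 / (P.mu : ℂ) else 0)).add
    ((IsRegularKernel.lrHess S hΩ (Medium.logCoeff_psiProfile (P := P) hne) i j).const_mul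
      P.hessCoeff)).congr fun _ _ h => Medium.E11_eq hk h i j

theorem isRegularKernel_E22 (hΩ : Bornology.IsBounded (frontier Ω)) (hk : P.IsWaveNumbers k₁ k₂) :
    S.IsRegularKernel (P.E22 k₁ k₂) :=
  (((S.isRegularKernel_helm hΩ hk.ne_zero.1).const_mul _).sub
    ((S.isRegularKernel_helm hΩ hk.ne_zero.2).const_mul _)).const_mul _

theorem isRegularKernel_ker_1_2 (hΩ : Bornology.IsBounded (frontier Ω)) (hne : k₁ ^ 2 ≠ k₂ ^ 2)
    (hk : P.IsWaveNumbers k₁ k₂) (i j : Fin 2) :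
    S.IsRegularKernel fun x y => P.ker_1_2 k₁ k₂ x y i j := by
  have h : ∀ m : Fin 2, S.IsRegularKernel fun x y => rotA i m * (2 * (P.mu : ℂ) *
      P.E11 k₁ k₂ x y m j - (if m = j then 1 else 0) * helm P.kS x y) := fun m =>
    (((S.isRegularKernel_E11 hΩ hne hk m j).const_mul _).sub
      ((S.isRegularKernel_helm hΩ P.kS_ne).const_mul _)).const_mul _
  refine ((h 0).add (h 1)).congr fun x y _ => ?_
  simp only [Medium.ker_1_2, Matrix.mul_apply, Fin.sum_univ_two, Matrix.sub_apply,
    Matrix.smul_apply, Matrix.one_apply, smul_eq_mul]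
  congr 2 <;> split_ifs <;> ring

theorem isRegularKernel_ker_2_2 (hΩ : Bornology.IsBounded (frontier Ω))
    (hk : P.IsWaveNumbers k₁ k₂) (i : Fin 2) :
    S.IsRegularKernel fun x y => P.ker_2_2 k₁ k₂ x y i := by
  refine ((((S.isRegularKernel_grad hΩ hk 0).const_mul (rotA i 0)).add
    ((S.isRegularKernel_grad hΩ hk 1).const_mul (rotA i 1))).const_mul
      (-(2 * (P.mu : ℂ) * P.gam / (((P.lam + 2 * P.mu : ℝ) : ℂ) * (k₁ ^ 2 - k₂ ^ 2))))).congr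
        fun x y _ => ?_
  simp only [Medium.ker_2_2, Pi.smul_apply, smul_eq_mul, Matrix.mulVec, dotProduct,
    Fin.sum_univ_two]

theorem isRegularKernel_ker_3_2 (hΩ : Bornology.IsBounded (frontier Ω))
    (hk : P.IsWaveNumbers k₁ k₂) (i : Fin 2) :
    S.IsRegularKernel fun x y => P.ker_3_2 k₁ k₂ x y i := by
  refine ((((S.isRegularKernel_grad hΩ hk 0).const_mul (rotA 0 i)).add
    ((S.isRegularKernel_grad hΩ hk 1).const_mul (rotA 1 i))).const_mul (P.C0 k₁ k₂)).congr
        fun x y _ => ?_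
  simp only [Medium.ker_3_2, Pi.smul_apply, smul_eq_mul, Matrix.vecMul, dotProduct,
    Fin.sum_univ_two]
  ring

theorem singularOfOrder_normal_mul {k : Plane → Plane → ℂ}
    (hk : SingularOfOrder (frontier Ω) (1 / 2) k) (i : Fin 2) :
    SingularOfOrder (frontier Ω) (1 / 2) fun x y => toC (S.normal x) i * k x y := by
  simpa using (S.singularOfOrder_normal i).mul hk

/-- All gradients are of differences of fundamental solutions except the one of γ_{k_s}, which
enters only as a normal derivative. -/
theorem singularOfOrder_ker_1_1 (hΩ : Bornology.IsBounded (frontier Ω))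
    (hk : P.IsWaveNumbers k₁ k₂) (i j : Fin 2) :
    SingularOfOrder (frontier Ω) (1 / 2) fun x y => S.ker_1_1 P k₁ k₂ x y i j := by
  have h1 := SingularOfOrder.lrGrad hΩ (logCoeff_helmProfile_sub P.kS k₁) j
  have h2 := SingularOfOrder.lrGrad hΩ (logCoeff_helmProfile_sub k₁ k₂) j
  have h3 := (S.singularOfOrder_normal_dotProduct_lrGrad hΩ (helmProfile P.kS)).const_mul
    (if i = j then 1 else 0)
  have h4 := (S.singularOfOrder_normal_mul ((S.isRegularKernel_grad hΩ hk j).singular.const_mul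
    (Complex.I * (P.omega : ℂ) * P.gam /
      (((P.lam + 2 * P.mu : ℝ) : ℂ) * (k₁ ^ 2 - k₂ ^ 2)))) i).const_mul (P.alpha : ℂ)
  refine (((S.singularOfOrder_normal_mul ((h1.const_mul (-1)).add (h2.const_mul
    ((k₂ ^ 2 - P.q) / (k₁ ^ 2 - k₂ ^ 2)))) i).add h3).sub h4).congr fun x y h => ?_
  rw [S.ker_1_1_eq hk h, lrGrad_sub, lrGrad_sub, Medium.E12, Pi.smul_apply, smul_eq_mul]
  split_ifs <;> ring

theorem singularOfOrder_ker_2_1 (hΩ : Bornology.IsBounded (frontier Ω))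
    (hk : P.IsWaveNumbers k₁ k₂) (i : Fin 2) :
    SingularOfOrder (frontier Ω) (1 / 2) fun x y => S.ker_2_1 P k₁ k₂ x y i := by
  have h := ((((S.isRegularKernel_helm hΩ hk.ne_zero.1).const_mul (k₁ ^ 2)).sub
    ((S.isRegularKernel_helm hΩ hk.ne_zero.2).const_mul (k₂ ^ 2))).const_mul
      (P.gam / (k₁ ^ 2 - k₂ ^ 2))).sub ((S.isRegularKernel_E22 hΩ hk).const_mul P.alpha)
  refine (S.singularOfOrder_normal_mul h.singular i).congr fun x y _ => ?_
  simp only [ker_2_1, Pi.sub_apply, Pi.smul_apply, smul_eq_mul]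
  ring

theorem singularOfOrder_ker_3_1 (hΩ : Bornology.IsBounded (frontier Ω)) (hne : k₁ ^ 2 ≠ k₂ ^ 2)
    (hk : P.IsWaveNumbers k₁ k₂) (i : Fin 2) :
    SingularOfOrder (frontier Ω) (1 / 2) fun x y => S.ker_3_1 P k₁ k₂ x y i := by
  have h1 := ((S.isRegularKernel_helm hΩ hk.ne_zero.1).const_mul (k₁ ^ 2)).sub
    ((S.isRegularKernel_helm hΩ hk.ne_zero.2).const_mul (k₂ ^ 2))
  have h2 := fun m => S.singularOfOrder_normal_mul (S.isRegularKernel_E11 hΩ hne hk m i).singular m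
  refine ((((h2 0).add (h2 1)).const_mul (-(Complex.I * (P.omega : ℂ) * P.beta))).add
    ((S.singularOfOrder_normal_mul h1.singular i).const_mul (P.C0 k₁ k₂))).congr fun x y _ => ?_
  simp only [ker_3_1, Pi.add_apply, Pi.smul_apply, smul_eq_mul, Matrix.vecMul, dotProduct,
    Fin.sum_univ_two]
  ring

/-- The two weights sum to -1, so the leading logarithm remains and its gradient is strongly
singular; the product with the normal makes it weak. -/
theorem singularOfOrder_ker_4_1 (hΩ : Bornology.IsBounded (frontier Ω))
    (hk : P.IsWaveNumbers k₁ k₂) :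
    SingularOfOrder (frontier Ω) (1 / 2) (S.ker_4_1 P k₁ k₂) := by
  have h1 := fun m => S.singularOfOrder_normal_mul (S.isRegularKernel_grad hΩ hk m).singular m
  have hp := S.singularOfOrder_normal_dotProduct_lrGrad hΩ (helmProfile k₁)
  have hq := S.singularOfOrder_normal_dotProduct_lrGrad hΩ (helmProfile k₂)
  refine (((((h1 0).add (h1 1)).const_mul (Complex.I * (P.omega : ℂ) * P.beta *
    (-P.gam / (((P.lam + 2 * P.mu : ℝ) : ℂ) * (k₁ ^ 2 - k₂ ^ 2))))).add
    ((hp.const_mul ((P.kP ^ 2 - k₁ ^ 2) / (k₁ ^ 2 - k₂ ^ 2))).sub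
      (hq.const_mul ((P.kP ^ 2 - k₂ ^ 2) / (k₁ ^ 2 - k₂ ^ 2))))).const_mul (-1)).congr
        fun x y h => ?_
  rw [S.ker_4_1_eq hk h]
  simp only [dotProduct, Fin.sum_univ_two, Medium.E21, Pi.smul_apply, smul_eq_mul]
  ring

end SmoothBoundary

end

section

/-! ### Calculus of principal values and arc length derivatives -/

namespace SmoothBoundary

variable {Ω : Set Plane} (S : SmoothBoundary Ω)
variable {W W' : Type*} [NormedAddCommGroup W] [NormedSpace ℝ W]
  [NormedAddCommGroup W'] [NormedSpace ℝ W']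

theorem Integrable.congr {S : SmoothBoundary Ω} {f g : Plane → W} (h : S.Integrable f)
    (he : ∀ y ∈ frontier Ω, g y = f y) : S.Integrable g := by
  intro j
  have : (fun t => ‖deriv (S.z j) t‖ • g (S.z j t)) = fun t => ‖deriv (S.z j) t‖ • f (S.z j t) :=
    funext fun t => by rw [he _ (S.mem_frontier j t)]
  rw [this]
  exact h j

theorem integral_congr {f g : Plane → W} (he : ∀ y ∈ frontier Ω, g y = f y) :
    S.integral g = S.integral f :=
  Finset.sum_congr rfl fun j _ => intervalIntegral.integral_congr fun t _ => by
    beta_reduce; rw [he _ (S.mem_frontier j t)]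

theorem Integrable.add {S : SmoothBoundary Ω} {f g : Plane → W} (hf : S.Integrable f)
    (hg : S.Integrable g) : S.Integrable fun y => f y + g y := fun j => by
  simpa only [smul_add] using (hf j).add (hg j)

theorem integral_add {f g : Plane → W} (hf : S.Integrable f) (hg : S.Integrable g) :
    S.integral (fun y => f y + g y) = S.integral f + S.integral g := by
  simp only [integral, ← Finset.sum_add_distrib, smul_add]
  exact Finset.sum_congr rfl fun j _ => intervalIntegral.integral_add (hf j) (hg j)

theorem Integrable.of_components {S : SmoothBoundary Ω} {f : Plane → Fin 2 → ℂ}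
    (h : ∀ i, S.Integrable fun y => f y i) : S.Integrable f := fun j =>
  ⟨MeasureTheory.Integrable.of_eval fun i => (h i j).1, MeasureTheory.Integrable.of_eval fun i => (h i j).2⟩

theorem Integrable.prodMk {S : SmoothBoundary Ω} {f : Plane → W} {g : Plane → W'}
    (hf : S.Integrable f) (hg : S.Integrable g) : S.Integrable fun y => (f y, g y) := fun j =>
  ⟨(hf j).1.prodMk (hg j).1, (hf j).2.prodMk (hg j).2⟩

theorem map_integral [CompleteSpace W] [CompleteSpace W'] (L : W →L[ℝ] W') {f : Plane → W}
    (hf : S.Integrable f) : L (S.integral f) = S.integral fun y => L (f y) := by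
  rw [integral, map_sum]
  refine Finset.sum_congr rfl fun j _ => ?_
  rw [← ContinuousLinearMap.intervalIntegral_comp_comm L (hf j)]
  simp only [map_smul]

theorem integral_apply {f : Plane → Fin 2 → ℂ} (hf : S.Integrable f) (i : Fin 2) :
    S.integral f i = S.integral fun y => f y i :=
  S.map_integral (ContinuousLinearMap.proj i : (Fin 2 → ℂ) →L[ℝ] ℂ) hf

variable {S} {x : Plane}

theorem PVTo.hasPV {f : Plane → W} {v : W} (h : S.PVTo f x v) : S.HasPV f x := ⟨h.1, v, h.2⟩

theorem PVTo.pv_eq {f : Plane → W} {v : W} (h : S.PVTo f x v) : S.pv f x = v := h.2.limUnder_eq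

/-- Every cutoff discards y = x, so the value there is irrelevant. -/
theorem PVTo.congr {f g : Plane → W} {v : W} (h : S.PVTo f x v) (he : ∀ y, x ≠ y → g y = f y) :
    S.PVTo g x v := by
  have h1 : ∀ ε : ℝ, 0 < ε → (fun y => open Classical in if ε < ‖x - y‖ then g y else 0) =
      fun y => open Classical in if ε < ‖x - y‖ then f y else 0 := by
    intro ε hε
    funext y
    by_cases hy : ε < ‖x - y‖
    · rw [if_pos hy, if_pos hy, he y (sub_ne_zero.1 (norm_pos_iff.1 (hε.trans hy)))]
    · rw [if_neg hy, if_neg hy]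
  refine ⟨fun ε hε => by rw [h1 ε hε]; exact h.1 ε hε, h.2.congr' ?_⟩
  filter_upwards [self_mem_nhdsWithin] with ε hε
  rw [truncIntegral, truncIntegral, h1 ε hε]

theorem PVTo.add {f g : Plane → W} {v w : W} (hf : S.PVTo f x v) (hg : S.PVTo g x w) :
    S.PVTo (fun y => f y + g y) x (v + w) := by
  have h1 : ∀ ε : ℝ, (fun y => open Classical in if ε < ‖x - y‖ then f y + g y else 0) =
      fun y => (open Classical in if ε < ‖x - y‖ then f y else 0) +
        (open Classical in if ε < ‖x - y‖ then g y else 0) := fun ε => by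
    funext y; split_ifs <;> simp
  refine ⟨fun ε hε => by rw [h1]; exact (hf.1 ε hε).add (hg.1 ε hε),
    (hf.2.add hg.2).congr' ?_⟩
  filter_upwards [self_mem_nhdsWithin] with ε hε
  rw [truncIntegral, truncIntegral, truncIntegral, h1, S.integral_add (hf.1 ε hε) (hg.1 ε hε)]

theorem PVTo.of_components {f : Plane → Fin 2 → ℂ} {v : Fin 2 → ℂ}
    (h : ∀ i, S.PVTo (fun y => f y i) x (v i)) : S.PVTo f x v := by
  have h1 : ∀ (ε : ℝ) (i : Fin 2), (fun y => (open Classical in if ε < ‖x - y‖ then f y else 0) i) =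
      fun y => open Classical in if ε < ‖x - y‖ then f y i else 0 := fun ε i => by
    funext y; split_ifs <;> rfl
  have hI : ∀ ε : ℝ, 0 < ε →
      S.Integrable fun y => open Classical in if ε < ‖x - y‖ then f y else 0 := fun ε hε =>
    Integrable.of_components fun i => by rw [h1]; exact (h i).1 ε hε
  refine ⟨hI, tendsto_pi_nhds.2 fun i => (h i).2.congr' ?_⟩
  filter_upwards [self_mem_nhdsWithin] with ε hε
  rw [truncIntegral, truncIntegral, S.integral_apply (hI ε hε), h1]

theorem PVTo.prodMk [CompleteSpace W] [CompleteSpace W'] {f : Plane → W × W'} {v : W × W'}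
    (hf : S.PVTo (fun y => (f y).1) x v.1) (hg : S.PVTo (fun y => (f y).2) x v.2) :
    S.PVTo f x v := by
  have h1 : ∀ ε : ℝ, (fun y => open Classical in if ε < ‖x - y‖ then f y else 0) =
      fun y => (open Classical in if ε < ‖x - y‖ then (f y).1 else 0,
        open Classical in if ε < ‖x - y‖ then (f y).2 else 0) := fun ε => by
    funext y; split_ifs <;> rfl
  have hI : ∀ ε : ℝ, 0 < ε →
      S.Integrable fun y => open Classical in if ε < ‖x - y‖ then f y else 0 := fun ε hε => by
    rw [h1]; exact (hf.1 ε hε).prodMk (hg.1 ε hε)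
  refine ⟨hI, (hf.2.prodMk_nhds hg.2).congr' ?_⟩
  filter_upwards [self_mem_nhdsWithin] with ε hε
  have h2 := S.map_integral (ContinuousLinearMap.fst ℝ W W') (hI ε hε)
  have h3 := S.map_integral (ContinuousLinearMap.snd ℝ W W') (hI ε hε)
  refine Prod.ext ?_ ?_
  · refine Eq.trans ?_ h2.symm
    simp only [truncIntegral]
    refine congrArg S.integral (funext fun y => ?_)
    simp only [ContinuousLinearMap.coe_fst']; split_ifs <;> rfl
  · refine Eq.trans ?_ h3.symm
    simp only [truncIntegral]
    refine congrArg S.integral (funext fun y => ?_)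
    simp only [ContinuousLinearMap.coe_snd']; split_ifs <;> rfl

/-- The point x is attained for at most countably many parameters, so the cutoffs exhaust almost
everything and dominated convergence applies. -/
theorem PVTo.of_integrable {f : Plane → ℂ}
    (hf : ContinuousOn f {y | y ∈ frontier Ω ∧ y ≠ x}) (hI : S.Integrable f) :
    S.PVTo f x (S.integral f) := by
  refine ⟨fun ε hε => S.integrable_trunc hf hε, tendsto_finsetSum _ fun j _ => ?_⟩
  have hz := S.isSmoothLoop j
  have hzc := hz.continuous
  have hIj := hI j
  rw [intervalIntegrable_iff_integrableOn_Ioc_of_le Real.two_pi_pos.le] at hIj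
  have h0 : ∀ᵐ τ ∂volume.restrict (Set.Ioc (0 : ℝ) (2 * Real.pi)), 0 < ‖x - S.z j τ‖ := by
    refine ae_restrict_of_ae ?_
    have hc : {τ | S.z j τ = x}.Countable := by
      rcases Set.eq_empty_or_nonempty {τ | S.z j τ = x} with h | ⟨τ₀, h⟩
      · rw [h]; exact Set.countable_empty
      · refine (Set.countable_range fun m : ℤ => τ₀ + m * (2 * Real.pi)).mono fun τ hτ => ?_
        obtain ⟨m, hm⟩ := hz.simple τ₀ τ (Eq.trans h (Eq.symm hτ))
        exact ⟨m, hm.symm⟩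
    filter_upwards [hc.ae_notMem volume] with τ hτ
    exact norm_pos_iff.2 (sub_ne_zero.2 fun h => hτ h.symm)
  have h := tendsto_integral_truncation hIj (D := fun τ => ‖x - S.z j τ‖)
    (Continuous.measurable (by fun_prop)) h0
  rw [intervalIntegral.integral_of_le Real.two_pi_pos.le]
  refine h.congr fun ε => ?_
  rw [intervalIntegral.integral_of_le Real.two_pi_pos.le]
  refine integral_congr_ae (Eventually.of_forall fun τ => ?_)
  beta_reduce
  by_cases hτ : ε < ‖x - S.z j τ‖ <;> simp [hτ]

theorem ArcDifferentiableAt.congr {f g : Plane → W} (hf : S.ArcDifferentiableAt f x)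
    (he : ∀ y ∈ frontier Ω, g y = f y) : S.ArcDifferentiableAt g x := fun j t h => by
  have : (fun s => g (S.z j s)) = fun s => f (S.z j s) :=
    funext fun s => he _ (S.mem_frontier j s)
  rw [this]; exact hf j t h

theorem arcDeriv_congr {f g : Plane → W} (hx : x ∈ frontier Ω)
    (he : ∀ y ∈ frontier Ω, g y = f y) : S.arcDeriv g x = S.arcDeriv f x := by
  obtain ⟨j, t, rfl⟩ := S.exists_eq hx
  have : (fun s => g (S.z j s)) = fun s => f (S.z j s) :=
    funext fun s => he _ (S.mem_frontier j s)
  rw [S.arcDeriv_apply, S.arcDeriv_apply, this]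

theorem ArcDifferentiableAt.add {f g : Plane → W} (hf : S.ArcDifferentiableAt f x)
    (hg : S.ArcDifferentiableAt g x) : S.ArcDifferentiableAt (fun y => f y + g y) x :=
  fun j t h => (hf j t h).add (hg j t h)

theorem arcDeriv_add {f g : Plane → W} (hx : x ∈ frontier Ω) (hf : S.ArcDifferentiableAt f x)
    (hg : S.ArcDifferentiableAt g x) :
    S.arcDeriv (fun y => f y + g y) x = S.arcDeriv f x + S.arcDeriv g x := by
  obtain ⟨j, t, rfl⟩ := S.exists_eq hx
  rw [S.arcDeriv_apply, S.arcDeriv_apply, S.arcDeriv_apply,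
    deriv_fun_add (hf j t rfl) (hg j t rfl), smul_add]

theorem ArcDifferentiableAt.of_components {f : Plane → Fin 2 → ℂ}
    (h : ∀ i, S.ArcDifferentiableAt (fun y => f y i) x) : S.ArcDifferentiableAt f x :=
  fun j t hx => differentiableAt_pi.2 fun i => h i j t hx

theorem arcDeriv_apply_component {f : Plane → Fin 2 → ℂ} (hx : x ∈ frontier Ω)
    (h : S.ArcDifferentiableAt f x) (i : Fin 2) :
    S.arcDeriv f x i = S.arcDeriv (fun y => f y i) x := by
  obtain ⟨j, t, rfl⟩ := S.exists_eq hx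
  rw [S.arcDeriv_apply, S.arcDeriv_apply, Pi.smul_apply,
    deriv_pi (differentiableAt_pi.1 (h j t rfl))]

end SmoothBoundary

/-! ### Regularization -/

namespace SmoothBoundary

variable {Ω : Set Plane}

/-- The principal value of the integral of `f` at `x` is `F₁ + dF₂/ds`. -/
def Regularizes (S : SmoothBoundary Ω) (F₁ F₂ : Plane → ℂ) (f : Plane → ℂ) (x : Plane) : Prop :=
  S.ArcDifferentiableAt F₂ x ∧ S.PVTo f x (F₁ x + S.arcDeriv F₂ x)

variable {S : SmoothBoundary Ω} {F₁ F₂ G₁ G₂ f g : Plane → ℂ} {x : Plane}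

theorem Regularizes.add (hx : x ∈ frontier Ω) (hf : S.Regularizes F₁ F₂ f x)
    (hg : S.Regularizes G₁ G₂ g x) :
    S.Regularizes (fun x => F₁ x + G₁ x) (fun x => F₂ x + G₂ x) (fun y => f y + g y) x := by
  refine ⟨hf.1.add hg.1, ?_⟩
  have h := hf.2.add hg.2
  rwa [arcDeriv_add hx hf.1 hg.1, add_add_add_comm]

theorem Regularizes.congr (hx : x ∈ frontier Ω) (hf : S.Regularizes F₁ F₂ f x)
    (h₁ : ∀ y ∈ frontier Ω, G₁ y = F₁ y) (h₂ : ∀ y ∈ frontier Ω, G₂ y = F₂ y)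
    (he : ∀ y, x ≠ y → g y = f y) : S.Regularizes G₁ G₂ g x := by
  refine ⟨hf.1.congr h₂, ?_⟩
  rw [arcDeriv_congr hx h₂, h₁ x hx]
  exact hf.2.congr he

theorem continuousOn_mul_of_singularOfOrder {k : Plane → Plane → ℂ} {φ : Plane → ℂ}
    (hk : SingularOfOrder (frontier Ω) (1 / 2) k) (hφ : IsHolderOn (frontier Ω) φ)
    (hx : x ∈ frontier Ω) : ContinuousOn (fun y => k x y * φ y) {y | y ∈ frontier Ω ∧ y ≠ x} := by
  obtain ⟨C, r, hr, h⟩ := hφ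
  exact (hk.1.comp (by fun_prop : Continuous fun y : Plane => (x, y)).continuousOn
    fun y hy => ⟨hx, hy.1, Ne.symm hy.2⟩).mul ((h.continuousOn hr).mono fun y hy => hy.1)

theorem regularizes_of_singularOfOrder {k : Plane → Plane → ℂ} {φ : Plane → ℂ}
    (hk : SingularOfOrder (frontier Ω) (1 / 2) k) (hφ : IsHolderOn (frontier Ω) φ)
    (hx : x ∈ frontier Ω) :
    S.Regularizes (fun x => S.integral fun y => k x y * φ y) (fun _ => 0)
      (fun y => k x y * φ y) x := by
  refine ⟨fun j t _ => differentiableAt_const _, ?_⟩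
  have h0 : S.arcDeriv (fun _ => (0 : ℂ)) x = 0 := by
    obtain ⟨j, t, rfl⟩ := S.exists_eq hx
    rw [S.arcDeriv_apply]; simp
  rw [h0, add_zero]
  exact PVTo.of_integrable (continuousOn_mul_of_singularOfOrder hk hφ hx)
    (S.integrable_of_singularOfOrder hk hφ hx)

/-- The principal value of the k₁ part is its integral, that of the tangential gradient is the
derivative of the potential of k₂, and principal values add. -/
theorem regularizes {k₁ k₂ : Plane → Plane → ℂ} {g : Plane → Plane → Fin 2 → ℂ} {φ : Plane → ℂ}
    (hk₁ : SingularOfOrder (frontier Ω) (1 / 2) k₁) (hk₂ : S.IsRegularKernel k₂)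
    (hg : ∀ x y, x ≠ y → HasGrad (fun x' => k₂ x' y) (g x y) x)
    (hφ : IsHolderOn (frontier Ω) φ) (hx : x ∈ frontier Ω) :
    S.Regularizes (fun x => S.integral fun y => k₁ x y * φ y)
      (fun x => S.integral fun y => k₂ x y * φ y)
      (fun y => (k₁ x y + g x y ⬝ᵥ perp (S.normal x)) * φ y) x := by
  have h2 := S.arcDeriv_integral hk₂.smooth hg hk₂.log hφ hx
  refine ⟨h2.1, ?_⟩
  have h1 := (PVTo.of_integrable (continuousOn_mul_of_singularOfOrder hk₁ hφ hx)
    (S.integrable_of_singularOfOrder hk₁ hφ hx)).add h2.2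
  exact h1.congr fun y _ => by rw [add_mul]

end SmoothBoundary

theorem IsHolderOn.component {G : Set Plane} {u : Plane → Fin 2 → ℂ} (hu : IsHolderOn G u)
    (i : Fin 2) : IsHolderOn G fun y => u y i := by
  obtain ⟨C, r, hr, h⟩ := hu
  exact ⟨C, r, hr, fun x hx y hy => (edist_le_pi_edist (u x) (u y) i).trans (h x hx y hy)⟩

end

section

/-! ### The blocks of the strongly singular operator -/

namespace SmoothBoundary

variable {Ω : Set Plane} (S : SmoothBoundary Ω) {x : Plane}

theorem integrable_mulVec {M : Plane → Plane → Matrix (Fin 2) (Fin 2) ℂ} {u : Plane → Fin 2 → ℂ}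
    (hM : ∀ i j, SingularOfOrder (frontier Ω) (1 / 2) fun x y => M x y i j)
    (hu : IsHolderOn (frontier Ω) u) (hx : x ∈ frontier Ω) :
    S.Integrable fun y => M x y *ᵥ u y :=
  Integrable.of_components fun i => ((S.integrable_of_singularOfOrder (hM i 0) (hu.component 0) hx).add
    (S.integrable_of_singularOfOrder (hM i 1) (hu.component 1) hx)).congr fun y _ => by
      simp [Matrix.mulVec, dotProduct, Fin.sum_univ_two]

theorem integral_mulVec {M : Plane → Plane → Matrix (Fin 2) (Fin 2) ℂ} {u : Plane → Fin 2 → ℂ}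
    (hM : ∀ i j, SingularOfOrder (frontier Ω) (1 / 2) fun x y => M x y i j)
    (hu : IsHolderOn (frontier Ω) u) (hx : x ∈ frontier Ω) (i : Fin 2) :
    S.integral (fun y => M x y *ᵥ u y) i =
      S.integral (fun y => M x y i 0 * u y 0) + S.integral (fun y => M x y i 1 * u y 1) := by
  rw [S.integral_apply (S.integrable_mulVec hM hu hx),
    ← S.integral_add (S.integrable_of_singularOfOrder (hM i 0) (hu.component 0) hx)
      (S.integrable_of_singularOfOrder (hM i 1) (hu.component 1) hx)]
  exact S.integral_congr fun y _ => by simp [Matrix.mulVec, dotProduct, Fin.sum_univ_two]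

theorem integrable_dotProduct {M : Plane → Plane → Fin 2 → ℂ} {u : Plane → Fin 2 → ℂ}
    (hM : ∀ i, SingularOfOrder (frontier Ω) (1 / 2) fun x y => M x y i)
    (hu : IsHolderOn (frontier Ω) u) (hx : x ∈ frontier Ω) :
    S.Integrable fun y => M x y ⬝ᵥ u y :=
  ((S.integrable_of_singularOfOrder (hM 0) (hu.component 0) hx).add
    (S.integrable_of_singularOfOrder (hM 1) (hu.component 1) hx)).congr fun y _ => by
      simp [dotProduct, Fin.sum_univ_two]

theorem integral_dotProduct {M : Plane → Plane → Fin 2 → ℂ} {u : Plane → Fin 2 → ℂ}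
    (hM : ∀ i, SingularOfOrder (frontier Ω) (1 / 2) fun x y => M x y i)
    (hu : IsHolderOn (frontier Ω) u) (hx : x ∈ frontier Ω) :
    S.integral (fun y => M x y ⬝ᵥ u y) =
      S.integral (fun y => M x y 0 * u y 0) + S.integral (fun y => M x y 1 * u y 1) := by
  rw [← S.integral_add (S.integrable_of_singularOfOrder (hM 0) (hu.component 0) hx)
      (S.integrable_of_singularOfOrder (hM 1) (hu.component 1) hx)]
  exact S.integral_congr fun y _ => by simp [dotProduct, Fin.sum_univ_two]

theorem integrable_smul {M : Plane → Plane → Fin 2 → ℂ} {p : Plane → ℂ}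
    (hM : ∀ i, SingularOfOrder (frontier Ω) (1 / 2) fun x y => M x y i)
    (hp : IsHolderOn (frontier Ω) p) (hx : x ∈ frontier Ω) :
    S.Integrable fun y => p y • M x y :=
  Integrable.of_components fun i => (S.integrable_of_singularOfOrder (hM i) hp hx).congr fun y _ => by
    simp [mul_comm]

theorem integral_smul {M : Plane → Plane → Fin 2 → ℂ} {p : Plane → ℂ}
    (hM : ∀ i, SingularOfOrder (frontier Ω) (1 / 2) fun x y => M x y i)
    (hp : IsHolderOn (frontier Ω) p) (hx : x ∈ frontier Ω) (i : Fin 2) :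
    S.integral (fun y => p y • M x y) i = S.integral fun y => M x y i * p y := by
  rw [S.integral_apply (S.integrable_smul hM hp hx)]
  exact S.integral_congr fun y _ => by simp [mul_comm]

variable {P : Medium} {k₁ k₂ : ℂ} {u : Plane → Fin 2 → ℂ} {p : Plane → ℂ}

theorem regularizes_KP1 (hΩ : Bornology.IsBounded (frontier Ω)) (hne : k₁ ^ 2 ≠ k₂ ^ 2)
    (hk : P.IsWaveNumbers k₁ k₂) (hu : IsHolderOn (frontier Ω) u) (hx : x ∈ frontier Ω) (i : Fin 2) :
    S.Regularizes (fun x => S.KP1_1 P k₁ k₂ u x i) (fun x => S.KP1_2 P k₁ k₂ u x i)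
      (fun y => (S.KPintegrand P k₁ k₂ (fun y => (u y, 0)) x y).1 i) x := by
  have h := fun j => regularizes (S.singularOfOrder_ker_1_1 hΩ hk i j)
    (S.isRegularKernel_ker_1_2 hΩ hne hk i j)
    (fun _ _ hxy => Medium.hasGrad_ker_1_2 hk hxy i j) (hu.component j) hx
  refine ((h 0).add hx (h 1)).congr hx
    (fun y hy => S.integral_mulVec (S.singularOfOrder_ker_1_1 hΩ hk) hu hy i)
    (fun y hy => S.integral_mulVec
      (fun i j => (S.isRegularKernel_ker_1_2 hΩ hne hk i j).singular) hu hy i) fun y hxy => ?_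
  rw [KPintegrand, S.neumann_ETmul_fst hne hk hxy]
  ring

theorem regularizes_KP2 (hΩ : Bornology.IsBounded (frontier Ω)) (hne : k₁ ^ 2 ≠ k₂ ^ 2)
    (hk : P.IsWaveNumbers k₁ k₂) (hp : IsHolderOn (frontier Ω) p) (hx : x ∈ frontier Ω) (i : Fin 2) :
    S.Regularizes (fun x => S.KP2_1 P k₁ k₂ p x i) (fun x => S.KP2_2 P k₁ k₂ p x i)
      (fun y => (S.KPintegrand P k₁ k₂ (fun y => (0, p y)) x y).1 i) x := by
  refine (regularizes (S.singularOfOrder_ker_2_1 hΩ hk i) (S.isRegularKernel_ker_2_2 hΩ hk i)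
    (fun _ _ hxy => Medium.hasGrad_ker_2_2 hk hxy i) hp hx).congr hx
    (fun y hy => S.integral_smul (S.singularOfOrder_ker_2_1 hΩ hk) hp hy i)
    (fun y hy => S.integral_smul
      (fun i => (S.isRegularKernel_ker_2_2 hΩ hk i).singular) hp hy i) fun y hxy => ?_
  rw [KPintegrand, S.neumann_ETmul_fst hne hk hxy]
  simp only [Pi.zero_apply]
  ring

theorem regularizes_KP3 (hΩ : Bornology.IsBounded (frontier Ω)) (hne : k₁ ^ 2 ≠ k₂ ^ 2)
    (hk : P.IsWaveNumbers k₁ k₂) (hu : IsHolderOn (frontier Ω) u) (hx : x ∈ frontier Ω) :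
    S.Regularizes (S.KP3_1 P k₁ k₂ u) (S.KP3_2 P k₁ k₂ u)
      (fun y => (S.KPintegrand P k₁ k₂ (fun y => (u y, 0)) x y).2) x := by
  have h := fun j => regularizes (S.singularOfOrder_ker_3_1 hΩ hne hk j)
    (S.isRegularKernel_ker_3_2 hΩ hk j)
    (fun _ _ hxy => Medium.hasGrad_ker_3_2 hk hxy j) (hu.component j) hx
  refine ((h 0).add hx (h 1)).congr hx
    (fun y hy => S.integral_dotProduct (S.singularOfOrder_ker_3_1 hΩ hne hk) hu hy)
    (fun y hy => S.integral_dotProduct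
      (fun i => (S.isRegularKernel_ker_3_2 hΩ hk i).singular) hu hy) fun y hxy => ?_
  rw [KPintegrand, S.neumann_ETmul_snd hk hxy]
  ring

theorem regularizes_KP4 (hΩ : Bornology.IsBounded (frontier Ω))
    (hk : P.IsWaveNumbers k₁ k₂) (hp : IsHolderOn (frontier Ω) p) (hx : x ∈ frontier Ω) :
    S.Regularizes (S.KP4_1 P k₁ k₂ p) (S.KP4_2 p)
      (fun y => (S.KPintegrand P k₁ k₂ (fun y => (0, p y)) x y).2) x := by
  refine (regularizes_of_singularOfOrder (S.singularOfOrder_ker_4_1 hΩ hk) hp hx).congr hx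
    (fun y hy => rfl) (fun y hy => rfl) fun y hxy => ?_
  rw [KPintegrand, S.neumann_ETmul_snd hk hxy]
  simp only [Pi.zero_apply]
  ring

end SmoothBoundary

end

end

end Poro

/-! ### The regularized formulas -/

theorem mainTheorem2
    (Ω : Set Plane) (hΩo : IsOpen Ω) (hΩc : IsConnected Ω) (hΩb : Bornology.IsBounded Ω)
    (S : SmoothBoundary Ω) (P : Medium) (k₁ k₂ : ℂ)
    (hk : P.IsWaveNumbers k₁ k₂) (hne : k₁ ^ 2 ≠ k₂ ^ 2) :
    -- the kernels of the operators on the right-hand sides are weakly singular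
    ((∀ i j, WeaklySingularOn (frontier Ω) fun x y => S.ker_1_1 P k₁ k₂ x y i j) ∧
      (∀ i j, WeaklySingularOn (frontier Ω) fun x y => P.ker_1_2 k₁ k₂ x y i j) ∧
      (∀ i, WeaklySingularOn (frontier Ω) fun x y => S.ker_2_1 P k₁ k₂ x y i) ∧
      (∀ i, WeaklySingularOn (frontier Ω) fun x y => P.ker_2_2 k₁ k₂ x y i) ∧
      (∀ i, WeaklySingularOn (frontier Ω) fun x y => S.ker_3_1 P k₁ k₂ x y i) ∧
      (∀ i, WeaklySingularOn (frontier Ω) fun x y => P.ker_3_2 k₁ k₂ x y i) ∧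
      WeaklySingularOn (frontier Ω) (S.ker_4_1 P k₁ k₂)) ∧
    ∀ (u : Plane → Fin 2 → ℂ) (p : Plane → ℂ), IsHolderOn (frontier Ω) u → IsHolderOn (frontier Ω) p →
      ∀ x ∈ frontier Ω,
        -- the principal value defining `K'` exists
        S.HasPV (S.KPintegrand P k₁ k₂ (fun y => (u y, p y)) x) x ∧
        S.HasPV (S.KPintegrand P k₁ k₂ (fun y => (u y, 0)) x) x ∧
        S.HasPV (S.KPintegrand P k₁ k₂ (fun y => (0, p y)) x) x ∧
        S.KP P k₁ k₂ (fun y => (u y, p y)) x =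
          (S.KP1 P k₁ k₂ u x + S.KP2 P k₁ k₂ p x, S.KP3 P k₁ k₂ u x + S.KP4 P k₁ k₂ p x) ∧
        -- the integrals on the right-hand sides exist
        S.Integrable (fun y => S.ker_1_1 P k₁ k₂ x y *ᵥ u y) ∧
        S.Integrable (fun y => P.ker_1_2 k₁ k₂ x y *ᵥ u y) ∧
        S.Integrable (fun y => p y • S.ker_2_1 P k₁ k₂ x y) ∧
        S.Integrable (fun y => p y • P.ker_2_2 k₁ k₂ x y) ∧
        S.Integrable (fun y => S.ker_3_1 P k₁ k₂ x y ⬝ᵥ u y) ∧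
        S.Integrable (fun y => P.ker_3_2 k₁ k₂ x y ⬝ᵥ u y) ∧
        S.Integrable (fun y => S.ker_4_1 P k₁ k₂ x y * p y) ∧
        -- the four regularized formulas
        (S.ArcDifferentiableAt (S.KP1_2 P k₁ k₂ u) x ∧
          S.KP1 P k₁ k₂ u x = S.KP1_1 P k₁ k₂ u x + S.arcDeriv (S.KP1_2 P k₁ k₂ u) x) ∧
        (S.ArcDifferentiableAt (S.KP2_2 P k₁ k₂ p) x ∧
          S.KP2 P k₁ k₂ p x = S.KP2_1 P k₁ k₂ p x + S.arcDeriv (S.KP2_2 P k₁ k₂ p) x) ∧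
        (S.ArcDifferentiableAt (S.KP3_2 P k₁ k₂ u) x ∧
          S.KP3 P k₁ k₂ u x = S.KP3_1 P k₁ k₂ u x + S.arcDeriv (S.KP3_2 P k₁ k₂ u) x) ∧
        (S.ArcDifferentiableAt (S.KP4_2 p) x ∧
          S.KP4 P k₁ k₂ p x =
            S.KP4_1 P k₁ k₂ p x + S.arcDeriv (S.KP4_2 p) x) := by
  have hΩ : Bornology.IsBounded (frontier Ω) := hΩb.closure.subset frontier_subset_closure
  have hw : ∀ {k : Plane → Plane → ℂ}, SingularOfOrder (frontier Ω) (1 / 2) k →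
      WeaklySingularOn (frontier Ω) k := fun h => h.weaklySingularOn (by norm_num) (by norm_num)
  have s11 := S.singularOfOrder_ker_1_1 (P := P) hΩ hk
  have s12 := fun i j => (S.isRegularKernel_ker_1_2 (P := P) hΩ hne hk i j).singular
  have s21 := S.singularOfOrder_ker_2_1 (P := P) hΩ hk
  have s22 := fun i => (S.isRegularKernel_ker_2_2 (P := P) hΩ hk i).singular
  have s31 := S.singularOfOrder_ker_3_1 (P := P) hΩ hne hk
  have s32 := fun i => (S.isRegularKernel_ker_3_2 (P := P) hΩ hk i).singular
  have s41 := S.singularOfOrder_ker_4_1 (P := P) hΩ hk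
  refine ⟨⟨fun i j => hw (s11 i j), fun i j => hw (s12 i j), fun i => hw (s21 i),
    fun i => hw (s22 i), fun i => hw (s31 i), fun i => hw (s32 i), hw s41⟩, fun u p hu hp x hx => ?_⟩
  have r1 := S.regularizes_KP1 hΩ hne hk hu hx
  have r2 := S.regularizes_KP2 hΩ hne hk hp hx
  have r3 := S.regularizes_KP3 hΩ hne hk hu hx
  have r4 := S.regularizes_KP4 hΩ hk hp hx
  have d1 : S.ArcDifferentiableAt (S.KP1_2 P k₁ k₂ u) x :=
    SmoothBoundary.ArcDifferentiableAt.of_components fun i => (r1 i).1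
  have d2 : S.ArcDifferentiableAt (S.KP2_2 P k₁ k₂ p) x :=
    SmoothBoundary.ArcDifferentiableAt.of_components fun i => (r2 i).1
  have hu0 : S.PVTo (S.KPintegrand P k₁ k₂ (fun y => (u y, 0)) x) x
      (S.KP1_1 P k₁ k₂ u x + S.arcDeriv (S.KP1_2 P k₁ k₂ u) x,
        S.KP3_1 P k₁ k₂ u x + S.arcDeriv (S.KP3_2 P k₁ k₂ u) x) :=
    SmoothBoundary.PVTo.prodMk (SmoothBoundary.PVTo.of_components fun i => by
      dsimp only
      rw [Pi.add_apply, SmoothBoundary.arcDeriv_apply_component hx d1]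
      exact (r1 i).2) r3.2
  have hp0 : S.PVTo (S.KPintegrand P k₁ k₂ (fun y => (0, p y)) x) x
      (S.KP2_1 P k₁ k₂ p x + S.arcDeriv (S.KP2_2 P k₁ k₂ p) x,
        S.KP4_1 P k₁ k₂ p x + S.arcDeriv (S.KP4_2 p) x) :=
    SmoothBoundary.PVTo.prodMk (SmoothBoundary.PVTo.of_components fun i => by
      dsimp only
      rw [Pi.add_apply, SmoothBoundary.arcDeriv_apply_component hx d2]
      exact (r2 i).2) r4.2
  -- Off the diagonal the integrand is additive in the density, by the pointwise formulas, so its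
  -- principal value is the sum of those for (u, 0) and (0, p).
  have hup : S.PVTo (S.KPintegrand P k₁ k₂ (fun y => (u y, p y)) x) x _ :=
    (hu0.add hp0).congr fun y hxy => by
      refine Prod.ext (funext fun i => ?_) ?_
      · rw [Prod.fst_add, Pi.add_apply, SmoothBoundary.KPintegrand, SmoothBoundary.KPintegrand,
          SmoothBoundary.KPintegrand, S.neumann_ETmul_fst hne hk hxy,
          S.neumann_ETmul_fst hne hk hxy, S.neumann_ETmul_fst hne hk hxy]
        simp only [Pi.zero_apply]
        ring
      · rw [Prod.snd_add, SmoothBoundary.KPintegrand, SmoothBoundary.KPintegrand,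
          SmoothBoundary.KPintegrand, S.neumann_ETmul_snd hk hxy,
          S.neumann_ETmul_snd hk hxy, S.neumann_ETmul_snd hk hxy]
        simp only [Pi.zero_apply]
        ring
  -- Limits are unique, so the operators defined by `limUnder` take the values found; the block form
  -- and the four formulas are their components.
  have e := hup.pv_eq
  have e1 := hu0.pv_eq
  have e2 := hp0.pv_eq
  refine ⟨hup.hasPV, hu0.hasPV, hp0.hasPV, ?_, S.integrable_mulVec s11 hu hx,
    S.integrable_mulVec s12 hu hx, S.integrable_smul s21 hp hx, S.integrable_smul s22 hp hx,
    S.integrable_dotProduct s31 hu hx, S.integrable_dotProduct s32 hu hx,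
    S.integrable_of_singularOfOrder s41 hp hx, ⟨d1, congrArg Prod.fst e1⟩,
    ⟨d2, congrArg Prod.fst e2⟩, ⟨r3.1, congrArg Prod.snd e1⟩, ⟨r4.1, congrArg Prod.snd e2⟩⟩
  rw [SmoothBoundary.KP1, SmoothBoundary.KP2, SmoothBoundary.KP3, SmoothBoundary.KP4,
    SmoothBoundary.KP, SmoothBoundary.KP, SmoothBoundary.KP, e, e1, e2]
  rfl
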